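/- **Definitions.** A *category with families* (CwF) is a category with a chosen terminal object, presheaves $\mathsf{Ty}$ of types and $\mathsf{Tm}$ of terms with a natural typing map $\mathsf{Tm}\to\mathsf{Ty}$, and chosen context extensions $\Gamma.A$ representing the terms of (substitution instances of) $A$. A $(\Sigma,\Pi_{\mathsf{rep}})$-*CwF* is a CwF equipped with a presheaf $\mathsf{RepTy}$ of representable types and a natural map $\mathsf{RepTy}\to\mathsf{Ty}$, with $\mathbf 1$- and $\Sigma$-types on both $\mathsf{Ty}$ and $\mathsf{RepTy}$, and with types $\Pi(A,B)$ for $A$ representable and $B$ an arbitrary type depending on $A$; morphisms are functors with actions on types, representable types and terms that preserve all the structure strictly. A *second-order generalized algebraic theory* (SOGAT) is a cellular small $(\Sigma,\Pi_{\mathsf{rep}})$-CwF $\mathcal T$: in the category of small $(\Sigma,\Pi_{\mathsf{rep}})$-CwFs and strict morphisms, the map $\mathbf 0\to\mathcal T$ from the initial object is a sequential ($\omega$-indexed) composition of pushouts of (small) coproducts of the generic extensions $$\mathsf{Free}(\Gamma\vdash)\to\mathsf{Free}(\Gamma\vdash A\ \mathsf{type}),\qquad \mathsf{Free}(\Gamma\vdash)\to\mathsf{Free}(\Gamma\vdash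 A\ \mathsf{type}_{\mathsf{rep}}),$$ $$\mathsf{Free}(\Gamma\vdash A\ \mathsf{type})\to\mathsf{Free}(\Gamma\vdash a:A),\qquad \mathsf{Free}(\Gamma\vdash x,y:A)\to\mathsf{Free}(\Gamma\vdash x=y:A).$$ A *model of extensional type theory* is a CwF with $\mathbf 1$-, $\Sigma$-, $\Pi$- and extensional equality types. For a small category $\mathcal C$, the presheaf category $\widehat{\mathcal C}$ is such a model: the types over a presheaf $X$ are the dependent presheaves over $X$ (presheaves over the category of elements of $X$), the terms are their sections, and $\mathbf 1,\Sigma,\Pi$ and equality are the usual ones. It is a $(\Sigma,\Pi_{\mathsf{rep}})$-CwF whose representable types are the locally representable dependent presheaves. An *internal model* of $\mathcal T$ in a $(\Sigma,\Pi_{\mathsf{rep}})$-CwF $\mathcal D$ is a strict $(\Sigma,\Pi_{\mathsf{rep}})$-CwF morphism $\mathcal T\to\mathcal D$. **Theorem.** Let $\mathcal T$ be any SOGAT. Then the model $\widehat{\mathcal T}$ of extensional type theory has an internal model $y:\mathcal T\to\widehat{\mathcal T}$ of $\mathcal T$ which is bijective on terms: for every object $\Gamma$ and every type $A$ over $\Gamma$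 in $\mathcal T$, the map $a\mapsto y(a)$ is a bijection from the terms of type $A$ in $\mathcal T$ to the terms of type $y(A)$ over $y(\Gamma)$ in $\widehat{\mathcal T}$. Moreover, $y$ is a strict replacement of the Yoneda embedding $\mathbb{y}$, which sends a type $A$ over $\Gamma$ to the dependent presheaf $(\rho:\Delta\to\Gamma)\mapsto\{\text{terms of type }A[\rho]\}$ over $\mathbb{y}(\Gamma)$ and a term $a$ to the section $\rho\mapsto a[\rho]$: there is a $2$-cell $\mathbb{y}\cong y$, that is, a natural isomorphism $\alpha:\mathbb{y}\cong y$ of functors $\mathcal T\to\widehat{\mathcal T}$ together with isomorphisms $\psi_A:\mathbb{y}(A)\cong y(A)[\alpha_\Gamma]$ of dependent presheaves over $\mathbb{y}(\Gamma)$ for all types $A$ over $\Gamma$, such that for all $\sigma:\Delta\to\Gamma$ and all terms $a$ of type $A[\sigma]$ over $\Delta$, the isomorphism $\psi_A[\mathbb{y}(\sigma)]$ sends the section $\mathbb{y}(a)$ to $y(a)[\alpha_\Delta]$. -/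

import Mathlib

open CategoryTheory Opposite

set_option linter.checkUnivs false

universe w u v u₁ v₁ u₂ v₂ u₃ v₃

/-- A category with families: a category with a chosen terminal object, together with presheaves
`Ty` of types and `Tm` of terms, a natural map `tp` giving the type of a term, and chosen context
extensions `ext Γ A` representing the terms of (substitution instances of) `A`. The terms of type
`A` in context `Γ` are the `t : Tm Γ` with `tp t = A`. -/
structure CwF where
  Obj : Type u
  [cat : Category.{v} Obj]
  nil : Obj
  nilIsTerminal : Limits.IsTerminal nil
  Ty : Obj → Type u
  tySub : ∀ {Δ Γ : Obj}, (Δ ⟶ Γ) → Ty Γ → Ty Δ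
  tySub_id : ∀ {Γ : Obj} (A : Ty Γ), tySub (𝟙 Γ) A = A
  tySub_comp : ∀ {Θ Δ Γ : Obj} (τ : Θ ⟶ Δ) (σ : Δ ⟶ Γ) (A : Ty Γ),
    tySub (τ ≫ σ) A = tySub τ (tySub σ A)
  Tm : Obj → Type u
  tmSub : ∀ {Δ Γ : Obj}, (Δ ⟶ Γ) → Tm Γ → Tm Δ
  tmSub_id : ∀ {Γ : Obj} (t : Tm Γ), tmSub (𝟙 Γ) t = t
  tmSub_comp : ∀ {Θ Δ Γ : Obj} (τ : Θ ⟶ Δ) (σ : Δ ⟶ Γ) (t : Tm Γ),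
    tmSub (τ ≫ σ) t = tmSub τ (tmSub σ t)
  tp : ∀ {Γ : Obj}, Tm Γ → Ty Γ
  tp_sub : ∀ {Δ Γ : Obj} (σ : Δ ⟶ Γ) (t : Tm Γ), tp (tmSub σ t) = tySub σ (tp t)
  ext : ∀ (Γ : Obj), Ty Γ → Obj
  p : ∀ {Γ : Obj} (A : Ty Γ), ext Γ A ⟶ Γ
  q : ∀ {Γ : Obj} (A : Ty Γ), Tm (ext Γ A)
  tp_q : ∀ {Γ : Obj} (A : Ty Γ), tp (q A) = tySub (p A) A
  lift : ∀ {Δ Γ : Obj} (σ : Δ ⟶ Γ) (A : Ty Γ) (a : Tm Δ), tp a = tySub σ A → (Δ ⟶ ext Γ A)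
  lift_p : ∀ {Δ Γ : Obj} (σ : Δ ⟶ Γ) (A : Ty Γ) (a : Tm Δ) (h : tp a = tySub σ A),
    lift σ A a h ≫ p A = σ
  lift_q : ∀ {Δ Γ : Obj} (σ : Δ ⟶ Γ) (A : Ty Γ) (a : Tm Δ) (h : tp a = tySub σ A),
    tmSub (lift σ A a h) (q A) = a
  lift_unique : ∀ {Δ Γ : Obj} (A : Ty Γ) (τ τ' : Δ ⟶ ext Γ A),
    τ ≫ p A = τ' ≫ p A → tmSub τ (q A) = tmSub τ' (q A) → τ = τ'

attribute [instance] CwF.cat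

namespace CwF

/-- The weakening `σ↑ : Δ.A' ⟶ Γ.A` of a substitution `σ : Δ ⟶ Γ`, where `A' = A[σ]`. -/
def up (C : CwF.{u, v}) {Δ Γ : C.Obj} (σ : Δ ⟶ Γ) (A : C.Ty Γ) (A' : C.Ty Δ)
    (h : A' = C.tySub σ A) : C.ext Δ A' ⟶ C.ext Γ A :=
  C.lift (C.p A' ≫ σ) A (C.q A') (by rw [C.tp_q, h, C.tySub_comp])

/-- The substitution `⟨id, a⟩ : Γ ⟶ Γ.A` given by a term `a` of type `A`. -/
def inst (C : CwF.{u, v}) {Γ : C.Obj} (A : C.Ty Γ) (a : C.Tm Γ) (h : C.tp a = A) :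
    Γ ⟶ C.ext Γ A :=
  C.lift (𝟙 Γ) A a (by rw [h, C.tySub_id])

/-- A restriction of the family of types: a presheaf `Ty'` with a natural map `ι` to `Ty`. -/
structure Restriction (C : CwF.{u, v}) where
  Ty' : C.Obj → Type u
  sub : ∀ {Δ Γ : C.Obj}, (Δ ⟶ Γ) → Ty' Γ → Ty' Δ
  sub_id : ∀ {Γ : C.Obj} (A : Ty' Γ), sub (𝟙 Γ) A = A
  sub_comp : ∀ {Θ Δ Γ : C.Obj} (τ : Θ ⟶ Δ) (σ : Δ ⟶ Γ) (A : Ty' Γ),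
    sub (τ ≫ σ) A = sub τ (sub σ A)
  ι : ∀ {Γ : C.Obj}, Ty' Γ → C.Ty Γ
  ι_sub : ∀ {Δ Γ : C.Obj} (σ : Δ ⟶ Γ) (A : Ty' Γ), ι (sub σ A) = C.tySub σ (ι A)

/-- The whole family of types, as a restriction of itself. -/
@[simps] def full (C : CwF.{u, v}) : C.Restriction where
  Ty' := C.Ty
  sub := C.tySub
  sub_id := C.tySub_id
  sub_comp := C.tySub_comp
  ι A := A
  ι_sub _ _ := rfl

/-- A `𝟏`-type structure on a (restricted) family: `Tm(𝟏) ≅ {tt}`. -/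
structure UnitStr (C : CwF.{u, v}) (R : C.Restriction) where
  one : ∀ (Γ : C.Obj), R.Ty' Γ
  one_sub : ∀ {Δ Γ : C.Obj} (σ : Δ ⟶ Γ), R.sub σ (one Γ) = one Δ
  tt : ∀ (Γ : C.Obj), C.Tm Γ
  tp_tt : ∀ (Γ : C.Obj), C.tp (tt Γ) = R.ι (one Γ)
  tt_unique : ∀ {Γ : C.Obj} (t : C.Tm Γ), C.tp t = R.ι (one Γ) → t = tt Γ

/-- A `Σ`-type structure on a (restricted) family: an operation `Σ(A, B)`, where `B` depends on
the terms of `A`, with a natural bijection `pair` between the pairs of `a : Tm(A)` and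
`b : Tm(B(a))` and the terms of `Σ(A, B)`. -/
structure SigmaStr (C : CwF.{u, v}) (R : C.Restriction) where
  sig : ∀ {Γ : C.Obj} (A : R.Ty' Γ), R.Ty' (C.ext Γ (R.ι A)) → R.Ty' Γ
  sig_sub : ∀ {Δ Γ : C.Obj} (σ : Δ ⟶ Γ) (A : R.Ty' Γ) (B : R.Ty' (C.ext Γ (R.ι A))),
    R.sub σ (sig A B) = sig (R.sub σ A) (R.sub (C.up σ (R.ι A) _ (R.ι_sub σ A)) B)
  pair : ∀ {Γ : C.Obj} (A : R.Ty' Γ) (B : R.Ty' (C.ext Γ (R.ι A))) (a b : C.Tm Γ)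
    (ha : C.tp a = R.ι A), C.tp b = C.tySub (C.inst (R.ι A) a ha) (R.ι B) → C.Tm Γ
  tp_pair : ∀ {Γ : C.Obj} (A : R.Ty' Γ) (B : R.Ty' (C.ext Γ (R.ι A))) (a b : C.Tm Γ)
    (ha : C.tp a = R.ι A) (hb : C.tp b = C.tySub (C.inst (R.ι A) a ha) (R.ι B)),
    C.tp (pair A B a b ha hb) = R.ι (sig A B)
  pair_sub : ∀ {Δ Γ : C.Obj} (σ : Δ ⟶ Γ) (A : R.Ty' Γ) (B : R.Ty' (C.ext Γ (R.ι A)))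
    (a b : C.Tm Γ) (ha : C.tp a = R.ι A)
    (hb : C.tp b = C.tySub (C.inst (R.ι A) a ha) (R.ι B))
    (ha' : C.tp (C.tmSub σ a) = R.ι (R.sub σ A))
    (hb' : C.tp (C.tmSub σ b) = C.tySub (C.inst (R.ι (R.sub σ A)) (C.tmSub σ a) ha')
      (R.ι (R.sub (C.up σ (R.ι A) _ (R.ι_sub σ A)) B))),
    C.tmSub σ (pair A B a b ha hb) =
      pair (R.sub σ A) (R.sub (C.up σ (R.ι A) _ (R.ι_sub σ A)) B)
        (C.tmSub σ a) (C.tmSub σ b) ha' hb'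
  pair_bijective : ∀ {Γ : C.Obj} (A : R.Ty' Γ) (B : R.Ty' (C.ext Γ (R.ι A))) (t : C.Tm Γ),
    C.tp t = R.ι (sig A B) → ∃! ab : C.Tm Γ × C.Tm Γ, ∃ ha hb, pair A B ab.1 ab.2 ha hb = t

/-- The structure of `Π`-types with arities in a restricted family: an operation `Π(A, B)` for `A`
in the restricted family and `B` a type depending on the terms of `A`, with a natural bijection
`lam` from the terms of `B` in the extended context to the terms of `Π(A, B)`. -/
structure PiStr (C : CwF.{u, v}) (R : C.Restriction) where
  pi : ∀ {Γ : C.Obj} (A : R.Ty' Γ), C.Ty (C.ext Γ (R.ι A)) → C.Ty Γ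
  pi_sub : ∀ {Δ Γ : C.Obj} (σ : Δ ⟶ Γ) (A : R.Ty' Γ) (B : C.Ty (C.ext Γ (R.ι A))),
    C.tySub σ (pi A B) = pi (R.sub σ A) (C.tySub (C.up σ (R.ι A) _ (R.ι_sub σ A)) B)
  lam : ∀ {Γ : C.Obj} (A : R.Ty' Γ), C.Tm (C.ext Γ (R.ι A)) → C.Tm Γ
  tp_lam : ∀ {Γ : C.Obj} (A : R.Ty' Γ) (b : C.Tm (C.ext Γ (R.ι A))),
    C.tp (lam A b) = pi A (C.tp b)
  lam_sub : ∀ {Δ Γ : C.Obj} (σ : Δ ⟶ Γ) (A : R.Ty' Γ) (b : C.Tm (C.ext Γ (R.ι A))),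
    C.tmSub σ (lam A b) = lam (R.sub σ A) (C.tmSub (C.up σ (R.ι A) _ (R.ι_sub σ A)) b)
  lam_bijective : ∀ {Γ : C.Obj} (A : R.Ty' Γ) (B : C.Ty (C.ext Γ (R.ι A))) (f : C.Tm Γ),
    C.tp f = pi A B → ∃! b : C.Tm (C.ext Γ (R.ι A)), C.tp b = B ∧ lam A b = f

/-- Extensional equality types: `Eq(a, b)` has at most one term, and has one iff `a = b`. -/
structure EqStr (C : CwF.{u, v}) where
  eq : ∀ {Γ : C.Obj} (a b : C.Tm Γ), C.tp a = C.tp b → C.Ty Γ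
  eq_sub : ∀ {Δ Γ : C.Obj} (σ : Δ ⟶ Γ) (a b : C.Tm Γ) (h : C.tp a = C.tp b)
    (h' : C.tp (C.tmSub σ a) = C.tp (C.tmSub σ b)),
    C.tySub σ (eq a b h) = eq (C.tmSub σ a) (C.tmSub σ b) h'
  refl : ∀ {Γ : C.Obj}, C.Tm Γ → C.Tm Γ
  tp_refl : ∀ {Γ : C.Obj} (a : C.Tm Γ), C.tp (refl a) = eq a a rfl
  reflection : ∀ {Γ : C.Obj} (a b : C.Tm Γ) (h : C.tp a = C.tp b) (t : C.Tm Γ),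
    C.tp t = eq a b h → a = b
  eq_unique : ∀ {Γ : C.Obj} (a : C.Tm Γ) (t : C.Tm Γ), C.tp t = eq a a rfl → t = refl a

/-- `Π`-types with arities in all types restrict to arities in any restricted family. -/
def PiStr.restrict {C : CwF.{u, v}} (P : C.PiStr C.full) (R : C.Restriction) : C.PiStr R where
  pi A B := P.pi (R.ι A) B
  pi_sub σ A B := by
    have := P.pi_sub σ (R.ι A) B
    refine this.trans ?_
    have key : ∀ (A' : C.Ty _) (h : A' = C.tySub σ (R.ι A)),
        P.pi (C.tySub σ (R.ι A)) (C.tySub (C.up σ (R.ι A) _ rfl) B) =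
          P.pi A' (C.tySub (C.up σ (R.ι A) A' h) B) := by
      rintro _ rfl; rfl
    exact key _ (R.ι_sub σ A)
  lam A b := P.lam (R.ι A) b
  tp_lam A b := P.tp_lam (R.ι A) b
  lam_sub σ A b := by
    refine (P.lam_sub σ (R.ι A) b).trans ?_
    have key : ∀ (A' : C.Ty _) (h : A' = C.tySub σ (R.ι A)),
        P.lam (C.tySub σ (R.ι A)) (C.tmSub (C.up σ (R.ι A) _ rfl) b) =
          P.lam A' (C.tmSub (C.up σ (R.ι A) A' h) b) := by
      rintro _ rfl; rfl
    exact key _ (R.ι_sub σ A)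
  lam_bijective A B f h := P.lam_bijective (R.ι A) B f h

/-- A strict morphism of categories with families: a functor with actions on types and terms,
preserving the terminal object, context extensions and projections on the nose. -/
structure Hom (C : CwF.{u₁, v₁}) (D : CwF.{u₂, v₂}) where
  fn : C.Obj ⥤ D.Obj
  ty : ∀ {Γ : C.Obj}, C.Ty Γ → D.Ty (fn.obj Γ)
  ty_sub : ∀ {Δ Γ : C.Obj} (σ : Δ ⟶ Γ) (A : C.Ty Γ),
    ty (C.tySub σ A) = D.tySub (fn.map σ) (ty A)
  tm : ∀ {Γ : C.Obj}, C.Tm Γ → D.Tm (fn.obj Γ)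
  tm_sub : ∀ {Δ Γ : C.Obj} (σ : Δ ⟶ Γ) (t : C.Tm Γ),
    tm (C.tmSub σ t) = D.tmSub (fn.map σ) (tm t)
  tp_tm : ∀ {Γ : C.Obj} (t : C.Tm Γ), D.tp (tm t) = ty (C.tp t)
  nil_eq : fn.obj C.nil = D.nil
  ext_eq : ∀ {Γ : C.Obj} (A : C.Ty Γ), fn.obj (C.ext Γ A) = D.ext (fn.obj Γ) (ty A)
  map_p : ∀ {Γ : C.Obj} (A : C.Ty Γ), fn.map (C.p A) = eqToHom (ext_eq A) ≫ D.p (ty A)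
  tm_q : ∀ {Γ : C.Obj} (A : C.Ty Γ), tm (C.q A) = D.tmSub (eqToHom (ext_eq A)) (D.q (ty A))

namespace Hom

/-- The identity morphism. -/
def id (C : CwF.{u, v}) : Hom C C where
  fn := 𝟭 _
  ty A := A
  ty_sub _ _ := rfl
  tm t := t
  tm_sub _ _ := rfl
  tp_tm _ := rfl
  nil_eq := rfl
  ext_eq _ := rfl
  map_p _ := by simp
  tm_q _ := by simp [C.tmSub_id]

/-- Composition of strict morphisms. -/
def comp {C : CwF.{u₁, v₁}} {D : CwF.{u₂, v₂}} {E : CwF.{u₃, v₃}} (F : Hom C D) (G : Hom D E) :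
    Hom C E where
  fn := F.fn ⋙ G.fn
  ty A := G.ty (F.ty A)
  ty_sub σ A := by rw [F.ty_sub, G.ty_sub]; rfl
  tm t := G.tm (F.tm t)
  tm_sub σ A := by rw [F.tm_sub, G.tm_sub]; rfl
  tp_tm t := by rw [G.tp_tm, F.tp_tm]
  nil_eq := (congrArg G.fn.obj F.nil_eq).trans G.nil_eq
  ext_eq A := (congrArg G.fn.obj (F.ext_eq A)).trans (G.ext_eq _)
  map_p A := by
    rw [Functor.comp_map, F.map_p, G.fn.map_comp, G.map_p, eqToHom_map, ← Category.assoc,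
      eqToHom_trans]
  tm_q A := by
    rw [F.tm_q, G.tm_sub, G.tm_q, eqToHom_map, ← E.tmSub_comp, eqToHom_trans]

theorem map_inst {C : CwF.{u₁, v₁}} {D : CwF.{u₂, v₂}} (F : Hom C D) {Γ : C.Obj} (A : C.Ty Γ)
    (a : C.Tm Γ) (h : C.tp a = A) (A' : D.Ty (F.fn.obj Γ)) (e : A' = F.ty A)
    (h' : D.tp (F.tm a) = A') :
    F.fn.map (C.inst A a h) = D.inst A' (F.tm a) h' ≫ eqToHom (by rw [e, F.ext_eq]) := by
  subst e
  rw [← cancel_mono (eqToHom (F.ext_eq A))]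
  apply D.lift_unique
  · have e₁ := F.map_p A
    have : F.fn.map (C.inst A a h) ≫ F.fn.map (C.p A) = 𝟙 _ := by
      rw [← F.fn.map_comp, inst, C.lift_p, F.fn.map_id]
    rw [e₁] at this
    simp only [Category.assoc, eqToHom_trans_assoc, eqToHom_refl, Category.id_comp]
    rw [this, inst, D.lift_p]
  · rw [Category.assoc, eqToHom_trans, eqToHom_refl, Category.comp_id, D.tmSub_comp, ← F.tm_q,
      ← F.tm_sub, inst, inst, C.lift_q, D.lift_q]

/-- A morphism is bijective on terms if, for all `Γ` and `A`, it restricts to a bijection from the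
terms of type `A` in context `Γ` to the terms of type `F(A)` in context `F(Γ)`. -/
def BijectiveOnTerms {C : CwF.{u₁, v₁}} {D : CwF.{u₂, v₂}} (F : Hom C D) : Prop :=
  ∀ (Γ : C.Obj) (A : C.Ty Γ), Set.BijOn F.tm {a : C.Tm Γ | C.tp a = A} {b | D.tp b = F.ty A}

end Hom

/-- The action of a morphism on restricted families. -/
structure RestrictionHom {C : CwF.{u₁, v₁}} {D : CwF.{u₂, v₂}} (F : Hom C D)
    (R : C.Restriction) (S : D.Restriction) where
  map : ∀ {Γ : C.Obj}, R.Ty' Γ → S.Ty' (F.fn.obj Γ)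
  map_sub : ∀ {Δ Γ : C.Obj} (σ : Δ ⟶ Γ) (A : R.Ty' Γ),
    map (R.sub σ A) = S.sub (F.fn.map σ) (map A)
  ι_map : ∀ {Γ : C.Obj} (A : R.Ty' Γ), S.ι (map A) = F.ty (R.ι A)

namespace RestrictionHom

/-- The action of a morphism on all types. -/
@[simps] def full {C : CwF.{u₁, v₁}} {D : CwF.{u₂, v₂}} (F : Hom C D) :
    RestrictionHom F C.full D.full where
  map A := F.ty A
  map_sub := F.ty_sub
  ι_map _ := rfl

/-- The identity action. -/
def id {C : CwF.{u, v}} (R : C.Restriction) : RestrictionHom (Hom.id C) R R where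
  map A := A
  map_sub _ _ := rfl
  ι_map _ := rfl

/-- Composition of actions on restricted families. -/
def comp {C : CwF.{u₁, v₁}} {D : CwF.{u₂, v₂}} {E : CwF.{u₃, v₃}} {F : Hom C D} {G : Hom D E}
    {R : C.Restriction} {S : D.Restriction} {U : E.Restriction}
    (φ : RestrictionHom F R S) (ψ : RestrictionHom G S U) : RestrictionHom (F.comp G) R U where
  map A := ψ.map (φ.map A)
  map_sub σ A := (congrArg ψ.map (φ.map_sub σ A)).trans (ψ.map_sub _ _)
  ι_map A := (ψ.ι_map _).trans (congrArg G.ty (φ.ι_map A))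

section
variable {C : CwF.{u₁, v₁}} {D : CwF.{u₂, v₂}} {F : Hom C D}
  {R : C.Restriction} {S : D.Restriction} (φ : RestrictionHom F R S)

/-- The strict equality `F(Γ).F(A) = F(Γ.A)`, as a morphism of contexts. -/
def extHom {Γ : C.Obj} (A : R.Ty' Γ) :
    D.ext (F.fn.obj Γ) (S.ι (φ.map A)) ⟶ F.fn.obj (C.ext Γ (R.ι A)) :=
  eqToHom (by rw [φ.ι_map, F.ext_eq])

/-- Strict preservation of `𝟏`-types (and hence of their unique terms). -/
def PreservesUnit (X : C.UnitStr R) (Y : D.UnitStr S) : Prop :=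
  ∀ Γ : C.Obj, φ.map (X.one Γ) = Y.one (F.fn.obj Γ)

/-- Strict preservation of `Σ`-types and of pairing (and hence of the projections). -/
structure PreservesSigma (X : C.SigmaStr R) (Y : D.SigmaStr S) : Prop where
  sig : ∀ {Γ : C.Obj} (A : R.Ty' Γ) (B : R.Ty' (C.ext Γ (R.ι A))),
    φ.map (X.sig A B) = Y.sig (φ.map A) (S.sub (φ.extHom A) (φ.map B))
  pair : ∀ {Γ : C.Obj} (A : R.Ty' Γ) (B : R.Ty' (C.ext Γ (R.ι A))) (a b : C.Tm Γ)
    (ha : C.tp a = R.ι A) (hb : C.tp b = C.tySub (C.inst (R.ι A) a ha) (R.ι B))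
    (ha' : D.tp (F.tm a) = S.ι (φ.map A))
    (hb' : D.tp (F.tm b) = D.tySub (D.inst (S.ι (φ.map A)) (F.tm a) ha')
      (S.ι (S.sub (φ.extHom A) (φ.map B)))),
    F.tm (X.pair A B a b ha hb) =
      Y.pair (φ.map A) (S.sub (φ.extHom A) (φ.map B)) (F.tm a) (F.tm b) ha' hb'

/-- Strict preservation of `Π`-types and of abstraction (and hence of application). -/
structure PreservesPi (X : C.PiStr R) (Y : D.PiStr S) : Prop where
  pi : ∀ {Γ : C.Obj} (A : R.Ty' Γ) (B : C.Ty (C.ext Γ (R.ι A))),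
    F.ty (X.pi A B) = Y.pi (φ.map A) (D.tySub (φ.extHom A) (F.ty B))
  lam : ∀ {Γ : C.Obj} (A : R.Ty' Γ) (b : C.Tm (C.ext Γ (R.ι A))),
    F.tm (X.lam A b) = Y.lam (φ.map A) (D.tmSub (φ.extHom A) (F.tm b))

end

section
variable {C : CwF.{u₁, v₁}} {D : CwF.{u₂, v₂}} {E : CwF.{u₃, v₃}} {F : Hom C D} {G : Hom D E}
  {R : C.Restriction} {S : D.Restriction} {U : E.Restriction}
  {φ : RestrictionHom F R S} {ψ : RestrictionHom G S U}

theorem PreservesSigma.id {C : CwF.{u, v}} {R : C.Restriction} (X : C.SigmaStr R) :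
    (RestrictionHom.id R).PreservesSigma X X where
  sig A B := congrArg (X.sig A) (R.sub_id B).symm
  pair A B a b ha hb ha' hb' := by
    have key : ∀ (B' : R.Ty' _) (_ : B' = B)
        (hb' : C.tp b = C.tySub (C.inst (R.ι A) a ha) (R.ι B')),
        X.pair A B a b ha hb = X.pair A B' a b ha hb' := by
      rintro _ rfl _; rfl
    exact key _ (R.sub_id B) hb'

theorem extHom_comp {Γ : C.Obj} (A : R.Ty' Γ) :
    (φ.comp ψ).extHom A = ψ.extHom (φ.map A) ≫ G.fn.map (φ.extHom A) := by
  simp only [extHom, eqToHom_map, eqToHom_trans]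
  rfl

theorem PreservesUnit.comp {X : C.UnitStr R} {Y : D.UnitStr S} {Z : E.UnitStr U}
    (h : φ.PreservesUnit X Y) (k : ψ.PreservesUnit Y Z) : (φ.comp ψ).PreservesUnit X Z :=
  fun Γ => (congrArg ψ.map (h Γ)).trans (k _)

theorem map_sub_extHom {Γ : C.Obj} (A : R.Ty' Γ) (B : R.Ty' (C.ext Γ (R.ι A))) :
    U.sub (ψ.extHom (φ.map A)) (ψ.map (S.sub (φ.extHom A) (φ.map B))) =
      U.sub ((φ.comp ψ).extHom A) ((φ.comp ψ).map B) := by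
  rw [ψ.map_sub, ← U.sub_comp, extHom_comp]
  rfl

theorem PreservesSigma.comp {X : C.SigmaStr R} {Y : D.SigmaStr S} {Z : E.SigmaStr U}
    (h : φ.PreservesSigma X Y) (k : ψ.PreservesSigma Y Z) : (φ.comp ψ).PreservesSigma X Z where
  sig A B := by
    refine (congrArg ψ.map (h.sig A B)).trans ((k.sig _ _).trans ?_)
    rw [map_sub_extHom]
    rfl
  pair A B a b ha hb ha' hb' := by
    have ha₁ : D.tp (F.tm a) = S.ι (φ.map A) := by rw [F.tp_tm, ha, φ.ι_map]
    have hb₁ : D.tp (F.tm b) = D.tySub (D.inst (S.ι (φ.map A)) (F.tm a) ha₁)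
        (S.ι (S.sub (φ.extHom A) (φ.map B))) := by
      rw [F.tp_tm, hb, F.ty_sub, S.ι_sub, φ.ι_map B, ← D.tySub_comp]
      exact congrArg (fun σ => D.tySub σ (F.ty (R.ι B)))
        (F.map_inst (R.ι A) a ha _ (φ.ι_map A) ha₁)
    refine (congrArg G.tm (h.pair A B a b ha hb ha₁ hb₁)).trans ?_
    have e := map_sub_extHom (φ := φ) (ψ := ψ) A B
    refine (k.pair _ _ _ _ _ _ ha' (by rw [e]; exact hb')).trans ?_
    congr 1

theorem PreservesPi.comp {X : C.PiStr R} {Y : D.PiStr S} {Z : E.PiStr U}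
    (h : φ.PreservesPi X Y) (k : ψ.PreservesPi Y Z) : (φ.comp ψ).PreservesPi X Z where
  pi A B := by
    refine (congrArg G.ty (h.pi A B)).trans ((k.pi _ _).trans ?_)
    rw [G.ty_sub, ← E.tySub_comp, extHom_comp]
    rfl
  lam A b := by
    refine (congrArg G.tm (h.lam A b)).trans ((k.lam _ _).trans ?_)
    rw [G.tm_sub, ← E.tmSub_comp, extHom_comp]
    rfl

end
end RestrictionHom
end CwF

/-- A `(Σ, Π_rep)`-CwF: a category with families with a restricted family `rep` of representable
types, `Π`-types with arities in the representable types (first-order `Π`-types), and `𝟏`- and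
`Σ`-types on the families of all types and of representable types. -/
structure SPCwF extends CwF.{u, v} where
  rep : toCwF.Restriction
  pi : toCwF.PiStr rep
  unit : toCwF.UnitStr toCwF.full
  sigma : toCwF.SigmaStr toCwF.full
  repUnit : toCwF.UnitStr rep
  repSigma : toCwF.SigmaStr rep

/-- A model of extensional type theory: a category with families equipped with `𝟏`-, `Σ`-, `Π`- and
extensional equality types. -/
structure ETTModel extends CwF.{u, v} where
  unit : toCwF.UnitStr toCwF.full
  sigma : toCwF.SigmaStr toCwF.full
  pi : toCwF.PiStr toCwF.full
  eq : toCwF.EqStr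

/-- The `(Σ, Π_rep)`-CwF underlying a model of extensional type theory, for a choice of
representable types closed under `𝟏`- and `Σ`-types; its first-order `Π`-types are the `Π`-types
of the model with arities in the representable types. -/
def ETTModel.toSPCwF (M : ETTModel.{u, v}) (rep : M.toCwF.Restriction)
    (repUnit : M.toCwF.UnitStr rep) (repSigma : M.toCwF.SigmaStr rep) : SPCwF.{u, v} where
  toCwF := M.toCwF
  rep := rep
  pi := M.pi.restrict rep
  unit := M.unit
  sigma := M.sigma
  repUnit := repUnit
  repSigma := repSigma

namespace SPCwF

/-- A strict morphism of `(Σ, Π_rep)`-CwFs. -/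
structure Hom (C : SPCwF.{u₁, v₁}) (D : SPCwF.{u₂, v₂}) extends CwF.Hom C.toCwF D.toCwF where
  rep : CwF.RestrictionHom toHom C.rep D.rep
  pi : rep.PreservesPi C.pi D.pi
  unit : (CwF.RestrictionHom.full toHom).PreservesUnit C.unit D.unit
  sigma : (CwF.RestrictionHom.full toHom).PreservesSigma C.sigma D.sigma
  repUnit : rep.PreservesUnit C.repUnit D.repUnit
  repSigma : rep.PreservesSigma C.repSigma D.repSigma

/-- The identity morphism. -/
def Hom.id (C : SPCwF.{u, v}) : Hom C C where
  toHom := CwF.Hom.id C.toCwF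
  rep := CwF.RestrictionHom.id C.rep
  pi :=
    { pi := fun A B => congrArg (C.pi.pi A) (C.tySub_id B).symm
      lam := fun A b => congrArg (C.pi.lam A) (C.tmSub_id b).symm }
  unit := fun _ => rfl
  sigma := CwF.RestrictionHom.PreservesSigma.id C.sigma
  repUnit := fun _ => rfl
  repSigma := CwF.RestrictionHom.PreservesSigma.id C.repSigma

/-- Composition of strict morphisms. -/
def Hom.comp {C : SPCwF.{u₁, v₁}} {D : SPCwF.{u₂, v₂}} {E : SPCwF.{u₃, v₃}} (F : Hom C D)
    (G : Hom D E) : Hom C E where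
  toHom := F.toHom.comp G.toHom
  rep := F.rep.comp G.rep
  pi := F.pi.comp G.pi
  unit := F.unit.comp G.unit
  sigma := F.sigma.comp G.sigma
  repUnit := F.repUnit.comp G.repUnit
  repSigma := F.repSigma.comp G.repSigma

instance : Category SPCwF.{u, v} where
  Hom := Hom
  id := Hom.id
  comp := Hom.comp
  id_comp _ := rfl
  comp_id _ := rfl
  assoc _ _ _ := rfl

end SPCwF

namespace SPCwF

/-- `F = Free(Γ ⊢)`: the context `Γ` freely generates `F`. -/
def IsFreeCtx (F : SPCwF.{u, v}) (Γ : F.Obj) : Prop :=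
  ∀ (D : SPCwF.{u, v}) (Δ : D.Obj), ∃! f : F ⟶ D, f.fn.obj Γ = Δ

/-- `F = Free(Γ ⊢ A type)`. -/
def IsFreeTy (F : SPCwF.{u, v}) (Γ : F.Obj) (A : F.Ty Γ) : Prop :=
  ∀ (D : SPCwF.{u, v}) (Δ : D.Obj) (B : D.Ty Δ), ∃! f : F ⟶ D,
    (⟨f.fn.obj Γ, f.ty A⟩ : Σ Δ, D.Ty Δ) = ⟨Δ, B⟩

/-- `F = Free(Γ ⊢ A type_rep)`. -/
def IsFreeRepTy (F : SPCwF.{u, v}) (Γ : F.Obj) (A : F.rep.Ty' Γ) : Prop :=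
  ∀ (D : SPCwF.{u, v}) (Δ : D.Obj) (B : D.rep.Ty' Δ), ∃! f : F ⟶ D,
    (⟨f.fn.obj Γ, f.rep.map A⟩ : Σ Δ, D.rep.Ty' Δ) = ⟨Δ, B⟩

/-- `F = Free(Γ ⊢ a : A)`; the type `A` is that of `a`. -/
def IsFreeTm (F : SPCwF.{u, v}) (Γ : F.Obj) (a : F.Tm Γ) : Prop :=
  ∀ (D : SPCwF.{u, v}) (Δ : D.Obj) (b : D.Tm Δ), ∃! f : F ⟶ D,
    (⟨f.fn.obj Γ, f.tm a⟩ : Σ Δ, D.Tm Δ) = ⟨Δ, b⟩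

/-- `F = Free(Γ ⊢ x, y : A)`; the type `A` is the common type of `x` and `y`. -/
def IsFreeTmPair (F : SPCwF.{u, v}) (Γ : F.Obj) (x y : F.Tm Γ) : Prop :=
  F.tp x = F.tp y ∧
  ∀ (D : SPCwF.{u, v}) (Δ : D.Obj) (x' y' : D.Tm Δ), D.tp x' = D.tp y' → ∃! f : F ⟶ D,
    (⟨f.fn.obj Γ, f.tm x, f.tm y⟩ : Σ Δ, D.Tm Δ × D.Tm Δ) = ⟨Δ, x', y'⟩

/-- The generic extension of `(Σ, Π_rep)`-CwFs by a type, `Free(Γ ⊢) ⟶ Free(Γ ⊢ A type)`. -/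
def ITy : MorphismProperty SPCwF.{u, v} := fun F G i =>
  ∃ (Γ : F.Obj) (A : G.Ty (i.fn.obj Γ)), F.IsFreeCtx Γ ∧ G.IsFreeTy (i.fn.obj Γ) A

/-- The generic extension by a representable type,
`Free(Γ ⊢) ⟶ Free(Γ ⊢ A type_rep)`. -/
def IRepTy : MorphismProperty SPCwF.{u, v} := fun F G i =>
  ∃ (Γ : F.Obj) (A : G.rep.Ty' (i.fn.obj Γ)), F.IsFreeCtx Γ ∧ G.IsFreeRepTy (i.fn.obj Γ) A

/-- The generic extension by a term, `Free(Γ ⊢ A type) ⟶ Free(Γ ⊢ a : A)`. -/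
def ITm : MorphismProperty SPCwF.{u, v} := fun F G i =>
  ∃ (Γ : F.Obj) (A : F.Ty Γ) (a : G.Tm (i.fn.obj Γ)),
    F.IsFreeTy Γ A ∧ G.IsFreeTm (i.fn.obj Γ) a ∧ G.tp a = i.ty A

/-- The generic extension by an equation between terms,
`Free(Γ ⊢ x, y : A) ⟶ Free(Γ ⊢ x = y)`, where `Free(Γ ⊢ x = y)` is freely generated by the common
value of `x` and `y`. -/
def ETm : MorphismProperty SPCwF.{u, v} := fun F G i =>
  ∃ (Γ : F.Obj) (x y : F.Tm Γ),
    F.IsFreeTmPair Γ x y ∧ G.IsFreeTm (i.fn.obj Γ) (i.tm x) ∧ i.tm x = i.tm y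

/-- A (small) second-order generalized algebraic theory is a cellular `(Σ, Π_rep)`-CwF `T`: the
morphism to `T` from an initial object is a sequential composition of pushouts of coproducts of
generic extensions by types, representable types, terms and term equalities. -/
def IsSOGAT (T : SPCwF.{w, w}) : Prop :=
  ∃ (O : SPCwF.{w, w}) (hO : Limits.IsInitial O),
    (MorphismProperty.coproducts.{w} (ITy ⊔ IRepTy ⊔ ITm ⊔ ETm)).pushouts
      |>.transfiniteCompositionsOfShape ℕ (hO.to T)

end SPCwF

namespace Psh

variable {C : Type w} [SmallCategory C]

/-- Dependent presheaves over `X`: presheaves over the category of elements of `X`. (As `X` is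
contravariant, `X.Elements` is the opposite of that category.) -/
abbrev Dep (X : Cᵒᵖ ⥤ Type w) : Type (w + 1) := X.Elements ⥤ Type w

/-- Substitution in a dependent presheaf. -/
abbrev Dep.sub {X' X : Cᵒᵖ ⥤ Type w} (σ : X' ⟶ X) (Y : Dep X) : Dep X' :=
  NatTrans.mapElements σ ⋙ Y

/-- The terms over `X`: a dependent presheaf over `X` together with a section of it. -/
abbrev Tm (X : Cᵒᵖ ⥤ Type w) : Type (w + 1) := Σ Y : Dep X, Y.sections

/-- Substitution in a section of a dependent presheaf. -/
def secSub {X' X : Cᵒᵖ ⥤ Type w} (σ : X' ⟶ X) {Y : Dep X} (s : Y.sections) :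
    (Dep.sub σ Y).sections :=
  ⟨fun e => s.1 ((NatTrans.mapElements σ).obj e),
    fun f => s.2 ((NatTrans.mapElements σ).map f)⟩

/-- Substitution in a term. -/
def Tm.sub {X' X : Cᵒᵖ ⥤ Type w} (σ : X' ⟶ X) (t : Tm X) : Tm X' :=
  ⟨Dep.sub σ t.1, secSub σ t.2⟩

theorem sigma_map_eq {X : Cᵒᵖ ⥤ Type w} (Y : Dep X) {c d : Cᵒᵖ} (f : c ⟶ d) (x : X.obj c)
    (x' : X.obj d) (h : X.map f x = x') (y : Y.obj ⟨c, x⟩) :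
    (⟨X.map f x, Y.map (CategoryOfElements.homMk (F := X) ⟨c, x⟩ ⟨d, X.map f x⟩ f rfl) y⟩ :
      Σ z : X.obj d, Y.obj ⟨d, z⟩) =
      ⟨x', Y.map (CategoryOfElements.homMk (F := X) ⟨c, x⟩ ⟨d, x'⟩ f h) y⟩ := by
  subst h; rfl

/-- The context extension `X.Y`: the presheaf of pairs of an element of `X` and an element of `Y`
over it. -/
def ext (X : Cᵒᵖ ⥤ Type w) (Y : Dep X) : Cᵒᵖ ⥤ Type w where
  obj c := Σ x : X.obj c, Y.obj ⟨c, x⟩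
  map {c d} f := TypeCat.ofHom fun z =>
    ⟨X.map f z.1,
      Y.map (CategoryOfElements.homMk (F := X) ⟨c, z.1⟩ ⟨d, X.map f z.1⟩ f rfl) z.2⟩
  map_id c := by
    refine ConcreteCategory.hom_ext _ _ ?_
    rintro ⟨x, y⟩
    refine (sigma_map_eq Y (𝟙 c) x x (by simp) y).trans ?_
    exact congrArg (Sigma.mk x) (congrArg (fun g => g y) (Y.map_id ⟨c, x⟩))
  map_comp {c d e} f g := by
    refine ConcreteCategory.hom_ext _ _ ?_
    rintro ⟨x, y⟩
    refine (sigma_map_eq Y (f ≫ g) x (X.map g (X.map f x)) (by simp) y).trans ?_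
    refine congrArg (Sigma.mk _) ?_
    exact congrArg (fun k => k y) (Y.map_comp
      (CategoryOfElements.homMk (F := X) ⟨c, x⟩ ⟨d, X.map f x⟩ f rfl)
      (CategoryOfElements.homMk (F := X) ⟨d, X.map f x⟩ ⟨e, X.map g (X.map f x)⟩ g rfl))

/-- A morphism between elements of `X.Y`. -/
def extMk {X : Cᵒᵖ ⥤ Type w} {Y : Dep X} {e e' : X.Elements} (f : e ⟶ e') (y : Y.obj e)
    (y' : Y.obj e') (h : Y.map f y = y') :
    (ext X Y).elementsMk e.1 ⟨e.2, y⟩ ⟶ (ext X Y).elementsMk e'.1 ⟨e'.2, y'⟩ :=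
  CategoryOfElements.homMk _ _ f.1
    ((sigma_map_eq Y f.1 e.2 e'.2 f.2 y).trans (congrArg (Sigma.mk e'.2) h))

/-- The projection `X.Y ⟶ X`. -/
def p {X : Cᵒᵖ ⥤ Type w} (Y : Dep X) : ext X Y ⟶ X where
  app c := TypeCat.ofHom fun z => z.1

/-- The generic section of `Y` over `X.Y`. -/
def qSec {X : Cᵒᵖ ⥤ Type w} (Y : Dep X) : (Dep.sub (p Y) Y).sections :=
  ⟨fun e => e.2.2, by
    rintro ⟨c, ⟨x, y⟩⟩ ⟨d, ⟨x', y'⟩⟩ ⟨f, h⟩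
    have h' := (sigma_map_eq Y f x x' (congrArg Sigma.fst h) y).symm.trans h
    exact eq_of_heq (Sigma.mk.inj h').2⟩

/-- The morphism `X' ⟶ X.Y` given by `σ : X' ⟶ X` and a section of `Y[σ]`. -/
def lift {X' X : Cᵒᵖ ⥤ Type w} (σ : X' ⟶ X) (Y : Dep X) (s : (Dep.sub σ Y).sections) :
    X' ⟶ ext X Y where
  app c := TypeCat.ofHom fun x => ⟨σ.app c x, s.1 ⟨c, x⟩⟩
  naturality c d f := by
    ext x
    refine Eq.symm ((sigma_map_eq Y f (σ.app c x) (σ.app d (X'.map f x))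
      (NatTrans.naturality_apply σ f x).symm _).trans ?_)
    exact congrArg (Sigma.mk _)
      (s.2 (CategoryOfElements.homMk (F := X') ⟨c, x⟩ ⟨d, X'.map f x⟩ f rfl))

/-- The weakening `X'.Y[σ] ⟶ X.Y` of `σ : X' ⟶ X`. -/
def up {X' X : Cᵒᵖ ⥤ Type w} (σ : X' ⟶ X) (Y : Dep X) : ext X' (Dep.sub σ Y) ⟶ ext X Y :=
  lift (p (Dep.sub σ Y) ≫ σ) Y (qSec (Dep.sub σ Y))

/-- The dependent sum of dependent presheaves. -/
def sig {X : Cᵒᵖ ⥤ Type w} (Y : Dep X) (Z : Dep (ext X Y)) : Dep X where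
  obj e := Σ y : Y.obj e, Z.obj ((ext X Y).elementsMk e.1 ⟨e.2, y⟩)
  map f := TypeCat.ofHom fun z => ⟨Y.map f z.1, Z.map (extMk f z.1 _ rfl) z.2⟩
  map_id e := by
    refine ConcreteCategory.hom_ext _ _ ?_
    rintro ⟨y, z⟩
    have key : ∀ (y' : Y.obj e) (h : Y.map (𝟙 e) y = y'),
      (⟨Y.map (𝟙 e) y, Z.map (extMk (𝟙 e) y _ rfl) z⟩ :
        Σ y : Y.obj e, Z.obj ((ext X Y).elementsMk e.1 ⟨e.2, y⟩)) =
        ⟨y', Z.map (extMk (𝟙 e) y _ h) z⟩ := by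
      rintro _ rfl; rfl
    refine (key y (by simp)).trans (congrArg (Sigma.mk y) ?_)
    exact congrArg (fun k => k z) (Z.map_id _)
  map_comp {e e' e''} f g := by
    refine ConcreteCategory.hom_ext _ _ ?_
    rintro ⟨y, z⟩
    have key : ∀ (y' : Y.obj e'') (h : Y.map (f ≫ g) y = y'),
      (⟨Y.map (f ≫ g) y, Z.map (extMk (f ≫ g) y _ rfl) z⟩ :
        Σ y : Y.obj e'', Z.obj ((ext X Y).elementsMk e''.1 ⟨e''.2, y⟩)) =
        ⟨y', Z.map (extMk (f ≫ g) y _ h) z⟩ := by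
      rintro _ rfl; rfl
    refine (key (Y.map g (Y.map f y)) (by simp)).trans (congrArg (Sigma.mk _) ?_)
    exact congrArg (fun k => k z)
      (Z.map_comp (extMk f y _ rfl) (extMk g (Y.map f y) _ rfl))

/-- The natural transformation `𝕪(Γ) ⟶ X` corresponding to an element `x` of `X` at `Γ`. -/
abbrev orb {X : Cᵒᵖ ⥤ Type w} (e : X.Elements) : yoneda.obj e.1.unop ⟶ X :=
  yonedaEquiv.symm e.2

/-- `Π(Y, Z)` at `o : 𝕪(Γ) ⟶ X`: the sections of `Z` over `(γ : 𝕪(Γ)).Y(o(γ))`. -/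
abbrev PiFib {X : Cᵒᵖ ⥤ Type w} (Y : Dep X) (Z : Dep (ext X Y)) {Γ : C}
    (o : yoneda.obj Γ ⟶ X) : Type w :=
  (Dep.sub (up o Y) Z).sections

/-- Restriction of `Π(Y, Z)` along `τ : Γ' ⟶ Γ`. -/
def piRes {X : Cᵒᵖ ⥤ Type w} (Y : Dep X) (Z : Dep (ext X Y)) {Γ Γ' : C} (τ : Γ' ⟶ Γ)
    {o : yoneda.obj Γ ⟶ X} {o' : yoneda.obj Γ' ⟶ X} (h : yoneda.map τ ≫ o = o')
    (s : PiFib Y Z o) : PiFib Y Z o' :=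
  h ▸ (secSub (up (yoneda.map τ) (Dep.sub o Y)) s : PiFib Y Z (yoneda.map τ ≫ o))

theorem piRes_id {X : Cᵒᵖ ⥤ Type w} (Y : Dep X) (Z : Dep (ext X Y)) {Γ : C}
    {o : yoneda.obj Γ ⟶ X} (h : yoneda.map (𝟙 Γ) ≫ o = o)
    (s : PiFib Y Z o) : piRes Y Z (𝟙 Γ) h s = s := by
  have key : ∀ (k : yoneda.obj Γ ⟶ yoneda.obj Γ) (_ : k = 𝟙 _) (h : k ≫ o = o),
    (h ▸ (secSub (up k (Dep.sub o Y)) s : PiFib Y Z (k ≫ o)) : PiFib Y Z o) = s := by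
    rintro _ rfl h
    rfl
  exact key _ (yoneda.map_id Γ) h

theorem piRes_comp {X : Cᵒᵖ ⥤ Type w} (Y : Dep X) (Z : Dep (ext X Y)) {Γ Γ' Γ'' : C}
    (τ : Γ' ⟶ Γ) (τ' : Γ'' ⟶ Γ')
    {o : yoneda.obj Γ ⟶ X} {o' : yoneda.obj Γ' ⟶ X} {o'' : yoneda.obj Γ'' ⟶ X}
    (h : yoneda.map τ ≫ o = o') (h' : yoneda.map τ' ≫ o' = o'')
    (h'' : yoneda.map (τ' ≫ τ) ≫ o = o'') (s : PiFib Y Z o) :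
    piRes Y Z (τ' ≫ τ) h'' s = piRes Y Z τ' h' (piRes Y Z τ h s) := by
  subst h h'
  have key : ∀ (k : yoneda.obj Γ'' ⟶ yoneda.obj Γ) (_ : k = yoneda.map τ' ≫ yoneda.map τ)
      (h : k ≫ o = yoneda.map τ' ≫ yoneda.map τ ≫ o),
    (h ▸ (secSub (up k (Dep.sub o Y)) s : PiFib Y Z (k ≫ o)) :
      PiFib Y Z (yoneda.map τ' ≫ yoneda.map τ ≫ o)) =
      piRes Y Z τ' rfl (piRes Y Z τ rfl s) := by
    rintro _ rfl h
    rfl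
  exact key _ (yoneda.map_comp τ' τ) h''

theorem orb_map {X : Cᵒᵖ ⥤ Type w} {e e' : X.Elements} (f : e ⟶ e') :
    yoneda.map f.1.unop ≫ orb e = orb e' := by
  refine (yonedaEquiv_symm_naturality_left f.1.unop X e.2).trans ?_
  exact congrArg yonedaEquiv.symm f.2

/-- The dependent product of dependent presheaves. -/
def pi {X : Cᵒᵖ ⥤ Type w} (Y : Dep X) (Z : Dep (ext X Y)) : Dep X where
  obj e := PiFib Y Z (orb e)
  map f := TypeCat.ofHom fun s => piRes Y Z f.1.unop (orb_map f) s
  map_id e := by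
    refine ConcreteCategory.hom_ext _ _ fun s => ?_
    exact piRes_id Y Z (orb_map (𝟙 e)) s
  map_comp f g := by
    refine ConcreteCategory.hom_ext _ _ fun s => ?_
    exact piRes_comp Y Z f.1.unop g.1.unop (orb_map f) (orb_map g) (orb_map (f ≫ g)) s

theorem orb_sub {X' X : Cᵒᵖ ⥤ Type w} (σ : X' ⟶ X) (e : X'.Elements) :
    orb ((NatTrans.mapElements σ).obj e) = orb e ≫ σ :=
  (yonedaEquiv_symm_naturality_right e.1.unop σ e.2).symm

theorem pi_sub {X' X : Cᵒᵖ ⥤ Type w} (σ : X' ⟶ X) (Y : Dep X) (Z : Dep (ext X Y)) :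
    Dep.sub σ (pi Y Z) = pi (Dep.sub σ Y) (Dep.sub (up σ Y) Z) := by
  have key : ∀ {Γ Γ' : C} (τ : Γ' ⟶ Γ) (o : yoneda.obj Γ ⟶ X') (o' : yoneda.obj Γ' ⟶ X')
      (o₁ : yoneda.obj Γ ⟶ X) (o₁' : yoneda.obj Γ' ⟶ X) (h : yoneda.map τ ≫ o = o')
      (h₁ : yoneda.map τ ≫ o₁ = o₁') (_ : o₁ = o ≫ σ) (_ : o₁' = o' ≫ σ),
      HEq (TypeCat.ofHom fun s => piRes Y Z τ h₁ s)
        (TypeCat.ofHom fun s =>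
          piRes (Dep.sub σ Y) (Dep.sub (up σ Y) Z) τ h s) := by
    rintro Γ Γ' τ o _ _ _ rfl h₁ rfl rfl
    rfl
  refine Functor.hext (fun e => ?_) (fun e e' f => ?_)
  · exact congrArg (fun o => PiFib Y Z o) (orb_sub σ e)
  · exact key f.1.unop (orb e) (orb e') _ _ (orb_map f)
      (orb_map ((NatTrans.mapElements σ).map f)) (orb_sub σ e) (orb_sub σ e')

/-- Abstraction. -/
def lamSec {X : Cᵒᵖ ⥤ Type w} {Y : Dep X} {Z : Dep (ext X Y)} (s : Z.sections) :
    (pi Y Z).sections :=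
  ⟨fun e => secSub (up (orb e) Y) s, by
    intro e e' f
    have key : ∀ (o : yoneda.obj e'.1.unop ⟶ X) (h : yoneda.map f.1.unop ≫ orb e = o),
        piRes Y Z f.1.unop h (secSub (up (orb e) Y) s) = secSub (up o Y) s := by
      rintro _ rfl
      rfl
    exact key _ (orb_map f)⟩

theorem sections_heq {J : Type w} [Category.{w} J] {F G : J ⥤ Type w} (h : F = G)
    (s : F.sections) (t : G.sections) (hst : ∀ e, HEq (s.1 e) (t.1 e)) : HEq s t := by
  subst h
  exact heq_of_eq (Subtype.ext (funext fun e => eq_of_heq (hst e)))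

theorem lam_sub {X' X : Cᵒᵖ ⥤ Type w} (σ : X' ⟶ X) {Y : Dep X} {Z : Dep (ext X Y)}
    (s : Z.sections) :
    Tm.sub σ ⟨pi Y Z, lamSec s⟩ =
      ⟨pi (Dep.sub σ Y) (Dep.sub (up σ Y) Z), lamSec (secSub (up σ Y) s)⟩ := by
  refine Sigma.ext (pi_sub σ Y Z) (sections_heq (pi_sub σ Y Z) _ _ fun e => ?_)
  have key : ∀ (o : yoneda.obj e.1.unop ⟶ X) (_ : o = orb e ≫ σ),
      HEq (secSub (up o Y) s : PiFib Y Z o) (secSub (up (orb e ≫ σ) Y) s) := by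
    rintro _ rfl
    rfl
  exact key _ (orb_sub σ e)

/-- Elements of `(γ : 𝕪(Γ)).Y(o(γ))`. -/
abbrev piElem {X : Cᵒᵖ ⥤ Type w} (Y : Dep X) {Γ : C} (o : yoneda.obj Γ ⟶ X) {Δ : C}
    (ρ : Δ ⟶ Γ) (y : Y.obj ⟨op Δ, o.app (op Δ) ρ⟩) :
    (ext (yoneda.obj Γ) (Dep.sub o Y)).Elements :=
  ⟨op Δ, ⟨ρ, y⟩⟩

theorem pi_section_map {X : Cᵒᵖ ⥤ Type w} {Y : Dep X} {Z : Dep (ext X Y)}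
    (s : (pi Y Z).sections) {e e' : X.Elements} (f : e ⟶ e') {Δ Δ' : C}
    (ρ : Δ ⟶ e.1.unop) (y : Y.obj ⟨op Δ, (orb e).app (op Δ) ρ⟩)
    (ρ' : Δ' ⟶ e'.1.unop) (y' : Y.obj ⟨op Δ', (orb e').app (op Δ') ρ'⟩)
    (g : (NatTrans.mapElements (up (orb e) Y)).obj (piElem Y (orb e) ρ y) ⟶
      (NatTrans.mapElements (up (orb e') Y)).obj (piElem Y (orb e') ρ' y'))
    (h : g.1.unop ≫ ρ = ρ' ≫ f.1.unop) :
    Z.map g ((s.1 e).1 (piElem Y (orb e) ρ y)) = (s.1 e').1 (piElem Y (orb e') ρ' y') := by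
  have hs : piRes Y Z f.1.unop (orb_map f) (s.1 e) = s.1 e' := s.2 f
  have key : ∀ (o : yoneda.obj e'.1.unop ⟶ X) (ho : yoneda.map f.1.unop ≫ orb e = o)
      (t : PiFib Y Z o) (_ : piRes Y Z f.1.unop ho (s.1 e) = t)
      (y' : Y.obj ⟨op Δ', o.app (op Δ') ρ'⟩)
      (g : (NatTrans.mapElements (up (orb e) Y)).obj (piElem Y (orb e) ρ y) ⟶
        (NatTrans.mapElements (up o Y)).obj (piElem Y o ρ' y'))
      (_ : g.1.unop ≫ ρ = ρ' ≫ f.1.unop),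
      Z.map g ((s.1 e).1 (piElem Y (orb e) ρ y)) = t.1 (piElem Y o ρ' y') := by
    rintro _ rfl _ rfl y' ⟨g, hg⟩ hρ
    let m : piElem Y (orb e) ρ y ⟶ piElem Y (orb e) (ρ' ≫ f.1.unop) y' :=
      ⟨g, (sigma_map_eq (Dep.sub (orb e) Y) g ρ (ρ' ≫ f.1.unop) hρ y).trans
        (congrArg (Sigma.mk (ρ' ≫ f.1.unop)) ((qSec Y).2 ⟨g, hg⟩))⟩
    exact (s.1 e).2 m
  exact key _ (orb_map f) _ hs y' g h

theorem map_map {J : Type w} [Category.{w} J] (F : J ⥤ Type w) {a b c : J} (f : a ⟶ b)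
    (g : b ⟶ c) (x : F.obj a) : F.map g (F.map f x) = F.map (f ≫ g) x := by
  rw [F.map_comp]; rfl

theorem map_iso {J : Type w} [Category.{w} J] (F : J ⥤ Type w) {a b : J} (i : a ≅ b)
    (x : F.obj a) : F.map i.inv (F.map i.hom x) = x := by
  rw [map_map, i.hom_inv_id, F.map_id]; rfl

/-- An element of `X`, restricted along the identity. -/
abbrev idElem {X : Cᵒᵖ ⥤ Type w} (e : X.Elements) : X.Elements :=
  X.elementsMk e.1 (X.map (𝟙 e.1) e.2)

/-- The canonical isomorphism between an element and its restriction along the identity. -/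
def idIso {X : Cᵒᵖ ⥤ Type w} (e : X.Elements) : e ≅ idElem e :=
  CategoryOfElements.isoMk _ _ (Iso.refl e.1) rfl

/-- The element of `(γ : 𝕪(Γ)).Y` at the identity of `Γ` given by an element of `Y`. -/
abbrev piPt {X : Cᵒᵖ ⥤ Type w} {Y : Dep X} (e : X.Elements) (y : Y.obj e) :
    (ext (yoneda.obj e.1.unop) (Dep.sub (orb e) Y)).Elements :=
  piElem Y (orb e) (𝟙 e.1.unop) (Y.map (idIso e).hom y)

/-- The canonical isomorphism from `piPt e y`, mapped to `X.Y`, to the element `(e, y)`. -/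
def piIso {X : Cᵒᵖ ⥤ Type w} {Y : Dep X} (e : X.Elements) (y : Y.obj e) :
    (NatTrans.mapElements (up (orb e) Y)).obj (piPt e y) ≅
      (ext X Y).elementsMk e.1 ⟨e.2, y⟩ where
  hom := extMk (idIso e).inv (Y.map (idIso e).hom y) y (map_iso Y (idIso e) y)
  inv := extMk (idIso e).hom y (Y.map (idIso e).hom y) rfl
  hom_inv_id := CategoryOfElements.ext _ _ _ (Category.comp_id _)
  inv_hom_id := CategoryOfElements.ext _ _ _ (Category.comp_id _)

theorem lamSec_bijective {X : Cᵒᵖ ⥤ Type w} {Y : Dep X} {Z : Dep (ext X Y)} :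
    Function.Bijective (lamSec : Z.sections → (pi Y Z).sections) := by
  constructor
  · intro s s' h
    refine Subtype.ext (funext ?_)
    rintro ⟨c, ⟨x, y⟩⟩
    have h₁ := congrArg (fun t => (t.1 ⟨c, x⟩).1 (piPt ⟨c, x⟩ y)) h
    have h₂ := congrArg (Z.map (piIso ⟨c, x⟩ y).hom) h₁
    exact (s.2 (piIso ⟨c, x⟩ y).hom).symm.trans (h₂.trans (s'.2 (piIso ⟨c, x⟩ y).hom))
  · intro s
    refine ⟨⟨fun e => Z.map (piIso ⟨e.1, e.2.1⟩ e.2.2).hom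
      ((s.1 ⟨e.1, e.2.1⟩).1 (piPt ⟨e.1, e.2.1⟩ e.2.2)), ?_⟩, ?_⟩
    · rintro ⟨c, ⟨x, y⟩⟩ ⟨c', ⟨x', y'⟩⟩ g
      have h := pi_section_map s ((NatTrans.mapElements (p Y)).map g) (𝟙 c.unop) _ (𝟙 c'.unop) _
        ((piIso ⟨c, x⟩ y).hom ≫ g ≫ (piIso ⟨c', x'⟩ y').inv) (by
          change ((𝟙 _ ≫ g.1 ≫ 𝟙 _ : c ⟶ c').unop) ≫ 𝟙 _ = 𝟙 _ ≫ g.1.unop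
          simp)
      have h' := congrArg (Z.map (piIso ⟨c', x'⟩ y').hom) h
      refine Eq.trans ?_ h'
      refine (map_map Z _ _ _).trans (Eq.trans ?_ (map_map Z _ _ _).symm)
      have hk : (piIso ⟨c, x⟩ y).hom ≫ g =
          ((piIso ⟨c, x⟩ y).hom ≫ g ≫ (piIso ⟨c', x'⟩ y').inv) ≫ (piIso ⟨c', x'⟩ y').hom := by
        refine CategoryOfElements.ext _ _ _ ?_
        change 𝟙 _ ≫ g.1 = (𝟙 _ ≫ g.1 ≫ 𝟙 _) ≫ 𝟙 _
        simp only [Category.id_comp, Category.comp_id]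
      exact congrArg (fun k => Z.map k _) hk
    · refine Subtype.ext (funext fun e => Subtype.ext (funext ?_))
      rintro ⟨d, ⟨ρ, y⟩⟩
      let e₁ : X.Elements := ⟨d, X.map ρ.op e.2⟩
      have h := pi_section_map s (e := e) (e' := e₁) ⟨ρ.op, rfl⟩ ρ y (𝟙 d.unop) _
        (piIso (Y := Y) e₁ y).inv rfl
      have h' := congrArg (Z.map (piIso (Y := Y) e₁ y).hom) h
      exact h'.symm.trans (map_iso Z (piIso (Y := Y) e₁ y).symm _)

/-- The slice over `Γ` is the category of elements of `𝕪(Γ)`. -/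
def overElem (Γ : C) : (Over Γ)ᵒᵖ ⥤ (yoneda.obj Γ).Elements where
  obj ρ := (yoneda.obj Γ).elementsMk (op ρ.unop.left) ρ.unop.hom
  map τ := CategoryOfElements.homMk _ _ τ.unop.left.op (Over.w τ.unop)
  map_id _ := CategoryOfElements.ext _ _ _ rfl
  map_comp _ _ := CategoryOfElements.ext _ _ _ rfl

/-- The restriction `Y|x` of a dependent presheaf `Y` over `X` to the slice over `Γ`, for an
element `x : 𝕪(Γ) ⟶ X`: the presheaf sending `ρ : Δ ⟶ Γ` to `Y(Δ, x[ρ])`. -/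
abbrev Dep.restrict {X : Cᵒᵖ ⥤ Type w} (Y : Dep X) {Γ : C} (x : yoneda.obj Γ ⟶ X) :
    (Over Γ)ᵒᵖ ⥤ Type w :=
  overElem Γ ⋙ Dep.sub x Y

/-- A dependent presheaf is locally representable if all its restrictions to slices are
representable. -/
def Dep.IsLocRep {X : Cᵒᵖ ⥤ Type w} (Y : Dep X) : Prop :=
  ∀ (Γ : C) (x : yoneda.obj Γ ⟶ X), (Y.restrict x).IsRepresentable

theorem Dep.IsLocRep.sub {X' X : Cᵒᵖ ⥤ Type w} (σ : X' ⟶ X) {Y : Dep X} (h : Y.IsLocRep) :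
    (Dep.sub σ Y).IsLocRep :=
  fun Γ x => h Γ (x ≫ σ)

theorem Dep.isLocRep_iff {X : Cᵒᵖ ⥤ Type w} (Y : Dep X) :
    Y.IsLocRep ↔ ∀ e : X.Elements, ∃ (e' : X.Elements) (π : e ⟶ e') (q : Y.obj e'),
      ∀ (d : X.Elements) (f : e ⟶ d) (y : Y.obj d), ∃! g : e' ⟶ d, π ≫ g = f ∧ Y.map g q = y := by
  constructor
  · intro h e
    obtain ⟨E, q, h⟩ := Functor.IsRepresentable.iff_exists_isRepresentedBy.1 (h _ (orb e))
    let π (ρ : Over e.1.unop) : e ⟶ X.elementsMk (op ρ.left) (X.map ρ.hom.op e.2) :=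
      CategoryOfElements.homMk _ _ ρ.hom.op rfl
    let F (ρ : Over e.1.unop) (τ : ρ ⟶ E) :
        X.elementsMk (op E.left) (X.map E.hom.op e.2) ⟶
          X.elementsMk (op ρ.left) (X.map ρ.hom.op e.2) :=
      (overElem e.1.unop ⋙ NatTrans.mapElements (orb e)).map τ.op
    refine ⟨_, π E, q, fun d f y => ?_⟩
    let ρ : Over e.1.unop := Over.mk f.1.unop
    let j : X.elementsMk (op ρ.left) (X.map ρ.hom.op e.2) ≅ d :=
      CategoryOfElements.isoMk _ _ (Iso.refl _) (by
        change X.map (𝟙 _) (X.map f.1 e.2) = d.2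
        rw [f.2]; simp)
    obtain ⟨τ, hτ⟩ := h.map_bijective.2 (Y.map j.inv y)
    change Y.map (F ρ τ) q = _ at hτ
    refine ⟨F ρ τ ≫ j.hom, ⟨?_, ?_⟩, ?_⟩
    · refine CategoryOfElements.ext _ _ _ ?_
      change E.hom.op ≫ τ.left.op ≫ 𝟙 _ = f.1
      rw [Category.comp_id, ← op_comp, Over.w]
      rfl
    · exact (map_map Y (F ρ τ) j.hom q).symm.trans
        ((congrArg (Y.map j.hom) hτ).trans (map_iso Y j.symm y))
    · rintro g ⟨hg, hgy⟩
      have hw : g.1.unop ≫ E.hom = ρ.hom :=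
        congrArg (fun k => k.1.unop) hg
      have hu : (Over.homMk g.1.unop hw : ρ ⟶ E) = τ := by
        apply h.map_bijective.1
        change Y.map (F ρ _) q = Y.map (F ρ τ) q
        refine Eq.trans ?_ ((map_map Y g j.inv q).symm.trans
          ((congrArg (Y.map j.inv) hgy).trans hτ.symm))
        refine congrArg (fun k => Y.map k q) (CategoryOfElements.ext _ _ _ ?_)
        change g.1 = g.1 ≫ 𝟙 _
        rw [Category.comp_id]
      subst hu
      refine CategoryOfElements.ext _ _ _ ?_
      change g.1 = g.1 ≫ 𝟙 _
      rw [Category.comp_id]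
  · intro h Γ x
    obtain ⟨e, rfl⟩ : ∃ x' : X.obj (op Γ), x = yonedaEquiv.symm x' :=
      ⟨yonedaEquiv x, (yonedaEquiv.symm_apply_apply x).symm⟩
    obtain ⟨e', π, q, h⟩ := h (X.elementsMk (op Γ) e)
    let E : Over Γ := Over.mk π.1.unop
    let k : X.elementsMk (op E.left) (X.map E.hom.op e) ≅ e' :=
      CategoryOfElements.isoMk _ _ (Iso.refl _) (by
        change X.map (𝟙 _) (X.map π.1 e) = e'.2
        rw [π.2]; simp)
    refine Functor.IsRepresentable.iff_exists_isRepresentedBy.2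
      ⟨E, Y.map k.inv q, ⟨fun {ρ} => ?_⟩⟩
    let π' : X.elementsMk (op Γ) e ⟶ X.elementsMk (op ρ.left) (X.map ρ.hom.op e) :=
      CategoryOfElements.homMk _ _ ρ.hom.op rfl
    let F (τ : ρ ⟶ E) : X.elementsMk (op E.left) (X.map E.hom.op e) ⟶
          X.elementsMk (op ρ.left) (X.map ρ.hom.op e) :=
      (overElem Γ ⋙ NatTrans.mapElements (yonedaEquiv.symm e)).map τ.op
    have hF (τ : ρ ⟶ E) : π ≫ k.inv ≫ F τ = π' := by
      refine CategoryOfElements.ext _ _ _ ?_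
      change π.1 ≫ 𝟙 _ ≫ τ.left.op = ρ.hom.op
      rw [Category.id_comp, ← Over.w τ]
      rfl
    constructor
    · intro τ τ' hτ
      change Y.map (F τ) (Y.map k.inv q) = Y.map (F τ') (Y.map k.inv q) at hτ
      rw [map_map, map_map] at hτ
      have := (h _ π' _).unique ⟨hF τ, hτ⟩ ⟨hF τ', rfl⟩
      have h₂ : 𝟙 _ ≫ τ.left.op = 𝟙 _ ≫ τ'.left.op := congrArg Subtype.val this
      rw [Category.id_comp, Category.id_comp] at h₂
      exact Over.OverMorphism.ext (Quiver.Hom.op_inj h₂)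
    · intro y
      obtain ⟨g, ⟨hg, hgy⟩, -⟩ := h _ π' y
      have hw : g.1.unop ≫ E.hom = ρ.hom := congrArg (fun k => k.1.unop) hg
      refine ⟨Over.homMk g.1.unop hw, ?_⟩
      change Y.map (F _) (Y.map k.inv q) = y
      rw [map_map, ← hgy]
      refine congrArg (fun k => Y.map k q) (CategoryOfElements.ext _ _ _ ?_)
      change 𝟙 _ ≫ g.1 = g.1
      rw [Category.id_comp]

/-- The terminal dependent presheaf. -/
def unit (X : Cᵒᵖ ⥤ Type w) : Dep X := (Functor.const _).obj PUnit

theorem isLocRep_unit (X : Cᵒᵖ ⥤ Type w) : (unit X).IsLocRep := by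
  rw [Dep.isLocRep_iff]
  intro e
  exact ⟨e, 𝟙 e, PUnit.unit, fun d f y => ⟨f, ⟨Category.id_comp f, rfl⟩,
    fun g hg => (Category.id_comp g).symm.trans hg.1⟩⟩

theorem isLocRep_sig {X : Cᵒᵖ ⥤ Type w} {Y : Dep X} {Z : Dep (ext X Y)} (hY : Y.IsLocRep)
    (hZ : Z.IsLocRep) : (sig Y Z).IsLocRep := by
  rw [Dep.isLocRep_iff] at *
  intro e
  obtain ⟨e₁, π₁, q₁, h₁⟩ := hY e
  obtain ⟨e₂, π₂, q₂, h₂⟩ := hZ ((ext X Y).elementsMk e₁.1 ⟨e₁.2, q₁⟩)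
  let P := NatTrans.mapElements (p Y)
  let π₂' : e₁ ⟶ P.obj e₂ := P.map π₂
  have hπ₂ : Y.map π₂' q₁ = e₂.2.2 := (qSec Y).2 π₂
  refine ⟨P.obj e₂, π₁ ≫ π₂', ⟨e₂.2.2, q₂⟩, ?_⟩
  rintro d f ⟨y, z⟩
  obtain ⟨g, ⟨hg, hgy⟩, hu⟩ := h₁ d f y
  obtain ⟨k, ⟨hk, hkz⟩, hv⟩ := h₂ _ (extMk g q₁ y hgy) z
  have key : ∀ (m : P.obj e₂ ⟶ d) (y' : Y.obj d) (hm : Y.map m e₂.2.2 = y'),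
      (sig Y Z).map m (⟨e₂.2.2, q₂⟩ : (sig Y Z).obj (P.obj e₂)) =
        ⟨y', Z.map (extMk (e := P.obj e₂) m e₂.2.2 y' hm) q₂⟩ := by
    rintro m _ rfl; rfl
  refine ⟨P.map k, ⟨?_, ?_⟩, ?_⟩
  · have hk' : π₂' ≫ P.map k = g := by
      refine CategoryOfElements.ext _ _ _ ?_
      exact congrArg (fun t => t.1) hk
    exact (Category.assoc _ _ _).trans ((congrArg (fun t => π₁ ≫ t) hk').trans hg)
  · refine (key (P.map k) y ((qSec Y).2 k)).trans ?_
    exact congrArg (Sigma.mk y) hkz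
  · rintro m ⟨hm, hmz⟩
    have hm₁ : Y.map m e₂.2.2 = y := congrArg Sigma.fst hmz
    have hm₂ := (key m y hm₁).symm.trans hmz
    have hm₃ : Z.map (extMk (e := P.obj e₂) m e₂.2.2 y hm₁) q₂ = z :=
      eq_of_heq (Sigma.mk.inj hm₂).2
    have hm₄ : π₂' ≫ m = g := by
      apply hu
      refine ⟨(Category.assoc _ _ _).symm.trans hm, ?_⟩
      rw [← map_map, hπ₂, hm₁]
    have := hv (extMk (e := P.obj e₂) m e₂.2.2 y hm₁) ⟨?_, hm₃⟩
    · refine CategoryOfElements.ext _ _ _ ?_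
      exact congrArg (fun t => t.1) this
    · refine CategoryOfElements.ext _ _ _ ?_
      exact congrArg (fun t => t.1) hm₄

/-- The section of `Y` given by a term of type `Y`. -/
def termSec {X : Cᵒᵖ ⥤ Type w} (t : Tm X) (Y : Dep X) (h : t.1 = Y) : Y.sections :=
  h ▸ t.2

theorem eq_mk_termSec {X : Cᵒᵖ ⥤ Type w} (t : Tm X) (Y : Dep X) (h : t.1 = Y) :
    t = ⟨Y, termSec t Y h⟩ := by
  subst h; rfl

theorem exists_sec {X : Cᵒᵖ ⥤ Type w} (t : Tm X) (Y : Dep X) (h : t.1 = Y) :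
    ∃ s, t = ⟨Y, s⟩ :=
  ⟨_, eq_mk_termSec t Y h⟩

theorem term_heq {X : Cᵒᵖ ⥤ Type w} {t t' : Tm X} (h : t = t') (e : X.Elements) :
    HEq (t.2.1 e) (t'.2.1 e) := by
  subst h; rfl

theorem lift_unique {X' X : Cᵒᵖ ⥤ Type w} (Y : Dep X) (τ τ' : X' ⟶ ext X Y)
    (h₁ : τ ≫ p Y = τ' ≫ p Y)
    (h₂ : Tm.sub τ ⟨Dep.sub (p Y) Y, qSec Y⟩ = Tm.sub τ' ⟨Dep.sub (p Y) Y, qSec Y⟩) : τ = τ' := by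
  refine NatTrans.ext (funext fun c => ConcreteCategory.hom_ext _ _ fun x => ?_)
  exact Sigma.ext (congrArg (fun k => k.app c x) h₁) (term_heq h₂ ⟨c, x⟩)

/-- A section of a dependent sum. -/
def pairSec {X : Cᵒᵖ ⥤ Type w} {Y : Dep X} {Z : Dep (ext X Y)} (a : Y.sections)
    (b : (Dep.sub (lift (𝟙 X) Y a) Z).sections) : (sig Y Z).sections :=
  ⟨fun e => ⟨a.1 e, b.1 e⟩, by
    intro e e' f
    have key : ∀ (y' : Y.obj e') (h : Y.map f (a.1 e) = y'),
      (⟨Y.map f (a.1 e), Z.map (extMk f (a.1 e) _ rfl) (b.1 e)⟩ : (sig Y Z).obj e') =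
        ⟨y', Z.map (extMk f (a.1 e) y' h) (b.1 e)⟩ := by
      rintro _ rfl; rfl
    exact (key _ (a.2 f)).trans (congrArg (Sigma.mk _) (b.2 f))⟩

/-- The first projection of a section of a dependent sum. -/
def fstSec {X : Cᵒᵖ ⥤ Type w} {Y : Dep X} {Z : Dep (ext X Y)} (s : (sig Y Z).sections) :
    Y.sections :=
  ⟨fun e => (s.1 e).1, fun f => congrArg Sigma.fst (s.2 f)⟩

/-- The second projection of a section of a dependent sum. -/
def sndSec {X : Cᵒᵖ ⥤ Type w} {Y : Dep X} {Z : Dep (ext X Y)} (s : (sig Y Z).sections) :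
    (Dep.sub (lift (𝟙 X) Y (fstSec s)) Z).sections :=
  ⟨fun e => (s.1 e).2, by
    intro e e' f
    have key : ∀ (y' : Y.obj e') (h : Y.map f (s.1 e).1 = y'),
      (sig Y Z).map f (s.1 e) = ⟨y', Z.map (extMk f (s.1 e).1 y' h) (s.1 e).2⟩ := by
      rintro _ rfl; rfl
    have h := (key _ ((fstSec s).2 f)).symm.trans (s.2 f)
    exact eq_of_heq (Sigma.mk.inj h).2⟩

/-- The term of a dependent sum given by a pair of terms. -/
def pair {X : Cᵒᵖ ⥤ Type w} (Y : Dep X) (Z : Dep (ext X Y)) (a b : Tm X) (ha : a.1 = Y)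
    (hb : b.1 = Dep.sub (lift (𝟙 X) Y (termSec a Y ha)) Z) : Tm X :=
  ⟨sig Y Z, pairSec (termSec a Y ha) (termSec b _ hb)⟩

theorem pair_sub {X' X : Cᵒᵖ ⥤ Type w} (σ : X' ⟶ X) (Y : Dep X) (Z : Dep (ext X Y)) (a b : Tm X)
    (ha : a.1 = Y) (hb : b.1 = Dep.sub (lift (𝟙 X) Y (termSec a Y ha)) Z)
    (ha' : (Tm.sub σ a).1 = Dep.sub σ Y)
    (hb' : (Tm.sub σ b).1 =
      Dep.sub (lift (𝟙 X') (Dep.sub σ Y) (termSec (Tm.sub σ a) _ ha')) (Dep.sub (up σ Y) Z)) :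
    Tm.sub σ (pair Y Z a b ha hb) =
      pair (Dep.sub σ Y) (Dep.sub (up σ Y) Z) (Tm.sub σ a) (Tm.sub σ b) ha' hb' := by
  obtain ⟨a, rfl⟩ := exists_sec a Y ha
  obtain ⟨b, rfl⟩ := exists_sec b _ hb
  rfl

theorem pair_bijective {X : Cᵒᵖ ⥤ Type w} (Y : Dep X) (Z : Dep (ext X Y)) (t : Tm X)
    (h : t.1 = sig Y Z) : ∃! ab : Tm X × Tm X, ∃ ha hb, pair Y Z ab.1 ab.2 ha hb = t := by
  obtain ⟨s, rfl⟩ := exists_sec t _ h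
  refine ⟨⟨⟨Y, fstSec s⟩, ⟨_, sndSec s⟩⟩, ⟨rfl, rfl, rfl⟩, ?_⟩
  rintro ⟨a, b⟩ ⟨ha, hb, hs⟩
  obtain ⟨a, rfl⟩ := exists_sec a Y ha
  have hb' : b.1 = Dep.sub (lift (𝟙 X) Y a) Z := hb
  obtain ⟨b, rfl⟩ := exists_sec b _ hb'
  obtain rfl : pairSec a b = s := eq_of_heq (Sigma.mk.inj hs).2
  rfl

variable (C)

/-- The category with families of presheaves over `C`: the types over `X` are the dependent
presheaves over `X`, and the terms of type `Y` are the sections of `Y`. -/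
def cwf : CwF.{w + 1, w} where
  Obj := Cᵒᵖ ⥤ Type w
  nil := (Functor.const _).obj PUnit
  nilIsTerminal := Limits.IsTerminal.ofUniqueHom
    (fun X => NatTrans.mk (fun _ => TypeCat.ofHom fun _ => PUnit.unit))
    (fun _ _ => by ext; rfl)
  Ty := Dep
  tySub := Dep.sub
  tySub_id _ := rfl
  tySub_comp _ _ _ := rfl
  Tm := Tm
  tmSub := Tm.sub
  tmSub_id _ := rfl
  tmSub_comp _ _ _ := rfl
  tp t := t.1
  tp_sub _ _ := rfl
  ext := ext
  p := p
  q Y := ⟨Dep.sub (p Y) Y, qSec Y⟩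
  tp_q _ := rfl
  lift σ Y a h := lift σ Y (termSec a _ h)
  lift_p σ Y a h := rfl
  lift_q _ _ a h := (eq_mk_termSec a _ h).symm
  lift_unique := lift_unique

/-- The terminal dependent presheaves. -/
def unitStr : (cwf C).UnitStr (cwf C).full where
  one := unit
  one_sub _ := rfl
  tt X := ⟨unit X, fun _ => PUnit.unit, fun _ => rfl⟩
  tp_tt _ := rfl
  tt_unique := by
    rintro X ⟨_, s⟩ rfl
    rfl

/-- Dependent sums of dependent presheaves. -/
def sigmaStr : (cwf C).SigmaStr (cwf C).full where
  sig := sig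
  sig_sub _ _ _ := rfl
  pair := pair
  tp_pair _ _ _ _ _ _ := rfl
  pair_sub := pair_sub
  pair_bijective := pair_bijective

/-- Dependent products of dependent presheaves. -/
def piStr : (cwf C).PiStr (cwf C).full where
  pi := pi
  pi_sub := pi_sub
  lam Y b := ⟨pi Y b.1, lamSec b.2⟩
  tp_lam _ _ := rfl
  lam_sub σ Y b := lam_sub σ b.2
  lam_bijective := by
    rintro X Y Z ⟨_, s⟩ rfl
    obtain ⟨b, hb⟩ := lamSec_bijective.2 s
    refine ⟨⟨Z, b⟩, ⟨rfl, congrArg (Sigma.mk _) hb⟩, ?_⟩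
    rintro ⟨_, b'⟩ ⟨rfl, hb'⟩
    have h := eq_of_heq (Sigma.mk.inj hb').2
    exact congrArg (Sigma.mk _) (lamSec_bijective.1 (h.trans hb.symm))

/-- Equality of sections, as a dependent presheaf. -/
def eqDep {X : Cᵒᵖ ⥤ Type w} (a b : Tm X) (h : a.1 = b.1) : Dep X where
  obj e := ULift.{w} (PLift (HEq (a.2.1 e) (b.2.1 e)))
  map {e e'} f := TypeCat.ofHom fun z => ⟨⟨by
    obtain ⟨Y, a⟩ := a
    obtain ⟨_, b⟩ := b
    obtain rfl : Y = _ := h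
    have := eq_of_heq z.down.down
    exact heq_of_eq ((a.2 f).symm.trans ((congrArg (Y.map f) this).trans (b.2 f)))⟩⟩
  map_id _ := rfl
  map_comp _ _ := rfl

/-- Equality types of dependent presheaves. -/
def eqStr : (cwf C).EqStr where
  eq := eqDep C
  eq_sub _ _ _ _ _ := rfl
  refl a := ⟨eqDep C a a rfl, fun _ => ⟨⟨HEq.rfl⟩⟩, fun _ => rfl⟩
  tp_refl _ := rfl
  reflection := by
    intro X a b h t ht
    obtain ⟨t, -⟩ := exists_sec t _ ht
    obtain ⟨b, rfl⟩ := exists_sec b _ h.symm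
    exact congrArg (Sigma.mk a.1) (Subtype.ext (funext fun e => eq_of_heq (t.1 e).down.down))
  eq_unique := by
    rintro X a ⟨_, t⟩ rfl
    rfl

/-- The presheaf model of extensional type theory. -/
def ettModel : ETTModel.{w + 1, w} where
  toCwF := cwf C
  unit := unitStr C
  sigma := sigmaStr C
  pi := piStr C
  eq := eqStr C

/-- The locally representable dependent presheaves. -/
def locRep : (cwf C).Restriction where
  Ty' X := {Y : Dep X // Y.IsLocRep}
  sub σ Y := ⟨Dep.sub σ Y.1, Y.2.sub σ⟩
  sub_id _ := rfl
  sub_comp _ _ _ := rfl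
  ι Y := Y.1
  ι_sub _ _ := rfl

/-- The terminal dependent presheaves are locally representable. -/
def locRepUnitStr : (cwf C).UnitStr (locRep C) where
  one X := ⟨unit X, isLocRep_unit X⟩
  one_sub _ := rfl
  tt := (unitStr C).tt
  tp_tt := (unitStr C).tp_tt
  tt_unique := (unitStr C).tt_unique

/-- Locally representable dependent presheaves are closed under dependent sums. -/
def locRepSigmaStr : (cwf C).SigmaStr (locRep C) where
  sig Y Z := ⟨sig Y.1 Z.1, isLocRep_sig Y.2 Z.2⟩
  sig_sub _ _ _ := rfl
  pair Y Z := pair Y.1 Z.1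
  tp_pair _ _ _ _ _ _ := rfl
  pair_sub σ Y Z := pair_sub σ Y.1 Z.1
  pair_bijective Y Z := pair_bijective Y.1 Z.1

/-- The `(Σ, Π_rep)`-CwF of presheaves over `C`: the presheaf model of extensional type theory,
whose representable types are the locally representable dependent presheaves. -/
def spCwF : SPCwF.{w + 1, w} :=
  (ettModel C).toSPCwF (locRep C) (locRepUnitStr C) (locRepSigmaStr C)

end Psh

namespace Yoneda

variable (T : CwF.{w, w})

/-- The Yoneda embedding on types: `A` is sent to the dependent presheaf over `𝕪(Γ)` of terms of
substitution instances of `A`. -/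
def ty {Γ : T.Obj} (A : T.Ty Γ) : Psh.Dep (yoneda.obj Γ) where
  obj e := {a : T.Tm e.1.unop // T.tp a = T.tySub (e.2 : e.1.unop ⟶ Γ) A}
  map {e e'} f := TypeCat.ofHom fun a => ⟨T.tmSub f.1.unop a.1, by
    rw [T.tp_sub, a.2, ← T.tySub_comp]
    exact congrArg (fun σ => T.tySub σ A) f.2⟩
  map_id e := ConcreteCategory.hom_ext _ _ fun a => Subtype.ext (T.tmSub_id a.1)
  map_comp f g := ConcreteCategory.hom_ext _ _ fun a =>
    Subtype.ext (T.tmSub_comp g.1.unop f.1.unop a.1)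

/-- The Yoneda embedding on terms: a term `a` of type `A[σ]` in context `Δ`, for `σ : Δ ⟶ Γ`, is
sent to the section `ρ ↦ a[ρ]` of `𝕪(A)[𝕪(σ)]` over `𝕪(Δ)`. -/
def tm {Δ Γ : T.Obj} (σ : Δ ⟶ Γ) (A : T.Ty Γ) (a : T.Tm Δ) (h : T.tp a = T.tySub σ A) :
    (Psh.Dep.sub (yoneda.map σ) (ty T A)).sections :=
  ⟨fun e => ⟨T.tmSub (e.2 : e.1.unop ⟶ Δ) a, by
    refine (T.tp_sub _ a).trans ((congrArg (T.tySub _) h).trans ?_)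
    exact (T.tySub_comp _ _ A).symm⟩, fun {e e'} f => Subtype.ext (by
      refine (T.tmSub_comp f.1.unop (e.2 : e.1.unop ⟶ Δ) a).symm.trans ?_
      exact congrArg (fun σ => T.tmSub σ a) f.2)⟩

end Yoneda

/-- A `2`-cell `𝕪 ≅ F` from the Yoneda embedding to a strict morphism `F : T ⟶ Psh(T)`: a natural
isomorphism `α` of the underlying functors, with isomorphisms `ψ A : 𝕪(A) ≅ F(A)[α]` of dependent
presheaves over `𝕪(Γ)` for all types `A` over `Γ`, compatible with the actions on terms (and hence
with substitution and context extension): for `σ : Δ ⟶ Γ` and a term `a` of type `A[σ]` over `Δ`,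
the term `F(a)[α]` over `𝕪(Δ)` is the image of `𝕪(a)` under `(ψ A)[𝕪(σ)]`. -/
structure YonedaTwoCell {T : SPCwF.{w, w}} (F : SPCwF.Hom T (Psh.spCwF T.Obj)) where
  α : (yoneda : T.Obj ⥤ T.Objᵒᵖ ⥤ Type w) ≅ F.fn
  ψ : ∀ {Γ : T.Obj} (A : T.Ty Γ), Yoneda.ty T.toCwF A ≅ Psh.Dep.sub (α.hom.app Γ) (F.ty A)
  tm : ∀ {Δ Γ : T.Obj} (σ : Δ ⟶ Γ) (A : T.Ty Γ) (a : T.Tm Δ) (h : T.tp a = T.tySub σ A),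
    Psh.Tm.sub (α.hom.app Δ) (F.tm a) =
      ⟨Psh.Dep.sub (yoneda.map σ ≫ α.hom.app Γ) (F.ty A),
        (Functor.sectionsFunctor _).map
          (Functor.whiskerLeft (NatTrans.mapElements (yoneda.map σ)) (ψ A).hom)
          (Yoneda.tm T.toCwF σ A a h)⟩

/-!
The Yoneda embedding `𝕪` of a SOGAT `T` is not a strict morphism, since it preserves context
extensions and type formers only up to isomorphism. It is strictified by lifting against a trivial
fibration; this uses only that `T` is cellular.

A *labelled presheaf* (`Labelled.Ctx`) over `Γ` is a presheaf `X` over `T` with an isomorphism to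
`𝕪(Γ)`, and a *labelled dependent presheaf* (`Labelled.Dep`) over `X` and a type `A` is a dependent
presheaf over `X` with an isomorphism to the dependent presheaf of terms of instances of `A`.
All the operations of presheaves lift to labelled ones: for example, an element of a dependent sum
is labelled by the pair of the labels of its components, and an element of a dependent product,
which is a section over an extended representable, is labelled by the abstraction of the term
labelling that section. Moreover, the context extensions of `T` show that all labelled dependent
presheaves are locally representable (`Labelled.Dep.isLocRep`). So labelled presheaves form a
`(Σ, Π_rep)`-CwF `Labelled.spCwF T` with strict projections `Labelled.spFst T` to `T` and
`Labelled.spSnd T` to presheaves, both of which are bijective on terms. The labels form a `2`-cell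
from the first projection followed by `𝕪` to the second projection (`Labelled.relTwoCell`). It
remains to find a section of `Labelled.spFst T`; its composite with `Labelled.spSnd T` is the
required morphism `y`, and the `2`-cell `𝕪 ≅ y` is that of the labels.

The first projection lifts types and representable types, because every type labels a dependent
presheaf (`Labelled.Dep.gen`), and it is bijective on terms. These properties amount to the right
lifting property against the generic extensions (`SPCwF.IsTrivialFibration.rlp`), so that such a
morphism splits over every cellular object (`SPCwF.IsTrivialFibration.exists_section`). There is a
problem of size: the labelled presheaves do not form a small category, whereas the freeness that
defines the generic extensions concerns small `(Σ, Π_rep)`-CwFs only. Therefore `spCwF T` is first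
replaced by its small sub-CwF `Labelled.small T` of the labelled presheaves generated by `Dep.gen`
under the operations. These are named by an inductive family of codes (`Labelled.Code`), and the
structure of `spCwF T` restricts to them because their interpretation is injective on types and
bijective on terms (`CwF.Hom.IsEmbedding`).
-/

/-! ### Substitution calculus in a category with families -/

namespace CwF

theorem inst_comp_up (C : CwF.{u, v}) {Δ Γ : C.Obj} (σ : Δ ⟶ Γ) (A : C.Ty Γ) (A' : C.Ty Δ)
    (h : A' = C.tySub σ A) (a : C.Tm Δ) (ha : C.tp a = A') :
    C.inst A' a ha ≫ C.up σ A A' h = C.lift σ A a (ha.trans h) := by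
  apply C.lift_unique
  · rw [Category.assoc, up, C.lift_p, C.lift_p, ← Category.assoc, inst, C.lift_p, Category.id_comp]
  · rw [C.tmSub_comp, up, C.lift_q, C.lift_q, inst, C.lift_q]

theorem comp_lift (C : CwF.{u, v}) {Θ Δ Γ : C.Obj} (τ : Θ ⟶ Δ) (σ : Δ ⟶ Γ) (A : C.Ty Γ)
    (a : C.Tm Δ) (h : C.tp a = C.tySub σ A) :
    τ ≫ C.lift σ A a h = C.lift (τ ≫ σ) A (C.tmSub τ a)
      (by rw [C.tp_sub, h, C.tySub_comp]) := by
  apply C.lift_unique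
  · rw [Category.assoc, C.lift_p, C.lift_p]
  · rw [C.tmSub_comp, C.lift_q, C.lift_q]

theorem lift_congr (C : CwF.{u, v}) {Δ Γ : C.Obj} {σ σ' : Δ ⟶ Γ} (A : C.Ty Γ)
    {a a' : C.Tm Δ} (h : C.tp a = C.tySub σ A) (hσ : σ = σ') (ha : a = a') :
    C.lift σ A a h = C.lift σ' A a' (by rw [← hσ, ← ha, h]) := by
  subst hσ ha; rfl

theorem lift_comp_up (C : CwF.{u, v}) {Θ Δ Γ : C.Obj} (ρ : Θ ⟶ Δ) (σ : Δ ⟶ Γ) (A : C.Ty Γ)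
    (A' : C.Ty Δ) (h : A' = C.tySub σ A) (a : C.Tm Θ) (ha : C.tp a = C.tySub ρ A') :
    C.lift ρ A' a ha ≫ C.up σ A A' h =
      C.lift (ρ ≫ σ) A a (by rw [ha, h, C.tySub_comp]) := by
  apply C.lift_unique
  · rw [Category.assoc, up, C.lift_p, C.lift_p, ← Category.assoc, C.lift_p]
  · rw [C.tmSub_comp, up, C.lift_q, C.lift_q, C.lift_q]

theorem up_comp_up (C : CwF.{u, v}) {Θ Δ Γ : C.Obj} (τ : Θ ⟶ Δ) (σ : Δ ⟶ Γ) (A : C.Ty Γ)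
    (A' : C.Ty Δ) (h : A' = C.tySub σ A) (A'' : C.Ty Θ) (h' : A'' = C.tySub τ A') :
    C.up τ A' A'' h' ≫ C.up σ A A' h =
      C.up (τ ≫ σ) A A'' (by rw [h', h, C.tySub_comp]) := by
  rw [up, lift_comp_up]
  exact C.lift_congr _ _ (Category.assoc _ _ _) rfl

end CwF

/-! ### Labelled presheaves -/

namespace Labelled

variable (T : CwF.{w, w})

/-- A presheaf over `T` whose elements are labelled by the substitutions into `Γ`, that is, a
presheaf with a chosen isomorphism to `𝕪(Γ)`. -/
structure Ctx (Γ : T.Obj) where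
  X : T.Objᵒᵖ ⥤ Type w
  α : X ≅ yoneda.obj Γ

variable {T}

namespace Ctx

variable {Γ Γ' Γ'' : T.Obj}

/-- The substitution labelling an element. -/
def lab (X : Ctx T Γ) (e : X.X.Elements) : e.1.unop ⟶ Γ := X.α.hom.app e.1 e.2

theorem lab_map (X : Ctx T Γ) {e e' : X.X.Elements} (f : e ⟶ e') :
    f.1.unop ≫ X.lab e = X.lab e' := by
  have h := NatTrans.naturality_apply X.α.hom f.1 e.2
  rw [f.2] at h
  exact h.symm

/-- The element labelled by `ρ`. -/
def pt (X : Ctx T Γ) {Δ : T.Obj} (ρ : Δ ⟶ Γ) : X.X.obj (op Δ) := X.α.inv.app (op Δ) ρ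

theorem lab_pt (X : Ctx T Γ) {Δ : T.Obj} (ρ : Δ ⟶ Γ) : X.lab ⟨op Δ, X.pt ρ⟩ = ρ :=
  congrArg (fun k : yoneda.obj Γ ⟶ yoneda.obj Γ => k.app (op Δ) ρ) X.α.inv_hom_id

theorem pt_lab (X : Ctx T Γ) (e : X.X.Elements) : X.pt (X.lab e) = e.2 :=
  congrArg (fun k : X.X ⟶ X.X => k.app e.1 e.2) X.α.hom_inv_id

theorem lab_inj (X : Ctx T Γ) {c} {x x' : X.X.obj c} (h : X.lab ⟨c, x⟩ = X.lab ⟨c, x'⟩) :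
    x = x' := by
  have := congrArg X.pt h
  exact (X.pt_lab ⟨c, x⟩).symm.trans (this.trans (X.pt_lab ⟨c, x'⟩))

/-- A morphism of presheaves acts as composition with `σ` on labels. -/
def Over (X' : Ctx T Γ') (X : Ctx T Γ) (m : X'.X ⟶ X.X) (σ : Γ' ⟶ Γ) : Prop :=
  ∀ e, X.lab ((NatTrans.mapElements m).obj e) = X'.lab e ≫ σ

theorem Over.id (X : Ctx T Γ) : X.Over X (𝟙 _) (𝟙 _) := fun _ => (Category.comp_id _).symm

theorem Over.comp {X'' : Ctx T Γ''} {X' : Ctx T Γ'} {X : Ctx T Γ} {m' : X''.X ⟶ X'.X}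
    {m : X'.X ⟶ X.X} {σ' : Γ'' ⟶ Γ'} {σ : Γ' ⟶ Γ} (h' : X''.Over X' m' σ') (h : X'.Over X m σ) :
    X''.Over X (m' ≫ m) (σ' ≫ σ) := fun e =>
  (h ((NatTrans.mapElements m').obj e)).trans
    ((congrArg (fun k => k ≫ σ) (h' e)).trans (Category.assoc _ _ _))

/-- There is only one morphism of labelled presheaves over `σ`, as the labellings are injective. All
functoriality properties of substitution in labelled presheaves follow from this. -/
theorem Over.unique {X' : Ctx T Γ'} {X : Ctx T Γ} {m m' : X'.X ⟶ X.X} {σ : Γ' ⟶ Γ}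
    (h : X'.Over X m σ) (h' : X'.Over X m' σ) : m = m' := by
  refine NatTrans.ext (funext fun c => ConcreteCategory.hom_ext _ _ fun x => ?_)
  exact X.lab_inj ((h ⟨c, x⟩).trans (h' ⟨c, x⟩).symm)

/-- The morphism of presheaves given by a substitution. -/
def map (X' : Ctx T Γ') (X : Ctx T Γ) (σ : Γ' ⟶ Γ) : X'.X ⟶ X.X :=
  X'.α.hom ≫ yoneda.map σ ≫ X.α.inv

theorem map_over (X' : Ctx T Γ') (X : Ctx T Γ) (σ : Γ' ⟶ Γ) : X'.Over X (X'.map X σ) σ :=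
  fun e => X.lab_pt (X'.lab e ≫ σ)

end Ctx

variable {Γ Γ' Γ'' : T.Obj}

/-- A dependent presheaf whose elements are labelled bijectively and naturally by the terms of
substitution instances of `A`. -/
structure Dep (X : Ctx T Γ) (A : T.Ty Γ) where
  Y : Psh.Dep X.X
  ψ : ∀ {e : X.X.Elements}, Y.obj e → T.Tm e.1.unop
  tp_ψ : ∀ {e : X.X.Elements} (y : Y.obj e), T.tp (ψ y) = T.tySub (X.lab e) A
  ψ_map : ∀ {e e' : X.X.Elements} (f : e ⟶ e') (y : Y.obj e),
    ψ (Y.map f y) = T.tmSub f.1.unop (ψ y)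
  ψ_inj : ∀ {e : X.X.Elements} (y y' : Y.obj e), ψ y = ψ y' → y = y'
  ψ_surj : ∀ {e : X.X.Elements} (a : T.Tm e.1.unop), T.tp a = T.tySub (X.lab e) A →
    ∃ y : Y.obj e, ψ y = a

namespace Dep

theorem ext' {X : Ctx T Γ} {A : T.Ty Γ} {D D' : Dep X A} (h : D.Y = D'.Y)
    (hψ : ∀ e (y : D.Y.obj e) (y' : D'.Y.obj e), HEq y y' → D.ψ y = D'.ψ y') : D = D' := by
  obtain ⟨Y, ψ, _⟩ := D
  obtain ⟨Y', ψ', _⟩ := D'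
  obtain rfl : Y = Y' := h
  obtain rfl : @ψ = @ψ' := by
    funext e y
    exact hψ e y y HEq.rfl
  rfl

theorem tySub_lab {X' : Ctx T Γ'} {X : Ctx T Γ} {σ : Γ' ⟶ Γ} {m : X'.X ⟶ X.X}
    (hm : X'.Over X m σ) (A : T.Ty Γ) (A' : T.Ty Γ') (hA : A' = T.tySub σ A)
    (e : X'.X.Elements) :
    T.tySub (X.lab ((NatTrans.mapElements m).obj e)) A = T.tySub (X'.lab e) A' :=
  (congrArg (fun k => T.tySub k A) (hm e)).trans
    ((T.tySub_comp _ _ _).trans (congrArg _ hA.symm))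

/-- Substitution along a morphism of presheaves acting as `σ` on labels. -/
def sub {X' : Ctx T Γ'} {X : Ctx T Γ} {σ : Γ' ⟶ Γ} (m : X'.X ⟶ X.X)
    (hm : X'.Over X m σ) {A : T.Ty Γ} (D : Dep X A) (A' : T.Ty Γ') (hA : A' = T.tySub σ A) :
    Dep X' A' where
  Y := Psh.Dep.sub m D.Y
  ψ y := D.ψ y
  tp_ψ y := (D.tp_ψ y).trans (tySub_lab hm A A' hA _)
  ψ_map f y := D.ψ_map ((NatTrans.mapElements m).map f) y
  ψ_inj y y' h := D.ψ_inj y y' h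
  ψ_surj a h :=
    D.ψ_surj (e := (NatTrans.mapElements m).obj _) a (h.trans (tySub_lab hm A A' hA _).symm)

/-- The element labelled by a term. -/
noncomputable def el {X : Ctx T Γ} {A : T.Ty Γ} (D : Dep X A) (e : X.X.Elements) (a : T.Tm e.1.unop)
    (h : T.tp a = T.tySub (X.lab e) A) : D.Y.obj e :=
  (D.ψ_surj a h).choose

theorem ψ_el {X : Ctx T Γ} {A : T.Ty Γ} (D : Dep X A) (e : X.X.Elements) (a : T.Tm e.1.unop)
    (h : T.tp a = T.tySub (X.lab e) A) : D.ψ (D.el e a h) = a :=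
  (D.ψ_surj a h).choose_spec

/-- The section of a labelled dependent presheaf given by a term. -/
noncomputable def sec {X : Ctx T Γ} {A : T.Ty Γ} (D : Dep X A) (a : T.Tm Γ) (h : T.tp a = A) :
    D.Y.sections :=
  ⟨fun e => D.el e (T.tmSub (X.lab e) a) (by rw [T.tp_sub, h]), fun {e e'} f => by
    apply D.ψ_inj
    rw [D.ψ_map, ψ_el, ψ_el, ← T.tmSub_comp, X.lab_map]⟩

theorem ψ_sec {X : Ctx T Γ} {A : T.Ty Γ} (D : Dep X A) (a : T.Tm Γ) (h : T.tp a = A)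
    (e : X.X.Elements) : D.ψ ((D.sec a h).1 e) = T.tmSub (X.lab e) a :=
  D.ψ_el e _ ((T.tp_sub _ _).trans (congrArg _ h))

/-- The term labelling a section: the label of its value at the element of `X` labelled by the
identity. -/
def term {X : Ctx T Γ} {A : T.Ty Γ} (D : Dep X A) (s : D.Y.sections) : T.Tm Γ :=
  D.ψ (s.1 (X.X.elementsMk (op Γ) (X.pt (𝟙 Γ))))

theorem tp_term {X : Ctx T Γ} {A : T.Ty Γ} (D : Dep X A) (s : D.Y.sections) :
    T.tp (D.term s) = A := by
  refine (D.tp_ψ _).trans ?_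
  rw [X.lab_pt, T.tySub_id]

/-- By naturality, a section is determined by its value at the element labelled by the identity. -/
theorem ψ_section {X : Ctx T Γ} {A : T.Ty Γ} (D : Dep X A) (s : D.Y.sections)
    (e : X.X.Elements) : D.ψ (s.1 e) = T.tmSub (X.lab e) (D.term s) := by
  let f : X.X.elementsMk (op Γ) (X.pt (𝟙 Γ)) ⟶ e := CategoryOfElements.homMk _ _ (X.lab e).op <|
    X.lab_inj ((X.lab_map (e := X.X.elementsMk (op Γ) (X.pt (𝟙 Γ)))
      (CategoryOfElements.homMk _ (X.X.elementsMk _ _) (X.lab e).op rfl)).symm.trans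
        ((congrArg (fun k => X.lab e ≫ k) (X.lab_pt _)).trans (Category.comp_id _)))
  exact (congrArg D.ψ (s.2 f).symm).trans (D.ψ_map f _)

theorem term_inj {X : Ctx T Γ} {A : T.Ty Γ} (D : Dep X A) {s s' : D.Y.sections}
    (h : D.term s = D.term s') : s = s' :=
  Subtype.ext (funext fun e => D.ψ_inj _ _ (by rw [ψ_section, ψ_section, h]))

theorem term_sec {X : Ctx T Γ} {A : T.Ty Γ} (D : Dep X A) (a : T.Tm Γ) (h : T.tp a = A) :
    D.term (D.sec a h) = a := by
  refine (D.ψ_sec a h _).trans ?_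
  rw [X.lab_pt, T.tmSub_id]

theorem term_secSub {X' : Ctx T Γ'} {X : Ctx T Γ} {σ : Γ' ⟶ Γ} {m : X'.X ⟶ X.X}
    (hm : X'.Over X m σ) {A : T.Ty Γ} (D : Dep X A) (A' : T.Ty Γ') (hA : A' = T.tySub σ A)
    (s : D.Y.sections) : (D.sub m hm A' hA).term (Psh.secSub m s) = T.tmSub σ (D.term s) := by
  refine (D.ψ_section s _).trans (congrArg (fun k => T.tmSub k _) ?_)
  refine (hm _).trans ?_
  rw [X'.lab_pt, Category.id_comp]

/-- The sections of a labelled dependent presheaf are determined by their labels. -/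
theorem eq_sec {X : Ctx T Γ} {A : T.Ty Γ} (D : Dep X A) (a : T.Tm Γ) (h : T.tp a = A)
    (s : D.Y.sections) (hs : ∀ e, D.ψ (s.1 e) = T.tmSub (X.lab e) a) : s = D.sec a h :=
  Subtype.ext (funext fun e => D.ψ_inj _ _ ((hs e).trans (D.ψ_sec a h e).symm))

end Dep

/-- The context extension by a labelled dependent presheaf: an element `(x, y)` is labelled by the
substitution that extends the label of `x` by the label of `y`. -/
noncomputable def Ctx.ext (X : Ctx T Γ) {A : T.Ty Γ} (D : Dep X A) : Ctx T (T.ext Γ A) where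
  X := Psh.ext X.X D.Y
  α :=
    have bij : ∀ c : T.Objᵒᵖ, Function.Bijective
        (fun z : (Psh.ext X.X D.Y).obj c => T.lift (X.lab ⟨c, z.1⟩) A (D.ψ z.2) (D.tp_ψ z.2)) := by
      intro c
      constructor
      · rintro ⟨x, y⟩ ⟨x', y'⟩ h
        have h₁ := congrArg (fun k => k ≫ T.p A) h
        simp only [T.lift_p] at h₁
        obtain rfl := X.lab_inj h₁
        have h₂ := congrArg (fun k => T.tmSub k (T.q A)) h
        simp only [T.lift_q] at h₂
        obtain rfl := D.ψ_inj _ _ h₂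
        rfl
      · intro τ
        have h₁ : X.lab ⟨c, X.pt (τ ≫ T.p A)⟩ = τ ≫ T.p A := X.lab_pt _
        obtain ⟨y, hy⟩ := D.ψ_surj (e := ⟨c, X.pt (τ ≫ T.p A)⟩) (T.tmSub τ (T.q A)) (by
          rw [T.tp_sub, T.tp_q, ← T.tySub_comp, h₁])
        refine ⟨⟨X.pt (τ ≫ T.p A), y⟩, T.lift_unique _ _ _ ?_ ?_⟩
        · rw [T.lift_p, h₁]
        · rw [T.lift_q, hy]
    NatIso.ofComponents (fun c => (Equiv.ofBijective _ (bij c)).toIso) (by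
      intro c d f
      refine ConcreteCategory.hom_ext _ _ fun z => ?_
      refine Eq.trans ?_ (T.comp_lift f.unop (X.lab ⟨c, z.1⟩) A (D.ψ z.2) (D.tp_ψ z.2)).symm
      let m : X.X.elementsMk c z.1 ⟶ X.X.elementsMk d (X.X.map f z.1) :=
        CategoryOfElements.homMk _ _ f rfl
      exact T.lift_congr A _ (X.lab_map m).symm (D.ψ_map m z.2))

theorem Ctx.lab_ext (X : Ctx T Γ) {A : T.Ty Γ} (D : Dep X A) (e : (X.ext D).X.Elements) :
    (X.ext D).lab e = T.lift (X.lab ⟨e.1, e.2.1⟩) A (D.ψ (e := ⟨e.1, e.2.1⟩) e.2.2)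
      (D.tp_ψ (e := ⟨e.1, e.2.1⟩) e.2.2) := rfl

theorem Ctx.p_over (X : Ctx T Γ) {A : T.Ty Γ} (D : Dep X A) :
    (X.ext D).Over X (Psh.p D.Y) (T.p A) := fun e => by
  rw [Ctx.lab_ext, T.lift_p]; rfl

theorem Ctx.lift_over {X' : Ctx T Γ'} {X : Ctx T Γ} {A : T.Ty Γ} (D : Dep X A) (σ : Γ' ⟶ Γ)
    (m : X'.X ⟶ X.X) (hm : X'.Over X m σ) (a : T.Tm Γ') (h : T.tp a = T.tySub σ A)
    (s : (Psh.Dep.sub m D.Y).sections) (hs : ∀ e, D.ψ (s.1 e) = T.tmSub (X'.lab e) a) :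
    X'.Over (X.ext D) (Psh.lift m D.Y s) (T.lift σ A a h) := fun e => by
  rw [Ctx.lab_ext, T.comp_lift]
  exact T.lift_congr A _ (hm e) (hs e)

theorem Ctx.up_over {X' : Ctx T Γ'} {X : Ctx T Γ} {A : T.Ty Γ} (D : Dep X A) (σ : Γ' ⟶ Γ)
    (m : X'.X ⟶ X.X) (hm : X'.Over X m σ) (A' : T.Ty Γ') (h : A' = T.tySub σ A) :
    (X'.ext (D.sub m hm A' h)).Over (X.ext D) (Psh.up m D.Y) (T.up σ A A' h) := by
  refine Ctx.lift_over D _ _ ((X'.p_over _).comp hm) _ _ _ fun e => ?_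
  rw [Ctx.lab_ext, T.lift_q]
  rfl

/-- Labelled types in a restricted family. -/
structure Ty (R : T.Restriction) (X : Ctx T Γ) where
  A : R.Ty' Γ
  D : Dep X (R.ι A)

namespace Ty

variable {R : T.Restriction}

theorem ext' {X : Ctx T Γ} {t t' : Ty R X} (hA : t.A = t'.A) (hY : t.D.Y = t'.D.Y)
    (hψ : ∀ e (y : t.D.Y.obj e) (y' : t'.D.Y.obj e), HEq y y' → t.D.ψ y = t'.D.ψ y') :
    t = t' := by
  obtain ⟨A, D⟩ := t
  obtain ⟨A', D'⟩ := t'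
  obtain rfl : A = A' := hA
  obtain rfl := Dep.ext' hY hψ
  rfl

/-- Substitution in a labelled type. -/
def sub {X' : Ctx T Γ'} {X : Ctx T Γ} (σ : Γ' ⟶ Γ) (m : X'.X ⟶ X.X) (hm : X'.Over X m σ)
    (t : Ty R X) : Ty R X' :=
  ⟨R.sub σ t.A, t.D.sub m hm _ (R.ι_sub σ t.A)⟩

theorem sub_congr {X' : Ctx T Γ'} {X : Ctx T Γ} {σ σ' : Γ' ⟶ Γ} {m m' : X'.X ⟶ X.X}
    (h : X'.Over X m σ) (h' : X'.Over X m' σ') (hσ : σ = σ') (t : Ty R X) :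
    t.sub σ m h = t.sub σ' m' h' := by
  subst hσ
  obtain rfl := h.unique h'
  rfl

theorem sub_id {X : Ctx T Γ} (t : Ty R X) {m : X.X ⟶ X.X} (h : X.Over X m (𝟙 Γ)) :
    t.sub (𝟙 Γ) m h = t := by
  obtain rfl := h.unique (Ctx.Over.id X)
  exact ext' (R.sub_id _) rfl (by rintro e y _ ⟨⟩; rfl)

theorem sub_comp {X'' : Ctx T Γ''} {X' : Ctx T Γ'} {X : Ctx T Γ} {m' : X''.X ⟶ X'.X}
    {m : X'.X ⟶ X.X} {σ' : Γ'' ⟶ Γ'} {σ : Γ' ⟶ Γ} (h' : X''.Over X' m' σ') (h : X'.Over X m σ)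
    {m'' : X''.X ⟶ X.X} (h'' : X''.Over X m'' (σ' ≫ σ)) (t : Ty R X) :
    t.sub (σ' ≫ σ) m'' h'' = (t.sub σ m h).sub σ' m' h' := by
  obtain rfl := h''.unique (h'.comp h)
  exact ext' (R.sub_comp _ _ _) rfl (by rintro e y _ ⟨⟩; rfl)

/-- The inclusion of a restricted family in all types. -/
def ι {X : Ctx T Γ} (t : Ty R X) : Ty T.full X := ⟨R.ι t.A, t.D⟩

theorem ι_sub {X' : Ctx T Γ'} {X : Ctx T Γ} (σ : Γ' ⟶ Γ) (m : X'.X ⟶ X.X)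
    (hm : X'.Over X m σ) (t : Ty R X) : (t.sub σ m hm).ι = t.ι.sub σ m hm :=
  ext' (R.ι_sub _ _) rfl (by rintro e y _ ⟨⟩; rfl)

end Ty

/-- Labelled terms: since the sections of a labelled dependent presheaf are labelled by terms,
a labelled term is determined by its label. -/
structure Tm (X : Ctx T Γ) where
  ty : Ty T.full X
  a : T.Tm Γ
  tp_a : T.tp a = ty.A

theorem Tm.ext' {X : Ctx T Γ} {t t' : Tm X} (h : t.ty = t'.ty) (ha : t.a = t'.a) : t = t' := by
  obtain ⟨A, a, _⟩ := t
  obtain ⟨A', a', _⟩ := t'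
  obtain rfl : A = A' := h
  obtain rfl : a = a' := ha
  rfl

variable (T)

/-- The contexts of labelled presheaves. -/
structure Obj where
  Γ : T.Obj
  X : Ctx T Γ

/-- The morphisms between labelled presheaves are the substitutions between the labels. -/
instance : Category.{w} (Obj T) where
  Hom X Y := X.Γ ⟶ Y.Γ
  id X := 𝟙 X.Γ
  comp f g := f ≫ g
  id_comp f := Category.id_comp (obj := T.Obj) f
  comp_id f := Category.comp_id (obj := T.Obj) f
  assoc f g h := Category.assoc (obj := T.Obj) f g h

/-- The category with families of labelled presheaves over `T`. -/
noncomputable def cwf : CwF.{w + 1, w} where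
  Obj := Obj T
  nil := ⟨T.nil, (Functor.const _).obj PUnit, NatIso.ofComponents
    (fun c => Equiv.toIso
      { toFun _ := T.nilIsTerminal.from c.unop
        invFun _ := PUnit.unit
        left_inv _ := rfl
        right_inv _ := T.nilIsTerminal.hom_ext _ _ })
    (fun _ => ConcreteCategory.hom_ext _ _ fun _ => T.nilIsTerminal.hom_ext _ _)⟩
  nilIsTerminal := Limits.IsTerminal.ofUniqueHom (fun X => T.nilIsTerminal.from X.Γ)
    (fun _ m => T.nilIsTerminal.hom_ext m _)
  Ty X := Ty T.full X.X
  tySub {X' X} σ t := t.sub σ (X'.X.map X.X σ) (X'.X.map_over X.X σ)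
  tySub_id t := t.sub_id _
  tySub_comp _ _ t := t.sub_comp _ _ _
  Tm X := Tm X.X
  tmSub {X' X} σ t := ⟨t.ty.sub σ (X'.X.map X.X σ) (X'.X.map_over X.X σ), T.tmSub σ t.a,
    (T.tp_sub _ _).trans (congrArg _ t.tp_a)⟩
  tmSub_id t := Tm.ext' (t.ty.sub_id _) (T.tmSub_id _)
  tmSub_comp _ _ t := Tm.ext' (t.ty.sub_comp _ _ _) (T.tmSub_comp _ _ _)
  tp t := t.ty
  tp_sub _ _ := rfl
  ext X t := ⟨T.ext X.Γ t.A, X.X.ext t.D⟩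
  p t := T.p t.A
  q {X} t := ⟨t.sub (T.p t.A) (Psh.p t.D.Y) (X.X.p_over t.D), T.q t.A, T.tp_q t.A⟩
  tp_q t := t.sub_congr _ _ rfl
  lift σ t a h := T.lift σ t.A a.a (a.tp_a.trans (congrArg Ty.A h))
  lift_p _ _ _ _ := T.lift_p _ _ _ _
  lift_q {X' X} σ t _ h := Tm.ext' ((t.sub_comp _ _
    ((Ctx.map_over _ _ _).comp (X.X.p_over t.D))).symm.trans
    ((t.sub_congr _ (X'.X.map_over X.X σ) (T.lift_p _ _ _ _)).trans h.symm)) (T.lift_q _ _ _ _)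
  lift_unique t σ τ h h' := T.lift_unique t.A σ τ h (congrArg Tm.a h')

end Labelled

/-! ### Pairing and abstraction over substituted types -/

namespace CwF

theorem Restriction.sub_up_heq {C : CwF.{u, v}} (R : C.Restriction) {Δ Γ : C.Obj} {σ σ' : Δ ⟶ Γ}
    {A : C.Ty Γ} {A₁ A₂ : C.Ty Δ} (h₁ : A₁ = C.tySub σ A) (h₂ : A₂ = C.tySub σ' A)
    (hσ : σ = σ') (B : R.Ty' (C.ext Γ A)) :
    HEq (R.sub (C.up σ A A₁ h₁) B) (R.sub (C.up σ' A A₂ h₂) B) := by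
  subst hσ h₁ h₂; rfl

namespace SigmaStr

variable {C : CwF.{u, v}} {R : C.Restriction} (S : C.SigmaStr R)

theorem sig_congr {Γ : C.Obj} {A A' : R.Ty' Γ} {B : R.Ty' (C.ext Γ (R.ι A))}
    {B' : R.Ty' (C.ext Γ (R.ι A'))} (hA : A = A') (hB : HEq B B') : S.sig A B = S.sig A' B' := by
  subst hA; obtain rfl := eq_of_heq hB; rfl

theorem pair_congr {Γ : C.Obj} {A A' : R.Ty' Γ} {B : R.Ty' (C.ext Γ (R.ι A))}
    {B' : R.Ty' (C.ext Γ (R.ι A'))} (hA : A = A') (hB : HEq B B') {a a' b b' : C.Tm Γ}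
    (ha : a = a') (hb : b = b') (h₁ h₂ h₁' h₂') :
    S.pair A B a b h₁ h₂ = S.pair A' B' a' b' h₁' h₂' := by
  subst hA ha hb; obtain rfl := eq_of_heq hB; rfl

theorem tp_snd_at {Δ Γ : C.Obj} (ρ : Δ ⟶ Γ) (A : R.Ty' Γ) (B : R.Ty' (C.ext Γ (R.ι A)))
    (a : C.Tm Δ) (ha : C.tp a = C.tySub ρ (R.ι A)) (ha' : C.tp a = R.ι (R.sub ρ A)) :
    C.tySub (C.inst _ a ha') (R.ι (R.sub (C.up ρ (R.ι A) _ (R.ι_sub ρ A)) B)) =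
      C.tySub (C.lift ρ (R.ι A) a ha) (R.ι B) := by
  rw [R.ι_sub (C.up _ _ _ _), ← C.tySub_comp, C.inst_comp_up]

/-- Pairing for the substitution instance of `Σ(A, B)` along `ρ`. -/
def pairAt {Δ Γ : C.Obj} (ρ : Δ ⟶ Γ) (A : R.Ty' Γ) (B : R.Ty' (C.ext Γ (R.ι A)))
    (a b : C.Tm Δ) (ha : C.tp a = C.tySub ρ (R.ι A))
    (hb : C.tp b = C.tySub (C.lift ρ (R.ι A) a ha) (R.ι B)) : C.Tm Δ :=
  S.pair (R.sub ρ A) (R.sub (C.up ρ (R.ι A) _ (R.ι_sub ρ A)) B) a b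
    (ha.trans (R.ι_sub ρ A).symm) (hb.trans (tp_snd_at ρ A B a ha _).symm)

theorem tp_pairAt {Δ Γ : C.Obj} (ρ : Δ ⟶ Γ) (A : R.Ty' Γ) (B : R.Ty' (C.ext Γ (R.ι A)))
    (a b : C.Tm Δ) (ha : C.tp a = C.tySub ρ (R.ι A))
    (hb : C.tp b = C.tySub (C.lift ρ (R.ι A) a ha) (R.ι B)) :
    C.tp (S.pairAt ρ A B a b ha hb) = C.tySub ρ (R.ι (S.sig A B)) := by
  rw [pairAt, S.tp_pair, ← S.sig_sub, R.ι_sub]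

theorem pairAt_congr {Δ Γ : C.Obj} {ρ ρ' : Δ ⟶ Γ} (A : R.Ty' Γ) (B : R.Ty' (C.ext Γ (R.ι A)))
    {a a' b b' : C.Tm Δ} (hρ : ρ = ρ') (ha : a = a') (hb : b = b') (h₁ h₂ h₁' h₂') :
    S.pairAt ρ A B a b h₁ h₂ = S.pairAt ρ' A B a' b' h₁' h₂' := by
  subst hρ ha hb; rfl

theorem pairAt_id {Γ : C.Obj} (A : R.Ty' Γ) (B : R.Ty' (C.ext Γ (R.ι A)))
    (a b : C.Tm Γ) (h₁ h₂ h₁' h₂') : S.pairAt (𝟙 Γ) A B a b h₁ h₂ = S.pair A B a b h₁' h₂' := by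
  refine S.pair_congr (R.sub_id A) ?_ rfl rfl _ _ _ _
  have key : ∀ (A' : C.Ty Γ) (h : A' = C.tySub (𝟙 Γ) (R.ι A)) (_ : A' = R.ι A),
      HEq (R.sub (C.up (𝟙 Γ) (R.ι A) A' h) B) B := by
    rintro _ h rfl
    have : C.up (𝟙 Γ) (R.ι A) (R.ι A) h = 𝟙 _ := by
      apply C.lift_unique
      · rw [up, C.lift_p, Category.comp_id, Category.id_comp]
      · rw [up, C.lift_q, C.tmSub_id]
    rw [this, R.sub_id]
  exact key _ _ (congrArg R.ι (R.sub_id A))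

theorem pairAt_comp {Θ Δ Γ : C.Obj} (ρ : Θ ⟶ Δ) (σ : Δ ⟶ Γ) (A : R.Ty' Γ)
    (B : R.Ty' (C.ext Γ (R.ι A))) (a b : C.Tm Θ) (h₁ h₂ h₁' h₂') :
    S.pairAt ρ (R.sub σ A) (R.sub (C.up σ (R.ι A) _ (R.ι_sub σ A)) B) a b h₁ h₂ =
      S.pairAt (ρ ≫ σ) A B a b h₁' h₂' := by
  refine S.pair_congr (R.sub_comp _ _ _).symm ?_ rfl rfl _ _ _ _
  have h : R.ι (R.sub ρ (R.sub σ A)) = C.tySub (ρ ≫ σ) (R.ι A) := by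
    rw [R.ι_sub, R.ι_sub, C.tySub_comp]
  refine HEq.trans (b := R.sub (C.up (ρ ≫ σ) (R.ι A) _ h) B) (heq_of_eq ?_)
    (R.sub_up_heq _ _ rfl _)
  exact (R.sub_comp _ _ B).symm.trans (congrArg (fun k => R.sub k B) (C.up_comp_up _ _ _ _ _ _ _))

theorem pairAt_sub {Θ Δ Γ : C.Obj} (τ : Θ ⟶ Δ) (ρ : Δ ⟶ Γ) (A : R.Ty' Γ)
    (B : R.Ty' (C.ext Γ (R.ι A))) (a b : C.Tm Δ) (h₁ h₂ h₁' h₂') :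
    C.tmSub τ (S.pairAt ρ A B a b h₁ h₂) =
      S.pairAt (τ ≫ ρ) A B (C.tmSub τ a) (C.tmSub τ b) h₁' h₂' := by
  have h₃ : C.tp (C.tmSub τ a) = C.tySub τ (R.ι (R.sub ρ A)) := by
    rw [h₁', C.tySub_comp, R.ι_sub]
  have h₄ : C.tp (C.tmSub τ b) = C.tySub (C.lift τ (R.ι (R.sub ρ A)) (C.tmSub τ a) h₃)
      (R.ι (R.sub (C.up ρ (R.ι A) _ (R.ι_sub ρ A)) B)) := by
    rw [h₂', R.ι_sub (C.up ρ _ _ _), ← C.tySub_comp, C.lift_comp_up]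
  exact (S.pair_sub τ _ _ _ _ _ _ _ _).trans (S.pairAt_comp τ ρ A B _ _ h₃ h₄ h₁' h₂')

theorem pairAt_inj {Δ Γ : C.Obj} {ρ : Δ ⟶ Γ} {A : R.Ty' Γ} {B : R.Ty' (C.ext Γ (R.ι A))}
    {a b a' b' : C.Tm Δ} {h₁ h₂ h₁' h₂'}
    (h : S.pairAt ρ A B a b h₁ h₂ = S.pairAt ρ A B a' b' h₁' h₂') : a = a' ∧ b = b' := by
  have := (S.pair_bijective _ _ _ (S.tp_pair _ _ _ _ _ _)).unique
    (y₁ := (a, b)) (y₂ := (a', b')) ⟨_, _, h⟩ ⟨_, _, rfl⟩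
  exact ⟨congrArg Prod.fst this, congrArg Prod.snd this⟩

theorem exists_pairAt {Δ Γ : C.Obj} (ρ : Δ ⟶ Γ) (A : R.Ty' Γ) (B : R.Ty' (C.ext Γ (R.ι A)))
    (t : C.Tm Δ) (ht : C.tp t = C.tySub ρ (R.ι (S.sig A B))) :
    ∃ a b h₁ h₂, S.pairAt ρ A B a b h₁ h₂ = t := by
  rw [← R.ι_sub, S.sig_sub] at ht
  obtain ⟨⟨a, b⟩, ⟨ha, hb, h⟩, -⟩ := S.pair_bijective _ _ _ ht
  have ha' := ha.trans (R.ι_sub _ _)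
  exact ⟨a, b, ha', hb.trans (tp_snd_at ρ A B a ha' _), h⟩

end SigmaStr

theorem tmSub_up_heq (C : CwF.{u, v}) {Δ Γ : C.Obj} {σ σ' : Δ ⟶ Γ}
    {A : C.Ty Γ} {A₁ A₂ : C.Ty Δ} (h₁ : A₁ = C.tySub σ A) (h₂ : A₂ = C.tySub σ' A)
    (hσ : σ = σ') (b : C.Tm (C.ext Γ A)) :
    HEq (C.tmSub (C.up σ A A₁ h₁) b) (C.tmSub (C.up σ' A A₂ h₂) b) := by
  subst hσ h₁ h₂; rfl

theorem PiStr.pi_congr {C : CwF.{u, v}} {R : C.Restriction} (P : C.PiStr R) {Γ : C.Obj}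
    {A A' : R.Ty' Γ} {B : C.Ty (C.ext Γ (R.ι A))} {B' : C.Ty (C.ext Γ (R.ι A'))} (hA : A = A')
    (hB : HEq B B') : P.pi A B = P.pi A' B' := by
  subst hA; obtain rfl := eq_of_heq hB; rfl

theorem PiStr.lam_congr {C : CwF.{u, v}} {R : C.Restriction} (P : C.PiStr R) {Γ : C.Obj}
    {A A' : R.Ty' Γ} {b : C.Tm (C.ext Γ (R.ι A))} {b' : C.Tm (C.ext Γ (R.ι A'))} (hA : A = A')
    (hb : HEq b b') : P.lam A b = P.lam A' b' := by
  subst hA; obtain rfl := eq_of_heq hb; rfl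

end CwF

/-! ### Type formers on labelled presheaves -/

namespace Labelled

variable {T : CwF.{w, w}} {Γ Γ' : T.Obj} {R : T.Restriction}

/-- Labelled types in a restricted family, as a restriction of the labelled types. -/
def fam (R : T.Restriction) : (cwf T).Restriction where
  Ty' X := Ty R X.X
  sub {X' X} σ t := t.sub σ (X'.X.map X.X σ) (X'.X.map_over X.X σ)
  sub_id t := t.sub_id _
  sub_comp _ _ t := t.sub_comp _ _ _
  ι t := t.ι
  ι_sub σ t := t.ι_sub σ _ _

/-- The unit type, labelled by its term. -/
def Ty.unit (U : T.UnitStr R) (X : Ctx T Γ) : Ty R X where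
  A := U.one Γ
  D :=
    { Y := Psh.unit X.X
      ψ {e} _ := U.tt e.1.unop
      tp_ψ {e} _ := by rw [U.tp_tt, ← R.ι_sub, U.one_sub]
      ψ_map f _ := (U.tt_unique _ (by rw [T.tp_sub, U.tp_tt, ← R.ι_sub, U.one_sub])).symm
      ψ_inj _ _ _ := rfl
      ψ_surj a h := ⟨PUnit.unit, (U.tt_unique a (by rw [h, ← R.ι_sub, U.one_sub])).symm⟩ }

/-- The labelled `𝟏`-types of a restricted family. -/
def unitStr (U : T.UnitStr R) : (cwf T).UnitStr (fam R) where
  one X := Ty.unit U X.X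
  one_sub σ := Ty.ext' (U.one_sub σ) rfl fun _ _ _ _ => rfl
  tt X := ⟨(Ty.unit U X.X).ι, U.tt X.Γ, U.tp_tt X.Γ⟩
  tp_tt _ := rfl
  tt_unique t h := Tm.ext' h (U.tt_unique _ (t.tp_a.trans (congrArg Ty.A h)))

/-- Dependent sums, labelled by pairs. -/
def Ty.sig (S : T.SigmaStr R) {X : Ctx T Γ} (t : Ty R X) (t' : Ty R (X.ext t.D)) : Ty R X where
  A := S.sig t.A t'.A
  D :=
    { Y := Psh.sig t.D.Y t'.D.Y
      ψ {e} z := S.pairAt (X.lab e) t.A t'.A (t.D.ψ z.1) (t'.D.ψ z.2) (t.D.tp_ψ z.1)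
        (t'.D.tp_ψ z.2)
      tp_ψ _ := S.tp_pairAt _ _ _ _ _ _ _
      ψ_map {e e'} f z := by
        have h₁ := t.D.ψ_map f z.1
        have h₂ := t'.D.ψ_map (Psh.extMk f z.1 _ rfl) z.2
        have h₃ := X.lab_map f
        have h₄ := t.D.tp_ψ (t.D.Y.map f z.1)
        have h₅ := t'.D.tp_ψ (t'.D.Y.map (Psh.extMk f z.1 _ rfl) z.2)
        have h₆ : T.tp (T.tmSub f.1.unop (t.D.ψ z.1)) =
            T.tySub (f.1.unop ≫ X.lab e) (R.ι t.A) := by rw [← h₁, h₄, h₃]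
        refine Eq.trans ?_ (S.pairAt_sub f.1.unop _ _ _ _ _ _ _ h₆ ?_).symm
        · exact S.pairAt_congr _ _ h₃.symm h₁ h₂ _ _ _ _
        · rw [← T.comp_lift _ _ _ _ (t.D.tp_ψ z.1), T.tp_sub, T.tySub_comp]
          exact congrArg _ (t'.D.tp_ψ z.2)
      ψ_inj := by
        rintro e ⟨y, z⟩ ⟨y', z'⟩ h
        obtain ⟨h₁, h₂⟩ := S.pairAt_inj h
        obtain rfl := t.D.ψ_inj _ _ h₁
        obtain rfl := t'.D.ψ_inj _ _ h₂
        rfl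
      ψ_surj {e} a h := by
        obtain ⟨a, b, h₁, h₂, rfl⟩ := S.exists_pairAt _ _ _ _ h
        obtain ⟨y, rfl⟩ := t.D.ψ_surj a h₁
        obtain ⟨z, rfl⟩ := t'.D.ψ_surj
          (e := (Psh.ext X.X t.D.Y).elementsMk e.1 ⟨e.2, y⟩) b h₂
        exact ⟨⟨y, z⟩, rfl⟩ }

theorem Ty.sig_sub (S : T.SigmaStr R) {X' : Ctx T Γ'} {X : Ctx T Γ} (σ : Γ' ⟶ Γ)
    (m : X'.X ⟶ X.X) (hm : X'.Over X m σ) (t : Ty R X) (t' : Ty R (X.ext t.D))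
    (k : (X'.ext (t.sub σ m hm).D).X ⟶ (X.ext t.D).X)
    (hk : (X'.ext (t.sub σ m hm).D).Over (X.ext t.D) k (T.up σ (R.ι t.A) _ (R.ι_sub σ t.A))) :
    (Ty.sig S t t').sub σ m hm = Ty.sig S (t.sub σ m hm) (t'.sub _ k hk) := by
  obtain rfl := hk.unique (Ctx.up_over t.D σ m hm _ _)
  refine Ty.ext' (S.sig_sub _ _ _) rfl ?_
  rintro e y y' h
  obtain rfl := eq_of_heq h
  have h₁ : T.tp (t.D.ψ y.1) = T.tySub (X'.lab e ≫ σ) (R.ι t.A) :=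
    (t.D.tp_ψ y.1).trans (congrArg (fun k => T.tySub k _) (hm e))
  have h₂ : T.tp (t'.D.ψ y.2) =
      T.tySub (T.lift (X'.lab e ≫ σ) (R.ι t.A) (t.D.ψ y.1) h₁) (R.ι t'.A) :=
    (t'.D.tp_ψ y.2).trans (congrArg (fun k => T.tySub k _) (T.lift_congr _ _ (hm e) rfl))
  have h₃ : T.tp (t.D.ψ y.1) = T.tySub (X'.lab e) (R.ι (R.sub σ t.A)) := by
    rw [R.ι_sub, ← T.tySub_comp]; exact h₁
  have h₄ : T.tp (t'.D.ψ y.2) = T.tySub (T.lift (X'.lab e) (R.ι (R.sub σ t.A)) (t.D.ψ y.1) h₃)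
      (R.ι (R.sub (T.up σ (R.ι t.A) _ (R.ι_sub σ t.A)) t'.A)) := by
    rw [R.ι_sub (T.up _ _ _ _), ← T.tySub_comp]
    exact h₂.trans (congrArg (fun k => T.tySub k _) (T.lift_comp_up _ _ _ _ _ _ h₃).symm)
  exact (S.pairAt_congr _ _ (hm e) rfl rfl (t.D.tp_ψ y.1) (t'.D.tp_ψ y.2) h₁ h₂).trans
    (S.pairAt_comp (X'.lab e) σ t.A t'.A _ _ h₃ h₄ h₁ h₂).symm

/-- The labelled `Σ`-types of a restricted family. -/
def sigmaStr (S : T.SigmaStr R) : (cwf T).SigmaStr (fam R) where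
  sig t t' := Ty.sig S t t'
  sig_sub {X' X} σ t t' := Ty.sig_sub S σ _ _ t t' _ (Ctx.map_over _ _ _)
  pair t t' a b ha hb := ⟨(Ty.sig S t t').ι,
    S.pair t.A t'.A a.a b.a (a.tp_a.trans (congrArg Ty.A ha)) (b.tp_a.trans (congrArg Ty.A hb)),
    S.tp_pair _ _ _ _ _ _⟩
  tp_pair _ _ _ _ _ _ := rfl
  pair_sub {X' X} σ t t' a b ha hb ha' hb' := by
    refine Tm.ext' ?_ (S.pair_sub σ t.A t'.A a.a b.a _ _ _ _)
    exact (Ty.ι_sub _ _ _ _).symm.trans (congrArg Ty.ι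
      (Ty.sig_sub S σ _ _ t t' _ (Ctx.map_over _ _ _)))
  pair_bijective {X} t t' s h := by
    obtain ⟨⟨a, b⟩, ⟨ha, hb, hab⟩, hu⟩ := S.pair_bijective t.A t'.A s.a
      (s.tp_a.trans (congrArg Ty.A h))
    have ha' : (cwf T).tp (⟨t.ι, a, ha⟩ : Tm X.X) = (fam R).ι t := rfl
    refine ⟨⟨⟨t.ι, a, ha⟩, ⟨(cwf T).tySub ((cwf T).inst ((fam R).ι t) ⟨t.ι, a, ha⟩ ha')
      ((fam R).ι t'), b, hb⟩⟩, ⟨ha', rfl, Tm.ext' h.symm hab⟩, ?_⟩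
    rintro ⟨⟨u, a', h₁⟩, ⟨v, b', h₂⟩⟩ ⟨hu₁, hv, hs⟩
    obtain rfl : u = t.ι := hu₁
    obtain rfl : v = (cwf T).tySub ((cwf T).inst ((fam R).ι t) ⟨t.ι, a', h₁⟩ rfl)
      ((fam R).ι t') := hv
    have := hu (a', b') ⟨h₁, h₂, congrArg Tm.a hs⟩
    obtain rfl : a' = a := congrArg Prod.fst this
    obtain rfl : b' = b := congrArg Prod.snd this
    rfl

/-- The representable presheaf, labelled by its elements. -/
def Ctx.yo (Γ : T.Obj) : Ctx T Γ := ⟨yoneda.obj Γ, Iso.refl _⟩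

theorem Ctx.orb_over (X : Ctx T Γ) (e : X.X.Elements) :
    (Ctx.yo e.1.unop).Over X (Psh.orb e) (X.lab e) := fun e' =>
  (X.lab_map (e := e) (e' := X.X.elementsMk e'.1 (X.X.map (Quiver.Hom.op e'.2) e.2))
    (CategoryOfElements.homMk _ _ _ rfl)).symm

/-- The term labelling a section of `Z` over `(γ : 𝕪(Δ)).Y(o(γ))`. -/
noncomputable def piTerm {X : Ctx T Γ} {A : T.Ty Γ} {B : T.Ty (T.ext Γ A)} (D : Dep X A)
    (E : Dep (X.ext D) B) {Δ : T.Obj} (o : yoneda.obj Δ ⟶ X.X) (ρ : Δ ⟶ Γ)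
    (ho : (Ctx.yo Δ).Over X o ρ) (A' : T.Ty Δ) (hA : A' = T.tySub ρ A)
    (s : Psh.PiFib D.Y E.Y o) : T.Tm (T.ext Δ A') :=
  (E.sub _ (Ctx.up_over (X' := Ctx.yo Δ) D ρ o ho A' hA) _ rfl).term s

theorem tp_piTerm {X : Ctx T Γ} {A : T.Ty Γ} {B : T.Ty (T.ext Γ A)} (D : Dep X A)
    (E : Dep (X.ext D) B) {Δ : T.Obj} (o : yoneda.obj Δ ⟶ X.X) (ρ : Δ ⟶ Γ)
    (ho : (Ctx.yo Δ).Over X o ρ) (A' : T.Ty Δ) (hA : A' = T.tySub ρ A)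
    (s : Psh.PiFib D.Y E.Y o) :
    T.tp (piTerm D E o ρ ho A' hA s) = T.tySub (T.up ρ A A' hA) B :=
  Dep.tp_term (E.sub _ (Ctx.up_over (X' := Ctx.yo Δ) D ρ o ho A' hA) _ rfl) s

theorem ψ_piTerm {X : Ctx T Γ} {A : T.Ty Γ} {B : T.Ty (T.ext Γ A)} (D : Dep X A)
    (E : Dep (X.ext D) B) {Δ : T.Obj} (o : yoneda.obj Δ ⟶ X.X) (ρ : Δ ⟶ Γ)
    (ho : (Ctx.yo Δ).Over X o ρ) (A' : T.Ty Δ) (hA : A' = T.tySub ρ A)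
    (s : Psh.PiFib D.Y E.Y o) {Θ : T.Obj} (τ : Θ ⟶ Δ) (y : D.Y.obj ⟨op Θ, o.app (op Θ) τ⟩)
    (hy : T.tp (D.ψ y) = T.tySub τ A') :
    E.ψ (s.1 (Psh.piElem D.Y o τ y)) =
      T.tmSub (T.lift τ A' (D.ψ y) hy) (piTerm D E o ρ ho A' hA s) :=
  Dep.ψ_section (E.sub _ (Ctx.up_over (X' := Ctx.yo Δ) D ρ o ho A' hA) _ rfl) s
    (Psh.piElem D.Y o τ y)

/-- The labels of sections of dependent products are compatible with restriction. It suffices to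
consider the values of the sections at the generic element `T.q A''`. -/
theorem piTerm_res {X : Ctx T Γ} {A : T.Ty Γ} {B : T.Ty (T.ext Γ A)}
    (D : Dep X A) (E : Dep (X.ext D) B) {Δ Δ' : T.Obj} (τ : Δ' ⟶ Δ)
    (o : yoneda.obj Δ ⟶ X.X) (ρ : Δ ⟶ Γ)
    (ho : (Ctx.yo Δ).Over X o ρ) (A' : T.Ty Δ) (hA : A' = T.tySub ρ A)
    (o' : yoneda.obj Δ' ⟶ X.X) (ρ' : Δ' ⟶ Γ)
    (ho' : (Ctx.yo Δ').Over X o' ρ') (A'' : T.Ty Δ') (hA' : A'' = T.tySub ρ' A)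
    (h : yoneda.map τ ≫ o = o') (hA'' : A'' = T.tySub τ A')
    (s : Psh.PiFib D.Y E.Y o) :
    piTerm D E o' ρ' ho' _ hA' (Psh.piRes D.Y E.Y τ h s) =
      T.tmSub (T.up τ A' A'' hA'') (piTerm D E o ρ ho _ hA s) := by
  subst h
  let y := D.el ⟨op (T.ext Δ' A''), (yoneda.map τ ≫ o).app _ (T.p A'')⟩ (T.q A'') (by
    rw [T.tp_q]
    refine (congrArg _ hA').trans ((T.tySub_comp _ _ _).symm.trans ?_)
    exact congrArg (fun k => T.tySub k A) (ho' ⟨_, T.p A''⟩).symm)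
  have hy : D.ψ y = T.q A'' := D.ψ_el _ _ _
  have h₁ := ψ_piTerm D E (yoneda.map τ ≫ o) ρ' ho' A'' hA' (Psh.piRes D.Y E.Y τ rfl s)
    (T.p A'') y (by rw [hy, T.tp_q])
  have h₂ := ψ_piTerm D E o ρ ho A' hA s (T.p A'' ≫ τ) y
    ((congrArg T.tp hy).trans (by rw [T.tp_q, T.tySub_comp, ← hA'']))
  have h₃ : T.lift (T.p A'') A'' (D.ψ y) (by rw [hy, T.tp_q]) = 𝟙 _ := by
    apply T.lift_unique
    · rw [T.lift_p, Category.id_comp]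
    · rw [T.lift_q, hy, T.tmSub_id]
  rw [h₃, T.tmSub_id] at h₁
  exact h₁.symm.trans (h₂.trans (congrArg (fun k => T.tmSub k _) (T.lift_congr _ _ rfl hy)))

/-- The labels of sections of dependent products are compatible with substitution. Again, it
suffices to consider the values of the sections at the generic element `T.q A''`. -/
theorem piTerm_sub {X' : Ctx T Γ'} {X : Ctx T Γ} (σ : Γ' ⟶ Γ) (m : X'.X ⟶ X.X)
    (hm : X'.Over X m σ) {A : T.Ty Γ} {B : T.Ty (T.ext Γ A)}
    (D : Dep X A) (E : Dep (X.ext D) B) (A' : T.Ty Γ') (hA : A' = T.tySub σ A)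
    (B' : T.Ty (T.ext Γ' A')) (hB : B' = T.tySub (T.up σ A A' hA) B)
    {Δ : T.Obj} (o : yoneda.obj Δ ⟶ X'.X) (ρ : Δ ⟶ Γ')
    (ho : (Ctx.yo Δ).Over X' o ρ) (A'' : T.Ty Δ) (hA' : A'' = T.tySub ρ A')
    (o' : yoneda.obj Δ ⟶ X.X) (ρ' : Δ ⟶ Γ) (ho' : (Ctx.yo Δ).Over X o' ρ')
    (hA'' : A'' = T.tySub ρ' A) (h : o' = o ≫ m) (s : Psh.PiFib D.Y E.Y o')
    (s' : Psh.PiFib (D.sub m hm A' hA).Y (E.sub _ (Ctx.up_over D σ m hm A' hA) B' hB).Y o)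
    (hs : HEq s s') :
    piTerm D E o' ρ' ho' A'' hA'' s = piTerm (D.sub m hm A' hA)
      (E.sub _ (Ctx.up_over D σ m hm A' hA) B' hB) o ρ ho A'' hA' s' := by
  subst h
  obtain rfl := eq_of_heq hs
  let y := D.el ⟨op (T.ext Δ A''), (o ≫ m).app _ (T.p A'')⟩ (T.q A'') (by
    rw [T.tp_q]
    refine (congrArg _ hA'').trans ((T.tySub_comp _ _ _).symm.trans ?_)
    exact congrArg (fun k => T.tySub k A) (ho' ⟨_, T.p A''⟩).symm)
  have hy : D.ψ y = T.q A'' := D.ψ_el _ _ _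
  have h₁ := ψ_piTerm D E (o ≫ m) ρ' ho' A'' hA'' s
    (T.p A'') y (by rw [hy, T.tp_q])
  have h₂ := ψ_piTerm (D.sub m hm A' hA)
    (E.sub _ (Ctx.up_over D σ m hm A' hA) B' hB) o ρ ho A'' hA' s (T.p A'') y (by
      exact (congrArg T.tp hy).trans (T.tp_q _))
  have h₃ : T.lift (T.p A'') A'' (D.ψ y) (by rw [hy, T.tp_q]) = 𝟙 _ := by
    apply T.lift_unique
    · rw [T.lift_p, Category.id_comp]
    · rw [T.lift_q, hy, T.tmSub_id]
  rw [h₃, T.tmSub_id] at h₁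
  refine h₁.symm.trans (h₂.trans ?_)
  exact (congrArg (fun k => T.tmSub k _) h₃).trans (T.tmSub_id _)

theorem piTerm_inj {X : Ctx T Γ} {A : T.Ty Γ} {B : T.Ty (T.ext Γ A)} (D : Dep X A)
    (E : Dep (X.ext D) B) {Δ : T.Obj} (o : yoneda.obj Δ ⟶ X.X) (ρ : Δ ⟶ Γ)
    (ho : (Ctx.yo Δ).Over X o ρ) (A' : T.Ty Δ) (hA : A' = T.tySub ρ A)
    {s s' : Psh.PiFib D.Y E.Y o} (h : piTerm D E o ρ ho A' hA s = piTerm D E o ρ ho A' hA s') :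
    s = s' :=
  Dep.term_inj (E.sub _ (Ctx.up_over (X' := Ctx.yo Δ) D ρ o ho A' hA) _ rfl) h

theorem exists_piTerm {X : Ctx T Γ} {A : T.Ty Γ} {B : T.Ty (T.ext Γ A)} (D : Dep X A)
    (E : Dep (X.ext D) B) {Δ : T.Obj} (o : yoneda.obj Δ ⟶ X.X) (ρ : Δ ⟶ Γ)
    (ho : (Ctx.yo Δ).Over X o ρ) (A' : T.Ty Δ) (hA : A' = T.tySub ρ A) (b : T.Tm (T.ext Δ A'))
    (hb : T.tp b = T.tySub (T.up ρ A A' hA) B) :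
    ∃ s : Psh.PiFib D.Y E.Y o, piTerm D E o ρ ho A' hA s = b :=
  ⟨_, Dep.term_sec (E.sub _ (Ctx.up_over (X' := Ctx.yo Δ) D ρ o ho A' hA) _ rfl) b hb⟩

theorem piTerm_secSub {X : Ctx T Γ} {A : T.Ty Γ} {B : T.Ty (T.ext Γ A)} (D : Dep X A)
    (E : Dep (X.ext D) B) {Δ : T.Obj} (o : yoneda.obj Δ ⟶ X.X) (ρ : Δ ⟶ Γ)
    (ho : (Ctx.yo Δ).Over X o ρ) (A' : T.Ty Δ) (hA : A' = T.tySub ρ A) (s : E.Y.sections) :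
    piTerm D E o ρ ho A' hA (Psh.secSub _ s) = T.tmSub (T.up ρ A A' hA) (E.term s) :=
  Dep.term_secSub (Ctx.up_over (X' := Ctx.yo Δ) D ρ o ho A' hA) E _ rfl s

/-- Dependent products, labelled by abstractions. An element over `e` is a section over the
extension of a representable presheaf, which is labelled by a term; the abstraction of that term is
its label. -/
noncomputable def Ty.pi (P : T.PiStr R) {X : Ctx T Γ} (t : Ty R X) (t' : Ty T.full (X.ext t.D)) :
    Ty T.full X where
  A := P.pi t.A t'.A
  D :=
    { Y := Psh.pi t.D.Y t'.D.Y
      ψ {e} s := P.lam (R.sub (X.lab e) t.A) (piTerm t.D t'.D (Psh.orb e) (X.lab e)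
        (X.orb_over e) _ (R.ι_sub _ _) s)
      tp_ψ {e} s := by
        rw [P.tp_lam]
        exact (congrArg _ (tp_piTerm _ _ _ _ _ _ _ _)).trans (P.pi_sub _ _ _).symm
      ψ_map {e e'} f s := by
        have key : ∀ (A'' : R.Ty' e'.1.unop) (hA'' : A'' = R.sub f.1.unop (R.sub (X.lab e) t.A))
          (hA' : R.ι A'' = T.tySub (X.lab e') (R.ι t.A)),
          P.lam A'' (piTerm t.D t'.D (Psh.orb e') (X.lab e') (X.orb_over e') _ hA'
            (Psh.piRes t.D.Y t'.D.Y f.1.unop (Psh.orb_map f) s)) =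
          T.tmSub f.1.unop (P.lam (R.sub (X.lab e) t.A) (piTerm t.D t'.D (Psh.orb e) (X.lab e)
            (X.orb_over e) _ (R.ι_sub _ _) s)) := by
          rintro _ rfl hA'
          rw [P.lam_sub]
          exact congrArg _ (piTerm_res _ _ _ _ _ _ _ _ _ _ _ _ _ _ _ _)
        refine key _ ?_ _
        rw [← R.sub_comp, X.lab_map]
      ψ_inj {e} s s' h := by
        apply piTerm_inj t.D t'.D (Psh.orb e) (X.lab e) (X.orb_over e) _ (R.ι_sub _ _)
        exact (P.lam_bijective _ _ _ ((P.tp_lam _ _).trans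
          (congrArg _ (tp_piTerm _ _ _ _ _ _ _ _)))).unique
          ⟨tp_piTerm _ _ _ _ _ _ _ _, h⟩ ⟨tp_piTerm _ _ _ _ _ _ _ _, rfl⟩
      ψ_surj {e} a h := by
        obtain ⟨b, ⟨hb, rfl⟩, -⟩ := P.lam_bijective _ _ a (h.trans (P.pi_sub _ _ _))
        obtain ⟨s, rfl⟩ := exists_piTerm t.D t'.D (Psh.orb e) (X.lab e) (X.orb_over e) _
          (R.ι_sub _ _) b hb
        exact ⟨s, rfl⟩ }

theorem Ty.pi_sub (P : T.PiStr R) {X' : Ctx T Γ'} {X : Ctx T Γ} (σ : Γ' ⟶ Γ)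
    (m : X'.X ⟶ X.X) (hm : X'.Over X m σ) (t : Ty R X) (t' : Ty T.full (X.ext t.D))
    (k : (X'.ext (t.sub σ m hm).D).X ⟶ (X.ext t.D).X)
    (hk : (X'.ext (t.sub σ m hm).D).Over (X.ext t.D) k (T.up σ (R.ι t.A) _ (R.ι_sub σ t.A))) :
    (Ty.pi P t t').sub σ m hm = Ty.pi P (t.sub σ m hm) (t'.sub _ k hk) := by
  obtain rfl := hk.unique (Ctx.up_over t.D σ m hm _ _)
  refine Ty.ext' (P.pi_sub _ _ _) (Psh.pi_sub _ _ _) ?_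
  intro e s s' h
  have key : ∀ (A₁ A₂ : R.Ty' e.1.unop) (hA : A₁ = A₂)
      (h₁ : R.ι A₁ = T.tySub (X.lab ((NatTrans.mapElements m).obj e)) (R.ι t.A))
      (h₂ : R.ι A₂ = T.tySub (X'.lab e) (R.ι (R.sub σ t.A))),
      P.lam A₁ (piTerm t.D t'.D _ _ (X.orb_over ((NatTrans.mapElements m).obj e)) _ h₁ s) =
      P.lam A₂ (piTerm (t.sub σ m hm).D (t'.sub _ _ hk).D _ _ (X'.orb_over e) _ h₂ s') := by
    rintro A₁ _ rfl h₁ h₂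
    exact congrArg _ (piTerm_sub σ m hm t.D t'.D _ _ _ rfl _ _ _ _ _ _ _ _ _
      (Psh.orb_sub m e) s s' h)
  refine key _ _ ?_ _ _
  exact (congrArg (fun k => R.sub k t.A) (hm e)).trans (R.sub_comp _ _ _)

/-- The labelled `Π`-types with arities in a restricted family. -/
noncomputable def piStr (P : T.PiStr R) : (cwf T).PiStr (fam R) where
  pi t t' := Ty.pi P t t'
  pi_sub σ t t' := Ty.pi_sub P σ _ _ t t' _ (Ctx.map_over _ _ _)
  lam {X} t b := ⟨Ty.pi P t b.ty, P.lam t.A b.a, (P.tp_lam _ _).trans (congrArg _ b.tp_a)⟩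
  tp_lam _ _ := rfl
  lam_sub σ t b := Tm.ext' (Ty.pi_sub P σ _ _ t b.ty _ (Ctx.map_over _ _ _)) (P.lam_sub _ _ _)
  lam_bijective t t' f h := by
    obtain ⟨b, ⟨hb, hbf⟩, hu⟩ := P.lam_bijective t.A t'.A f.a (f.tp_a.trans (congrArg Ty.A h))
    refine ⟨⟨t', b, hb⟩, ⟨rfl, Tm.ext' h.symm hbf⟩, ?_⟩
    rintro ⟨_, b', hb'⟩ ⟨rfl, h'⟩
    exact Tm.ext' rfl (hu b' ⟨hb', congrArg Tm.a h'⟩)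

end Labelled

/-! ### The projections of labelled presheaves -/

namespace Labelled

/-- Labelled dependent presheaves are locally representable: the context extensions of `T`
represent them. -/
theorem Dep.isLocRep {T : CwF.{w, w}} {Γ : T.Obj} {X : Ctx T Γ} {A : T.Ty Γ} (D : Dep X A) :
    Psh.Dep.IsLocRep D.Y := by
  rw [Psh.Dep.isLocRep_iff]
  intro e
  let A' := T.tySub (X.lab e) A
  let e' : X.X.Elements := X.X.elementsMk (op (T.ext e.1.unop A')) (X.X.map (T.p A').op e.2)
  let π : e ⟶ e' := CategoryOfElements.homMk _ _ (T.p A').op rfl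
  have hq : T.tp (T.q A') = T.tySub (X.lab e') A := by
    rw [T.tp_q, ← X.lab_map π, T.tySub_comp]; rfl
  refine ⟨e', π, D.el e' (T.q A') hq, fun d f y => ?_⟩
  have hy : T.tp (D.ψ y) = T.tySub f.1.unop A' := by
    rw [D.tp_ψ, ← X.lab_map f, T.tySub_comp]
  have hg : X.X.map (T.lift f.1.unop A' (D.ψ y) hy).op e'.2 = d.2 := by
    refine Eq.trans ?_ f.2
    refine (Psh.map_map X.X (T.p A').op (T.lift f.1.unop A' (D.ψ y) hy).op e.2).trans ?_
    rw [← op_comp, T.lift_p]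
    rfl
  refine ⟨CategoryOfElements.homMk _ _ (T.lift f.1.unop A' (D.ψ y) hy).op hg, ⟨?_, ?_⟩, ?_⟩
  · refine CategoryOfElements.ext _ _ _ ?_
    exact congrArg Quiver.Hom.op (T.lift_p f.1.unop A' (D.ψ y) hy)
  · apply D.ψ_inj
    rw [D.ψ_map, ψ_el]
    exact T.lift_q _ _ _ _
  · rintro g ⟨h₁, h₂⟩
    refine CategoryOfElements.ext _ _ _ (Quiver.Hom.unop_inj (T.lift_unique _ _ _ ?_ ?_))
    · exact (congrArg (fun k => k.1.unop) h₁).trans (T.lift_p f.1.unop A' (D.ψ y) hy).symm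
    · refine Eq.trans ?_ (T.lift_q f.1.unop A' (D.ψ y) hy).symm
      rw [← h₂, D.ψ_map, ψ_el]

variable (T : CwF.{w, w})

/-- The projection to the labels. -/
def fst : CwF.Hom (cwf T) T where
  fn := { obj := fun X => X.Γ, map := fun f => f }
  ty t := t.A
  ty_sub _ _ := rfl
  tm t := t.a
  tm_sub _ _ := rfl
  tp_tm t := t.tp_a
  nil_eq := rfl
  ext_eq _ := rfl
  map_p _ := (Category.id_comp _).symm
  tm_q _ := (T.tmSub_id _).symm

/-- The projection to the underlying presheaves. -/
noncomputable def snd : CwF.Hom (cwf T) (Psh.cwf T.Obj) where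
  fn :=
    { obj := fun X => X.X.X
      map := fun {X' X} σ => X'.X.map X.X σ
      map_id := fun X => (X.X.map_over X.X _).unique (Ctx.Over.id X.X)
      map_comp := fun {_ _ _} _ _ =>
        (Ctx.map_over _ _ _).unique ((Ctx.map_over _ _ _).comp (Ctx.map_over _ _ _)) }
  ty t := t.D.Y
  ty_sub _ _ := rfl
  tm t := ⟨t.ty.D.Y, t.ty.D.sec t.a t.tp_a⟩
  tm_sub {X' X} σ t := congrArg (Sigma.mk _) (Dep.eq_sec _ _ _ _ fun e => by
    refine (t.ty.D.ψ_sec t.a t.tp_a _).trans ?_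
    refine (congrArg (fun k => T.tmSub k t.a) (X'.X.map_over X.X σ e)).trans ?_
    exact T.tmSub_comp _ _ _).symm
  tp_tm _ := rfl
  nil_eq := rfl
  ext_eq _ := rfl
  map_p {X} t := ((Ctx.map_over _ _ _).unique (X.X.p_over t.D)).trans (Category.id_comp _).symm
  tm_q {X} t := by
    refine Eq.trans ?_ ((Psh.cwf T.Obj).tmSub_id _).symm
    refine congrArg (Sigma.mk (Psh.Dep.sub (Psh.p t.D.Y) t.D.Y))
      (Dep.eq_sec _ _ _ _ fun e => ?_).symm
    exact (T.lift_q _ _ _ (t.D.tp_ψ (e := ⟨e.1, e.2.1⟩) e.2.2)).symm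

variable {T}

/-- The projection to the labels, on a restricted family. -/
def fstRes (R : T.Restriction) : CwF.RestrictionHom (fst T) (fam R) R where
  map t := t.A
  map_sub _ _ := rfl
  ι_map _ := rfl

/-- The projection to the underlying dependent presheaves, on a restricted family. -/
noncomputable def sndRes (R : T.Restriction) :
    CwF.RestrictionHom (snd T) (fam R) (Psh.locRep T.Obj) where
  map t := ⟨t.D.Y, t.D.isLocRep⟩
  map_sub _ _ := rfl
  ι_map _ := rfl

theorem fstRes_sigma {R : T.Restriction} (S : T.SigmaStr R) :
    (fstRes R).PreservesSigma (sigmaStr S) S where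
  sig t t' := congrArg (S.sig t.A) (R.sub_id t'.A).symm
  pair _ t' _ _ _ _ _ _ :=
    S.pair_congr rfl (heq_of_eq (R.sub_id t'.A).symm) rfl rfl _ _ _ _

theorem fstRes_pi {R : T.Restriction} (P : T.PiStr R) :
    (fstRes R).PreservesPi (piStr P) P where
  pi t t' := congrArg (P.pi t.A) (T.tySub_id t'.A).symm
  lam t b := congrArg (P.lam t.A) (T.tmSub_id b.a).symm

section
variable {Γ Γ' : T.Obj} {R : T.Restriction}

theorem ψ_pairSec (S : T.SigmaStr R) {X : Ctx T Γ} (t : Ty R X) (t' : Ty R (X.ext t.D))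
    (a b : T.Tm Γ) (ha : T.tp a = R.ι t.A) (hb : T.tp b = T.tySub (T.inst _ a ha) (R.ι t'.A))
    (s : t.D.Y.sections) (hs : ∀ e, t.D.ψ (s.1 e) = T.tmSub (X.lab e) a)
    (u : (Psh.Dep.sub (Psh.lift (𝟙 X.X) t.D.Y s) t'.D.Y).sections)
    (hu : ∀ e, t'.D.ψ (u.1 e) = T.tmSub (X.lab e) b) (e : X.X.Elements) :
    (Ty.sig S t t').D.ψ ((Psh.pairSec s u).1 e) =
      T.tmSub (X.lab e) (S.pair t.A t'.A a b ha hb) := by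
  have h₁ : T.tp a = T.tySub (𝟙 Γ) (R.ι t.A) := ha.trans (T.tySub_id _).symm
  rw [← S.pairAt_id t.A t'.A a b h₁ hb ha hb]
  have h₂ : T.tp (T.tmSub (X.lab e) a) = T.tySub (X.lab e ≫ 𝟙 Γ) (R.ι t.A) := by
    rw [T.tp_sub, h₁, T.tySub_comp]
  have h₃ : T.tp (T.tmSub (X.lab e) b) =
      T.tySub (T.lift (X.lab e ≫ 𝟙 Γ) (R.ι t.A) (T.tmSub (X.lab e) a) h₂) (R.ι t'.A) := by
    rw [T.tp_sub, hb, ← T.comp_lift _ _ _ _ h₁, T.tySub_comp]; rfl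
  refine Eq.trans ?_ (S.pairAt_sub (X.lab e) (𝟙 Γ) t.A t'.A a b h₁ hb h₂ h₃).symm
  exact S.pairAt_congr _ _ (Category.comp_id _).symm (hs e) (hu e) (t.D.tp_ψ (s.1 e))
    (t'.D.tp_ψ (e := (Psh.ext X.X t.D.Y).elementsMk e.1 ⟨e.2, s.1 e⟩) (u.1 e)) h₂ h₃

/-- The values of the section underlying a labelled term `b` of type `t[σ]`. The morphism `m'` over
`σ` that occurs in the type of the section is allowed to differ syntactically from `m`. -/
theorem ψ_termSec {X' : Ctx T Γ'} {X : Ctx T Γ} {σ : Γ' ⟶ Γ} {m m' : X'.X ⟶ X.X}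
    (hm : X'.Over X m σ) (hm' : X'.Over X m' σ) (t : Ty R X) (b : Tm X')
    (hb : b.ty = t.ι.sub σ m hm)
    (h : (⟨b.ty.D.Y, b.ty.D.sec b.a b.tp_a⟩ : Psh.Tm X'.X).1 = Psh.Dep.sub m' t.D.Y)
    (e : X'.X.Elements) :
    t.D.ψ ((Psh.termSec (⟨b.ty.D.Y, b.ty.D.sec b.a b.tp_a⟩ : Psh.Tm X'.X) _ h).1 e) =
      T.tmSub (X'.lab e) b.a := by
  obtain rfl := hm.unique hm'
  obtain ⟨_, b, hb'⟩ := b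
  obtain rfl : _ = t.ι.sub σ m hm := hb
  exact Dep.ψ_sec (t.ι.sub σ m hm).D b hb' e

/-- The projection to the underlying presheaves preserves pairing, for every restricted family. -/
theorem snd_pair (S : T.SigmaStr R) {X : (cwf T).Obj} (t : (fam R).Ty' X)
    (t' : (fam R).Ty' ((cwf T).ext X ((fam R).ι t))) (a b : (cwf T).Tm X)
    (ha : (cwf T).tp a = (fam R).ι t)
    (hb : (cwf T).tp b = (cwf T).tySub ((cwf T).inst _ a ha) ((fam R).ι t'))
    (ha' : ((snd T).tm a).1 = t.D.Y)
    (hb' : ((snd T).tm b).1 =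
      Psh.Dep.sub (Psh.lift (𝟙 X.X.X) t.D.Y (Psh.termSec ((snd T).tm a) _ ha')) t'.D.Y) :
    (snd T).tm ((sigmaStr S).pair t t' a b ha hb) =
      Psh.pair t.D.Y t'.D.Y ((snd T).tm a) ((snd T).tm b) ha' hb' := by
  have h₁ : ∀ e, t.D.ψ ((Psh.termSec ((snd T).tm a) _ ha').1 e) = T.tmSub (X.X.lab e) a.a :=
    fun e => ψ_termSec (Ctx.Over.id X.X) (Ctx.Over.id X.X) t a
      (ha.trans (t.ι.sub_id _).symm) ha' e
  have ha₁ := a.tp_a.trans (congrArg Ty.A ha)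
  have h₂ : X.X.Over (X.X.ext t.D) (Psh.lift (𝟙 X.X.X) t.D.Y (Psh.termSec ((snd T).tm a) _ ha'))
      (T.inst (R.ι t.A) a.a ha₁) :=
    Ctx.lift_over t.D (𝟙 X.Γ) (𝟙 X.X.X) (Ctx.Over.id X.X) a.a _ _ h₁
  refine congrArg (Sigma.mk (Psh.sig t.D.Y t'.D.Y)) (Dep.eq_sec _ _ _ _ fun e => ?_).symm
  exact ψ_pairSec S t t' a.a b.a ha₁ (b.tp_a.trans (congrArg Ty.A hb)) _ h₁ _
    (ψ_termSec _ h₂ t' b hb hb') e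

theorem snd_sigma (S : T.SigmaStr T.full) :
    (CwF.RestrictionHom.full (snd T)).PreservesSigma (sigmaStr S) (Psh.sigmaStr T.Obj) where
  sig _ _ := rfl
  pair t t' a b ha hb ha' hb' := snd_pair S t t' a b ha hb ha' hb'

theorem sndRes_sigma (S : T.SigmaStr R) :
    (sndRes R).PreservesSigma (sigmaStr S) (Psh.locRepSigmaStr T.Obj) where
  sig _ _ := rfl
  pair t t' a b ha hb ha' hb' := snd_pair S t t' a b ha hb ha' hb'

theorem sndRes_pi (P : T.PiStr R) :
    (sndRes R).PreservesPi (piStr P) ((Psh.piStr T.Obj).restrict (Psh.locRep T.Obj)) where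
  pi _ _ := rfl
  lam {X} t b := by
    refine congrArg (Sigma.mk (Psh.pi t.D.Y b.ty.D.Y)) (Dep.eq_sec _ _ _ _ fun e => ?_).symm
    refine Eq.trans ?_ (P.lam_sub _ _ _).symm
    refine congrArg (P.lam _) ((piTerm_secSub _ _ _ _ _ _ _ _).trans ?_)
    exact congrArg (T.tmSub _) (Dep.term_sec b.ty.D b.a b.tp_a)

end

end Labelled

namespace Labelled

variable (T : SPCwF.{w, w})

/-- The `(Σ, Π_rep)`-CwF of labelled presheaves. -/
noncomputable def spCwF : SPCwF.{w + 1, w} where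
  toCwF := cwf T.toCwF
  rep := fam T.rep
  pi := piStr T.pi
  unit := unitStr T.unit
  sigma := sigmaStr T.sigma
  repUnit := unitStr T.repUnit
  repSigma := sigmaStr T.repSigma

/-- The projection to the labels is a strict morphism. -/
noncomputable def spFst : SPCwF.Hom (spCwF T) T where
  toHom := fst T.toCwF
  rep := fstRes T.rep
  pi := fstRes_pi T.pi
  unit _ := rfl
  sigma := fstRes_sigma T.sigma
  repUnit _ := rfl
  repSigma := fstRes_sigma T.repSigma

/-- The projection to the underlying presheaves is a strict morphism. -/
noncomputable def spSnd : SPCwF.Hom (spCwF T) (Psh.spCwF T.Obj) where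
  toHom := snd T.toCwF
  rep := sndRes T.rep
  pi := sndRes_pi T.pi
  unit _ := rfl
  sigma := snd_sigma T.sigma
  repUnit _ := rfl
  repSigma := sndRes_sigma T.repSigma

end Labelled

/-! ### Restriction of structure along embeddings -/

namespace CwF

/-- A strict morphism is an embedding if it is injective on the types and on the terms over each
context, and every term of the image of a type is the image of a term. -/
structure Hom.IsEmbedding {C : CwF.{u₁, v₁}} {D : CwF.{u₂, v₂}} (F : Hom C D) : Prop where
  ty_inj : ∀ {Γ : C.Obj} {A B : C.Ty Γ}, F.ty A = F.ty B → A = B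
  tm_inj : ∀ {Γ : C.Obj} {a b : C.Tm Γ}, F.tm a = F.tm b → a = b
  tm_surj : ∀ {Γ : C.Obj} (A : C.Ty Γ) (t : D.Tm (F.fn.obj Γ)), D.tp t = F.ty A →
    ∃ a, F.tm a = t

namespace RestrictionHom

variable {C : CwF.{u₁, v₁}} {D : CwF.{u₂, v₂}} {F : Hom C D}
  {R : C.Restriction} {S : D.Restriction} (φ : RestrictionHom F R S)

theorem extHom_p {Γ : C.Obj} (A : R.Ty' Γ) :
    φ.extHom A ≫ F.fn.map (C.p (R.ι A)) = D.p (S.ι (φ.map A)) := by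
  have key : ∀ (B : D.Ty (F.fn.obj Γ)) (_ : B = F.ty (R.ι A))
      (h : D.ext (F.fn.obj Γ) B = F.fn.obj (C.ext Γ (R.ι A))),
      eqToHom h ≫ F.fn.map (C.p (R.ι A)) = D.p B := by
    rintro _ rfl h
    rw [F.map_p, eqToHom_trans_assoc, eqToHom_refl, Category.id_comp]
  exact key _ (φ.ι_map A) _

theorem extHom_q {Γ : C.Obj} (A : R.Ty' Γ) :
    D.tmSub (φ.extHom A) (F.tm (C.q (R.ι A))) = D.q (S.ι (φ.map A)) := by
  have key : ∀ (B : D.Ty (F.fn.obj Γ)) (_ : B = F.ty (R.ι A))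
      (h : D.ext (F.fn.obj Γ) B = F.fn.obj (C.ext Γ (R.ι A))),
      D.tmSub (eqToHom h) (F.tm (C.q (R.ι A))) = D.q B := by
    rintro _ rfl h
    rw [F.tm_q, ← D.tmSub_comp, eqToHom_trans, eqToHom_refl, D.tmSub_id]
  exact key _ (φ.ι_map A) _

instance {Γ : C.Obj} (A : R.Ty' Γ) : IsIso (φ.extHom A) := by
  unfold extHom; infer_instance

/-- A morphism to `F(Γ.A)` is determined by its components. -/
theorem extHom_hom_ext (φ : RestrictionHom F R S) {X : D.Obj} {Γ : C.Obj} (A : R.Ty' Γ)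
    (τ τ' : X ⟶ F.fn.obj (C.ext Γ (R.ι A)))
    (h : τ ≫ F.fn.map (C.p (R.ι A)) = τ' ≫ F.fn.map (C.p (R.ι A)))
    (h' : D.tmSub τ (F.tm (C.q (R.ι A))) = D.tmSub τ' (F.tm (C.q (R.ι A)))) : τ = τ' := by
  rw [← cancel_mono (inv (φ.extHom A))]
  apply D.lift_unique
  · simp only [← φ.extHom_p A, Category.assoc, IsIso.inv_hom_id_assoc]
    exact h
  · simp only [← φ.extHom_q A, D.tmSub_comp]
    rw [← D.tmSub_comp (inv _), IsIso.inv_hom_id, D.tmSub_id, h']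

theorem ι_map_sub {Δ Γ : C.Obj} (σ : Δ ⟶ Γ) (A : R.Ty' Γ) :
    S.ι (φ.map (R.sub σ A)) = D.tySub (F.fn.map σ) (S.ι (φ.map A)) := by
  rw [φ.map_sub, S.ι_sub]

theorem extHom_up {Δ Γ : C.Obj} (σ : Δ ⟶ Γ) (A : R.Ty' Γ) :
    φ.extHom (R.sub σ A) ≫ F.fn.map (C.up σ (R.ι A) _ (R.ι_sub σ A)) =
      D.up (F.fn.map σ) (S.ι (φ.map A)) (S.ι (φ.map (R.sub σ A))) (φ.ι_map_sub σ A) ≫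
        φ.extHom A := by
  apply φ.extHom_hom_ext
  · rw [Category.assoc, Category.assoc, ← F.fn.map_comp, φ.extHom_p, up, up, C.lift_p, D.lift_p,
      F.fn.map_comp, ← Category.assoc, φ.extHom_p]
  · rw [D.tmSub_comp, D.tmSub_comp, ← F.tm_sub, φ.extHom_q, up, up, C.lift_q, D.lift_q, φ.extHom_q]

/-- The type required of the second component of a pair in the codomain is the image of the one
required in the domain. -/
theorem tySub_inst {Γ : C.Obj} (A : R.Ty' Γ) (B : R.Ty' (C.ext Γ (R.ι A))) (a : C.Tm Γ)
    (ha : C.tp a = R.ι A) (ha' : D.tp (F.tm a) = S.ι (φ.map A)) :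
    D.tySub (D.inst (S.ι (φ.map A)) (F.tm a) ha') (S.ι (S.sub (φ.extHom A) (φ.map B))) =
      F.ty (C.tySub (C.inst (R.ι A) a ha) (R.ι B)) := by
  rw [F.ty_sub, S.ι_sub, φ.ι_map B, ← D.tySub_comp]
  exact congrArg (fun σ => D.tySub σ (F.ty (R.ι B)))
    (F.map_inst (R.ι A) a ha _ (φ.ι_map A) ha').symm

/-- The compatibility of the action of `F` on dependent types with substitution. The two sides live
over the contexts extended by `F(A)[F(σ)]` and by `F(A[σ])`, which are equal only
propositionally. -/
theorem map_sub_up_heq {Δ Γ : C.Obj} (σ : Δ ⟶ Γ) (A : R.Ty' Γ) (B : R.Ty' (C.ext Γ (R.ι A))) :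
    HEq (S.sub (D.up (F.fn.map σ) (S.ι (φ.map A)) _ (S.ι_sub (F.fn.map σ) (φ.map A)))
        (S.sub (φ.extHom A) (φ.map B)))
      (S.sub (φ.extHom (R.sub σ A)) (φ.map (R.sub (C.up σ (R.ι A) _ (R.ι_sub σ A)) B))) := by
  rw [φ.map_sub (C.up _ _ _ _) B, ← S.sub_comp (φ.extHom (R.sub σ A)), φ.extHom_up, S.sub_comp]
  exact S.sub_up_heq _ _ rfl _

variable (hF : F.IsEmbedding) (hφ : ∀ {Γ : C.Obj} {A B : R.Ty' Γ}, φ.map A = φ.map B → A = B)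

/-- A `𝟏`-type structure on the codomain of an embedding restricts to its domain, if that contains
the `𝟏`-types. -/
noncomputable def unitStr (Y : D.UnitStr S) (one : ∀ Γ, R.Ty' Γ)
    (hone : ∀ Γ, φ.map (one Γ) = Y.one (F.fn.obj Γ)) : C.UnitStr R :=
  have ht (Γ : C.Obj) : ∃ a, F.tm a = Y.tt (F.fn.obj Γ) :=
    hF.tm_surj (R.ι (one Γ)) _ (by rw [Y.tp_tt, ← φ.ι_map, hone])
  { one := one
    one_sub := fun σ => hφ (by rw [φ.map_sub, hone, hone, Y.one_sub])
    tt := fun Γ => (ht Γ).choose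
    tp_tt := fun Γ => hF.ty_inj (by
      rw [← F.tp_tm, (ht Γ).choose_spec, Y.tp_tt, ← φ.ι_map, hone])
    tt_unique := fun {Γ} t h => hF.tm_inj (by
      rw [(ht Γ).choose_spec]
      exact Y.tt_unique _ (by rw [F.tp_tm, h, ← φ.ι_map, hone])) }

section Sigma
variable (Y : D.SigmaStr S)
  (sig : ∀ {Γ : C.Obj} (A : R.Ty' Γ), R.Ty' (C.ext Γ (R.ι A)) → R.Ty' Γ)
  (hsig : ∀ {Γ : C.Obj} (A : R.Ty' Γ) (B : R.Ty' (C.ext Γ (R.ι A))),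
    φ.map (sig A B) = Y.sig (φ.map A) (S.sub (φ.extHom A) (φ.map B)))

theorem tp_fst_map {Γ : C.Obj} (A : R.Ty' Γ) {a : C.Tm Γ} (ha : C.tp a = R.ι A) :
    D.tp (F.tm a) = S.ι (φ.map A) := by rw [F.tp_tm, ha, φ.ι_map]

theorem tp_snd_map {Γ : C.Obj} (A : R.Ty' Γ) (B : R.Ty' (C.ext Γ (R.ι A))) {a b : C.Tm Γ}
    (ha : C.tp a = R.ι A) (hb : C.tp b = C.tySub (C.inst (R.ι A) a ha) (R.ι B)) :
    D.tp (F.tm b) = D.tySub (D.inst (S.ι (φ.map A)) (F.tm a) (φ.tp_fst_map A ha))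
      (S.ι (S.sub (φ.extHom A) (φ.map B))) := by
  rw [φ.tySub_inst A B a ha, F.tp_tm, hb]

theorem exists_pair (hF : F.IsEmbedding)
    (hsig : ∀ {Γ : C.Obj} (A : R.Ty' Γ) (B : R.Ty' (C.ext Γ (R.ι A))),
      φ.map (sig A B) = Y.sig (φ.map A) (S.sub (φ.extHom A) (φ.map B)))
    {Γ : C.Obj} (A : R.Ty' Γ) (B : R.Ty' (C.ext Γ (R.ι A))) (a b : C.Tm Γ)
    (ha : C.tp a = R.ι A) (hb : C.tp b = C.tySub (C.inst (R.ι A) a ha) (R.ι B)) :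
    ∃ t, F.tm t = Y.pair (φ.map A) (S.sub (φ.extHom A) (φ.map B)) (F.tm a) (F.tm b)
      (φ.tp_fst_map A ha) (φ.tp_snd_map A B ha hb) :=
  hF.tm_surj (R.ι (sig A B)) _ (by rw [Y.tp_pair, ← hsig, φ.ι_map])

/-- A `Σ`-type structure on the codomain of an embedding restricts to its domain, if that is closed
under `Σ`-types. -/
noncomputable def sigmaStr : C.SigmaStr R where
  sig := sig
  sig_sub σ A B := hφ (by
    rw [φ.map_sub, hsig, hsig, Y.sig_sub]
    exact Y.sig_congr (φ.map_sub σ A).symm (φ.map_sub_up_heq σ A B))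
  pair A B a b ha hb := (φ.exists_pair Y sig hF hsig A B a b ha hb).choose
  tp_pair A B a b ha hb := hF.ty_inj (by
    rw [← F.tp_tm, (φ.exists_pair Y sig hF hsig A B a b ha hb).choose_spec, Y.tp_pair, ← hsig,
      φ.ι_map])
  pair_sub σ A B a b ha hb ha' hb' := hF.tm_inj (by
    have ha₁ : D.tp (D.tmSub (F.fn.map σ) (F.tm a)) = S.ι (S.sub (F.fn.map σ) (φ.map A)) := by
      rw [← F.tm_sub, ← φ.map_sub]; exact φ.tp_fst_map _ ha'
    rw [F.tm_sub, (φ.exists_pair Y sig hF hsig A B a b ha hb).choose_spec,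
      (φ.exists_pair Y sig hF hsig _ _ _ _ ha' hb').choose_spec]
    refine (Y.pair_sub _ _ _ _ _ _ _ ha₁ ?_).trans (Y.pair_congr (φ.map_sub σ A).symm
      (φ.map_sub_up_heq σ A B) (F.tm_sub _ _).symm (F.tm_sub _ _).symm _ _ _ _)
    have ha₂ : D.tp (F.tm a) = D.tySub (𝟙 _) (S.ι (φ.map A)) := by
      rw [D.tySub_id, φ.tp_fst_map A ha]
    have ha₃ : D.tp (D.tmSub (F.fn.map σ) (F.tm a)) =
        D.tySub (F.fn.map σ) (S.ι (φ.map A)) := by rw [ha₁, S.ι_sub]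
    rw [SigmaStr.tp_snd_at (F.fn.map σ) (φ.map A) _ _ ha₃ ha₁, D.tp_sub,
      φ.tp_snd_map A B ha hb, ← D.tySub_comp, inst, D.comp_lift]
    exact congrArg (fun k => D.tySub k _) (D.lift_congr _ _ (Category.comp_id _) rfl))
  pair_bijective {Γ} A B t ht := by
    obtain ⟨⟨a', b'⟩, ⟨ha', hb', h⟩, hu⟩ := Y.pair_bijective (φ.map A)
      (S.sub (φ.extHom A) (φ.map B)) (F.tm t) (by rw [F.tp_tm, ht, ← φ.ι_map, hsig])
    dsimp only at ha' hb' h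
    obtain ⟨a, rfl⟩ := hF.tm_surj (R.ι A) a' (by rw [ha', φ.ι_map])
    have ha : C.tp a = R.ι A := hF.ty_inj (by rw [← F.tp_tm, ha', φ.ι_map])
    rw [φ.tySub_inst A B a ha ha'] at hb'
    obtain ⟨b, rfl⟩ := hF.tm_surj _ b' hb'
    have hb := hF.ty_inj ((F.tp_tm b).symm.trans hb')
    refine ⟨(a, b), ⟨ha, hb, hF.tm_inj ?_⟩, ?_⟩
    · exact (φ.exists_pair Y sig hF hsig A B a b ha hb).choose_spec.trans h
    · rintro ⟨a₁, b₁⟩ ⟨ha₁, hb₁, rfl⟩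
      have := hu (F.tm a₁, F.tm b₁) ⟨φ.tp_fst_map A ha₁, φ.tp_snd_map A B ha₁ hb₁,
        (φ.exists_pair Y sig hF hsig A B a₁ b₁ ha₁ hb₁).choose_spec.symm⟩
      rw [hF.tm_inj (congrArg Prod.fst this), hF.tm_inj (congrArg Prod.snd this)]

theorem preservesSigma_sigmaStr :
    φ.PreservesSigma (φ.sigmaStr hF hφ Y sig hsig) Y where
  sig := hsig
  pair A B a b ha hb _ _ := (φ.exists_pair Y sig hF hsig A B a b ha hb).choose_spec

end Sigma

section Pi
variable (Y : D.PiStr S) (pi : ∀ {Γ : C.Obj} (A : R.Ty' Γ), C.Ty (C.ext Γ (R.ι A)) → C.Ty Γ)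
  (hpi : ∀ {Γ : C.Obj} (A : R.Ty' Γ) (B : C.Ty (C.ext Γ (R.ι A))),
    F.ty (pi A B) = Y.pi (φ.map A) (D.tySub (φ.extHom A) (F.ty B)))

theorem exists_lam (hF : F.IsEmbedding)
    (hpi : ∀ {Γ : C.Obj} (A : R.Ty' Γ) (B : C.Ty (C.ext Γ (R.ι A))),
      F.ty (pi A B) = Y.pi (φ.map A) (D.tySub (φ.extHom A) (F.ty B)))
    {Γ : C.Obj} (A : R.Ty' Γ) (b : C.Tm (C.ext Γ (R.ι A))) :
    ∃ t, F.tm t = Y.lam (φ.map A) (D.tmSub (φ.extHom A) (F.tm b)) :=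
  hF.tm_surj (pi A (C.tp b)) _ (by rw [Y.tp_lam, hpi, D.tp_sub, F.tp_tm])

/-- A `Π`-type structure on the codomain of an embedding restricts to its domain, if that is closed
under `Π`-types. -/
noncomputable def piStr : C.PiStr R where
  pi := pi
  pi_sub σ A B := hF.ty_inj (by
    rw [F.ty_sub, hpi, hpi, Y.pi_sub]
    refine Y.pi_congr (φ.map_sub σ A).symm ?_
    rw [F.ty_sub, ← D.tySub_comp (φ.extHom (R.sub σ A)), φ.extHom_up, D.tySub_comp]
    exact D.full.sub_up_heq _ _ rfl _)
  lam A b := (φ.exists_lam Y pi hF hpi A b).choose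
  tp_lam A b := hF.ty_inj (by
    rw [← F.tp_tm, (φ.exists_lam Y pi hF hpi A b).choose_spec, Y.tp_lam, hpi, D.tp_sub, F.tp_tm])
  lam_sub σ A b := hF.tm_inj (by
    rw [F.tm_sub, (φ.exists_lam Y pi hF hpi A b).choose_spec,
      (φ.exists_lam Y pi hF hpi _ _).choose_spec, Y.lam_sub]
    refine Y.lam_congr (φ.map_sub σ A).symm ?_
    rw [F.tm_sub, ← D.tmSub_comp (φ.extHom (R.sub σ A)), φ.extHom_up, D.tmSub_comp]
    exact D.tmSub_up_heq _ _ rfl _)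
  lam_bijective {Γ} A B f hf := by
    obtain ⟨b', ⟨hb', h⟩, hu⟩ := Y.lam_bijective (φ.map A) (D.tySub (φ.extHom A) (F.ty B)) (F.tm f)
      (by rw [F.tp_tm, hf, hpi])
    obtain ⟨b, hb⟩ := hF.tm_surj B (D.tmSub (inv (φ.extHom A)) b') (by
      rw [D.tp_sub, hb', ← D.tySub_comp, IsIso.inv_hom_id, D.tySub_id])
    have hb₁ : D.tmSub (φ.extHom A) (F.tm b) = b' := by
      rw [hb, ← D.tmSub_comp, IsIso.hom_inv_id, D.tmSub_id]
    refine ⟨b, ⟨hF.ty_inj ?_, hF.tm_inj ?_⟩, ?_⟩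
    · rw [← F.tp_tm, hb, D.tp_sub, hb', ← D.tySub_comp, IsIso.inv_hom_id, D.tySub_id]
    · rw [(φ.exists_lam Y pi hF hpi A b).choose_spec, hb₁, h]
    · rintro b₁ ⟨rfl, rfl⟩
      have := hu (D.tmSub (φ.extHom A) (F.tm b₁)) ⟨by rw [D.tp_sub, F.tp_tm],
        (φ.exists_lam Y pi hF hpi A b₁).choose_spec.symm⟩
      apply hF.tm_inj
      rw [hb, ← this, ← D.tmSub_comp, IsIso.inv_hom_id, D.tmSub_id]

theorem preservesPi_piStr : φ.PreservesPi (φ.piStr hF Y pi hpi) Y where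
  pi := hpi
  lam A b := (φ.exists_lam Y pi hF hpi A b).choose_spec

end Pi

end RestrictionHom
end CwF

/-! ### The small CwF of coded labelled presheaves -/

namespace Labelled

/-- The dependent presheaf of terms of substitution instances of `A`. -/
def Dep.gen {T : CwF.{w, w}} {Γ : T.Obj} (X : Ctx T Γ) (A : T.Ty Γ) : Dep X A where
  Y := Psh.Dep.sub X.α.hom (Yoneda.ty T A)
  ψ a := a.1
  tp_ψ a := a.2
  ψ_map _ _ := rfl
  ψ_inj _ _ h := Subtype.ext h
  ψ_surj a h := ⟨⟨a, h⟩, rfl⟩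

variable (T : SPCwF.{w, w})

/-- The family of all types (`false`) or of representable types (`true`). -/
def kind : Bool → T.toCwF.Restriction
  | false => T.toCwF.full
  | true => T.rep

/-- The `𝟏`-types of a family of types. -/
def kindUnit : (b : Bool) → T.toCwF.UnitStr (kind T b)
  | false => T.unit
  | true => T.repUnit

/-- The `Σ`-types of a family of types. -/
def kindSigma : (b : Bool) → T.toCwF.SigmaStr (kind T b)
  | false => T.sigma
  | true => T.repSigma

/-- The labels of the codes: a context, or a type in one of the families. -/
inductive Ix : Type w
  | obj (Γ : T.Obj)
  | ty (b : Bool) (Γ : T.Obj) (A : (kind T b).Ty' Γ)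

/-- Codes for the labelled presheaves and labelled dependent presheaves that are generated by the
`Dep.gen` under the operations of a `(Σ, Π_rep)`-CwF. A code for a type does not mention the
labelled presheaf over which it is to be interpreted, so that codes form an ordinary inductive
family. -/
inductive Code : Ix T → Type w
  | nil : Code (.obj T.nil)
  | ext {Γ : T.Obj} {A : (kind T false).Ty' Γ} :
    Code (.obj Γ) → Code (.ty false Γ A) → Code (.obj (T.ext Γ A))
  | gen (b : Bool) (Γ : T.Obj) (A : (kind T b).Ty' Γ) : Code (.ty b Γ A)
  -- The code of `Γ` is recorded, since the substitution in the underlying presheaf depends on it.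
  | sub {b : Bool} {Δ Γ : T.Obj} {A : (kind T b).Ty' Γ} (σ : Δ ⟶ Γ) :
    Code (.obj Γ) → Code (.ty b Γ A) → Code (.ty b Δ ((kind T b).sub σ A))
  | one (b : Bool) (Γ : T.Obj) : Code (.ty b Γ ((kindUnit T b).one Γ))
  | sig {b : Bool} {Γ : T.Obj} {A : (kind T b).Ty' Γ}
    {B : (kind T b).Ty' (T.ext Γ ((kind T b).ι A))} :
    Code (.ty b Γ A) → Code (.ty b (T.ext Γ ((kind T b).ι A)) B) →
      Code (.ty b Γ ((kindSigma T b).sig A B))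
  | pi {Γ : T.Obj} {A : (kind T true).Ty' Γ}
    {B : (kind T false).Ty' (T.ext Γ ((kind T true).ι A))} :
    Code (.ty true Γ A) → Code (.ty false (T.ext Γ ((kind T true).ι A)) B) →
      Code (.ty false Γ (T.pi.pi A B))
  | incl {Γ : T.Obj} {A : (kind T true).Ty' Γ} :
    Code (.ty true Γ A) → Code (.ty false Γ (T.rep.ι A))

/-- The type of interpretations of codes: a type is interpreted over every labelled presheaf. -/
def Interp : Ix T → Type (w + 1)
  | .obj Γ => Ctx T.toCwF Γ
  | .ty b Γ A => ∀ X : Ctx T.toCwF Γ, Dep X ((kind T b).ι A)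

variable {T}

/-- The interpretation of a code. -/
noncomputable def Code.interp : {i : Ix T} → Code T i → Interp T i
  | _, .nil => (cwf T.toCwF).nil.X
  | _, .ext c a => Ctx.ext (T := T.toCwF) c.interp (a.interp c.interp)
  | _, .gen b _ A => fun X => Dep.gen X ((kind T b).ι A)
  | _, .sub (b := b) (A := A) σ d a => fun X =>
    (a.interp d.interp).sub (X.map d.interp σ) (X.map_over d.interp σ) _ ((kind T b).ι_sub σ A)
  | _, .one b _ => fun X => (Ty.unit (kindUnit T b) X).D
  | _, .sig (b := b) (A := A) (B := B) a a' => fun X =>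
    (Ty.sig (kindSigma T b) ⟨A, a.interp X⟩ ⟨B, a'.interp (X.ext (a.interp X))⟩).D
  | _, .pi (A := A) (B := B) a a' => fun X =>
    (Ty.pi T.pi (R := T.rep) ⟨A, a.interp X⟩ ⟨B, a'.interp (X.ext (a.interp X))⟩).D
  | _, .incl a => a.interp

variable (T)

/-- The coded contexts. -/
structure SObj where
  Γ : T.Obj
  code : Code T (.obj Γ)

variable {T}

/-- The labelled presheaf of a coded context. -/
noncomputable def SObj.X (c : SObj T) : Ctx T.toCwF c.Γ := c.code.interp

/-- The interpretation of a code for a type over a coded context. -/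
noncomputable def codeVal (b : Bool) (c : SObj T)
    (a : Σ A : (kind T b).Ty' c.Γ, Code T (.ty b c.Γ A)) : Ty (kind T b) c.X :=
  ⟨a.1, a.2.interp c.X⟩

/-- The coded types over a coded context: codes are identified if their interpretations over the
labelled presheaf of the context agree. -/
noncomputable def STy (b : Bool) (c : SObj T) : Type w := Quotient (Setoid.ker (codeVal b c))

namespace STy

variable {b : Bool} {c : SObj T}

/-- A chosen code of a coded type. -/
noncomputable def code (A : STy b c) : Code T (.ty b c.Γ (Quotient.out A).1) := (Quotient.out A).2

/-- The labelled dependent presheaf of a coded type. -/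
noncomputable def val (A : STy b c) : Ty (kind T b) c.X := codeVal b c (Quotient.out A)

/-- The coded type of a code. -/
noncomputable def mk {A : (kind T b).Ty' c.Γ} (a : Code T (.ty b c.Γ A)) : STy b c :=
  Quotient.mk _ ⟨A, a⟩

theorem val_mk {A : (kind T b).Ty' c.Γ} (a : Code T (.ty b c.Γ A)) :
    (mk a : STy b c).val = ⟨A, a.interp c.X⟩ :=
  Quotient.exact (s := Setoid.ker (codeVal b c)) (Quotient.out_eq _)

theorem val_inj {A B : STy b c} (h : A.val = B.val) : A = B := by
  rw [← Quotient.out_eq A, ← Quotient.out_eq B]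
  exact Quotient.sound (s := Setoid.ker (codeVal b c)) h

/-- Substitution in a coded type. -/
noncomputable def sub {c' c : SObj T} (σ : c'.Γ ⟶ c.Γ) (A : STy b c) : STy b c' :=
  mk (.sub σ c.code A.code)

theorem val_sub {c' c : SObj T} (σ : c'.Γ ⟶ c.Γ) (A : STy b c) :
    (A.sub σ : STy b c').val = A.val.sub σ (c'.X.map c.X σ) (c'.X.map_over c.X σ) :=
  val_mk _

/-- The inclusion of coded representable types in coded types. -/
noncomputable def ι (A : STy true c) : STy false c := mk (.incl A.code)

theorem val_ι (A : STy true c) : A.ι.val = Ty.ι (R := T.rep) A.val := val_mk _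

end STy

/-- The terms of coded types. As in `Tm`, a term is given by its label. -/
structure STm (c : SObj T) where
  ty : STy false c
  a : T.Tm c.Γ
  tp_a : T.tp a = ty.val.A

/-- The labelled term of a term of a coded type. -/
noncomputable def STm.val {c : SObj T} (t : STm c) : Tm c.X := ⟨t.ty.val, t.a, t.tp_a⟩

theorem STm.val_inj {c : SObj T} {t t' : STm c} (h : t.val = t'.val) : t = t' := by
  obtain ⟨A, a, _⟩ := t
  obtain ⟨A', a', _⟩ := t'
  obtain rfl : A = A' := STy.val_inj (congrArg Tm.ty h)
  obtain rfl : a = a' := congrArg Tm.a h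
  rfl

variable (T)

/-- The morphisms between coded contexts are the substitutions between the labels. -/
instance : Category.{w} (SObj T) where
  Hom X Y := X.Γ ⟶ Y.Γ
  id X := 𝟙 X.Γ
  comp f g := f ≫ g
  id_comp f := Category.id_comp (obj := T.Obj) f
  comp_id f := Category.comp_id (obj := T.Obj) f
  assoc f g h := Category.assoc (obj := T.Obj) f g h

/-- The labelled presheaf of a coded context, as a context of labelled presheaves. -/
noncomputable def SObj.val {T : SPCwF.{w, w}} (c : SObj T) : Obj T.toCwF := ⟨c.Γ, c.X⟩

/-- The small category with families of coded labelled presheaves. -/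
noncomputable def smallCwF : CwF.{w, w} where
  Obj := SObj T
  nil := ⟨T.nil, .nil⟩
  nilIsTerminal := Limits.IsTerminal.ofUniqueHom (fun X => T.nilIsTerminal.from X.Γ)
    (fun _ m => T.nilIsTerminal.hom_ext m _)
  Ty := STy false
  tySub σ A := A.sub σ
  tySub_id A := STy.val_inj ((STy.val_sub _ A).trans (A.val.sub_id _))
  tySub_comp {_ c' c} σ τ A := STy.val_inj ((STy.val_sub _ A).trans
    ((A.val.sub_comp (Ctx.map_over _ _ _) (Ctx.map_over c'.X c.X τ) _).trans
      (((STy.val_sub σ (A.sub τ)).trans (congrArg _ (STy.val_sub τ A))).symm)))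
  Tm := STm
  tmSub σ t := ⟨t.ty.sub σ, T.tmSub σ t.a, by
    rw [STy.val_sub]; exact (T.tp_sub _ _).trans (congrArg _ t.tp_a)⟩
  tmSub_id t := STm.val_inj (Tm.ext' ((STy.val_sub _ _).trans (t.ty.val.sub_id _)) (T.tmSub_id _))
  tmSub_comp {_ c' c} σ τ t := STm.val_inj (Tm.ext' ((STy.val_sub _ _).trans
    ((t.ty.val.sub_comp (Ctx.map_over _ _ _) (Ctx.map_over c'.X c.X τ) _).trans
      (((STy.val_sub σ (t.ty.sub τ)).trans (congrArg _ (STy.val_sub τ t.ty))).symm)))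
    (T.tmSub_comp _ _ _))
  tp t := t.ty
  tp_sub _ _ := rfl
  ext c A := ⟨T.ext c.Γ _, .ext c.code A.code⟩
  p A := T.p A.val.A
  q {c} A := ⟨A.sub (c' := ⟨T.ext c.Γ _, .ext c.code A.code⟩) (T.p A.val.A), T.q A.val.A,
    (T.tp_q _).trans (congrArg Ty.A
      (STy.val_sub (c' := ⟨T.ext c.Γ _, .ext c.code A.code⟩) (T.p A.val.A) A)).symm⟩
  tp_q _ := rfl
  lift σ A a h := T.lift σ A.val.A a.a (by
    rw [a.tp_a, h, STy.val_sub]; rfl)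
  lift_p _ _ _ _ := T.lift_p _ _ _ _
  lift_q {c' c} σ A a h := STm.val_inj (by
    have h' : a.val.ty = (cwf T.toCwF).tySub (Δ := c'.val) (Γ := c.val) σ A.val :=
      (congrArg STy.val h).trans (STy.val_sub σ A)
    refine Eq.trans (b := (cwf T.toCwF).tmSub ((cwf T.toCwF).lift (Δ := c'.val) (Γ := c.val)
      σ A.val a.val h') ((cwf T.toCwF).q (Γ := c.val) A.val)) (Tm.ext' ?_ rfl)
      ((cwf T.toCwF).lift_q (Δ := c'.val) (Γ := c.val) σ A.val a.val h')
    refine (STy.val_sub (c' := c') (c := ⟨T.ext c.Γ _, .ext c.code A.code⟩) _ _).trans ?_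
    refine (congrArg _ (STy.val_sub _ A)).trans ?_
    exact congrArg _ ((cwf T.toCwF).tp_q (Γ := c.val) A.val).symm)
  lift_unique A σ τ h h' := T.lift_unique A.val.A σ τ h (congrArg STm.a h')

/-- The interpretation of coded labelled presheaves. -/
noncomputable def smallHom : CwF.Hom (smallCwF T) (cwf T.toCwF) where
  fn := { obj := fun c => SObj.val c, map := fun f => f }
  ty A := STy.val A
  ty_sub σ A := STy.val_sub σ A
  tm t := STm.val t
  tm_sub σ t := Tm.ext' (STy.val_sub σ t.ty) rfl
  tp_tm _ := rfl
  nil_eq := rfl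
  ext_eq _ := rfl
  map_p _ := (Category.id_comp _).symm
  tm_q {c} A := by
    refine Eq.trans (b := (cwf T.toCwF).q (Γ := c.val) A.val) (Tm.ext' ?_ rfl)
      ((cwf T.toCwF).tmSub_id _).symm
    exact (STy.val_sub _ A).trans ((cwf T.toCwF).tp_q (Γ := c.val) A.val).symm

theorem smallHom_isEmbedding : (smallHom T).IsEmbedding where
  ty_inj := STy.val_inj
  tm_inj := STm.val_inj
  tm_surj A t h := ⟨⟨A, t.a, t.tp_a.trans (congrArg Ty.A h)⟩, Tm.ext' h.symm rfl⟩

/-- The coded representable types. -/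
noncomputable def smallRep : (smallCwF T).Restriction where
  Ty' := STy true
  sub σ A := A.sub σ
  sub_id A := STy.val_inj ((STy.val_sub _ A).trans (A.val.sub_id _))
  sub_comp {_ c' c} σ τ A := STy.val_inj ((STy.val_sub _ A).trans
    ((A.val.sub_comp (Ctx.map_over _ _ _) (Ctx.map_over c'.X c.X τ) _).trans
      (((STy.val_sub σ (A.sub τ)).trans (congrArg _ (STy.val_sub τ A))).symm)))
  ι A := A.ι
  ι_sub σ A := STy.val_inj (by
    refine (STy.val_ι _).trans ((congrArg _ (STy.val_sub σ A)).trans ?_)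
    refine (Ty.ι_sub (R := T.rep) _ _ _ _).trans ?_
    exact (congrArg _ (STy.val_ι A)).symm.trans (STy.val_sub σ _).symm)

/-- The interpretation of coded representable types. -/
noncomputable def smallRepHom : CwF.RestrictionHom (smallHom T) (smallRep T) (fam T.rep) where
  map A := STy.val A
  map_sub σ A := STy.val_sub σ A
  ι_map A := (STy.val_ι A).symm

/-- The small `(Σ, Π_rep)`-CwF of coded labelled presheaves. -/
noncomputable def small : SPCwF.{w, w} where
  toCwF := smallCwF T
  rep := smallRep T
  pi := (smallRepHom T).piStr (smallHom_isEmbedding T) (piStr T.pi)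
    (fun {c} A B => STy.mk (c := c)
      (.pi A.code (.sub ((smallRepHom T).extHom A) (SObj.code _) B.code)))
    (fun _ _ => STy.val_mk _)
  unit := (CwF.RestrictionHom.full (smallHom T)).unitStr (smallHom_isEmbedding T) STy.val_inj
    (unitStr T.unit) (fun c => STy.mk (.one false c.Γ)) (fun _ => STy.val_mk _)
  sigma := (CwF.RestrictionHom.full (smallHom T)).sigmaStr (smallHom_isEmbedding T) STy.val_inj
    (sigmaStr T.sigma)
    (fun {c} A B => STy.mk (c := c) (.sig A.code
      (.sub ((CwF.RestrictionHom.full (smallHom T)).extHom A) (SObj.code _) B.code)))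
    (fun _ _ => STy.val_mk _)
  repUnit := (smallRepHom T).unitStr (smallHom_isEmbedding T) STy.val_inj
    (unitStr T.repUnit) (fun c => STy.mk (.one true c.Γ)) (fun _ => STy.val_mk _)
  repSigma := (smallRepHom T).sigmaStr (smallHom_isEmbedding T) STy.val_inj
    (sigmaStr T.repSigma)
    (fun {c} A B => STy.mk (c := c)
      (.sig A.code (.sub ((smallRepHom T).extHom A) (SObj.code _) B.code)))
    (fun _ _ => STy.val_mk _)

/-- The interpretation of coded labelled presheaves is a strict morphism. -/
noncomputable def smallSPHom : SPCwF.Hom (small T) (spCwF T) where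
  toHom := smallHom T
  rep := smallRepHom T
  pi := by
    refine (smallRepHom T).preservesPi_piStr (smallHom_isEmbedding T) _ _ ?_
    exact fun _ _ => STy.val_mk _
  unit _ := STy.val_mk _
  sigma := by
    refine (CwF.RestrictionHom.full (smallHom T)).preservesSigma_sigmaStr
      (smallHom_isEmbedding T) STy.val_inj _ _ ?_
    exact fun _ _ => STy.val_mk _
  repUnit _ := STy.val_mk _
  repSigma := by
    refine (smallRepHom T).preservesSigma_sigmaStr (smallHom_isEmbedding T) STy.val_inj _ _ ?_
    exact fun _ _ => STy.val_mk _

end Labelled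

/-! ### Morphisms that are bijective on terms -/

namespace CwF.Hom

variable {C : CwF.{u₁, v₁}} {D : CwF.{u₂, v₂}} {E : CwF.{u₃, v₃}} {F : Hom C D} {G : Hom D E}

theorem BijectiveOnTerms.comp (hF : F.BijectiveOnTerms) (hG : G.BijectiveOnTerms) :
    (F.comp G).BijectiveOnTerms :=
  fun Γ A => (hG _ (F.ty A)).comp (hF Γ A)

theorem BijectiveOnTerms.of_comp (h : (F.comp G).BijectiveOnTerms) (hG : G.BijectiveOnTerms) :
    F.BijectiveOnTerms := fun Γ A => by
  have hF : Set.MapsTo F.tm {a : C.Tm Γ | C.tp a = A} {b | D.tp b = F.ty A} :=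
    fun a ha => (F.tp_tm a).trans (congrArg F.ty ha)
  refine ⟨hF, fun a ha a' ha' e => (h Γ A).injOn ha ha' (congrArg G.tm e), fun b hb => ?_⟩
  obtain ⟨a, ha, e⟩ := (h Γ A).surjOn ((G.tp_tm b).trans (congrArg G.ty hb))
  exact ⟨a, ha, (hG _ (F.ty A)).injOn (hF ha) hb e⟩

theorem IsEmbedding.bijectiveOnTerms (hF : F.IsEmbedding) : F.BijectiveOnTerms := fun _ A =>
  ⟨fun a ha => (F.tp_tm a).trans (congrArg F.ty ha), fun _ _ _ _ e => hF.tm_inj e,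
    fun b hb => by
      obtain ⟨a, rfl⟩ := hF.tm_surj A b hb
      exact ⟨a, hF.ty_inj ((F.tp_tm a).symm.trans hb), rfl⟩⟩

end CwF.Hom

/-! ### Trivial fibrations -/

namespace SPCwF

/-- The trivial fibrations of `(Σ, Π_rep)`-CwFs: the morphisms which lift types and representable
types, and which are bijective on terms. -/
structure IsTrivialFibration {E B : SPCwF.{u, v}} (π : E ⟶ B) : Prop where
  ty_surj : ∀ {Δ : E.Obj} (A : B.Ty (π.fn.obj Δ)), ∃ A', π.ty A' = A
  rep_surj : ∀ {Δ : E.Obj} (A : B.rep.Ty' (π.fn.obj Δ)), ∃ A', π.rep.map A' = A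
  tm_bij : π.toHom.BijectiveOnTerms

namespace IsTrivialFibration

variable {E B : SPCwF.{u, v}} {π : E ⟶ B}

/-- The lifting of types, for a type whose context is `π(Δ)` only propositionally. -/
theorem exists_ty (hπ : IsTrivialFibration π) (Δ : E.Obj) (s : Σ Γ, B.Ty Γ)
    (h : π.fn.obj Δ = s.1) : ∃ A', (⟨π.fn.obj Δ, π.ty A'⟩ : Σ Γ, B.Ty Γ) = s := by
  obtain ⟨Γ, A⟩ := s
  obtain rfl : _ = Γ := h
  obtain ⟨A', rfl⟩ := hπ.ty_surj A
  exact ⟨A', rfl⟩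

/-- The lifting of representable types, over a context that is `π(Δ)` only propositionally. -/
theorem exists_rep (hπ : IsTrivialFibration π) (Δ : E.Obj) (s : Σ Γ, B.rep.Ty' Γ)
    (h : π.fn.obj Δ = s.1) : ∃ A', (⟨π.fn.obj Δ, π.rep.map A'⟩ : Σ Γ, B.rep.Ty' Γ) = s := by
  obtain ⟨Γ, A⟩ := s
  obtain rfl : _ = Γ := h
  obtain ⟨A', rfl⟩ := hπ.rep_surj A
  exact ⟨A', rfl⟩

/-- The lifting of terms, for a term whose context and type are images under `π` only
propositionally. -/
theorem exists_tm (hπ : IsTrivialFibration π) {Δ : E.Obj} (A : E.Ty Δ) (s : Σ Γ, B.Tm Γ)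
    (h : (⟨π.fn.obj Δ, π.ty A⟩ : Σ Γ, B.Ty Γ) = ⟨s.1, B.tp s.2⟩) :
    ∃ a, E.tp a = A ∧ (⟨π.fn.obj Δ, π.tm a⟩ : Σ Γ, B.Tm Γ) = s := by
  obtain ⟨Γ, b⟩ := s
  obtain rfl : _ = Γ := congrArg Sigma.fst h
  obtain ⟨a, ha, rfl⟩ := (hπ.tm_bij Δ A).surjOn (eq_of_heq (Sigma.mk.inj h).2).symm
  exact ⟨a, ha, rfl⟩

theorem hasLift_of {F G : SPCwF.{u, v}} {i : F ⟶ G} {f : F ⟶ E} {g : G ⟶ B}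
    (sq : CommSq f i π g) (l : G ⟶ E) (h₁ : i ≫ l = f) (h₂ : l ≫ π = g) : sq.HasLift :=
  ⟨⟨{ l := l, fac_left := h₁, fac_right := h₂ }⟩⟩

/-- Trivial fibrations have the right lifting property against the generic extensions: the lift is
obtained from the freeness of the codomain of the extension, and both triangles commute by the
uniqueness part of freeness. -/
theorem rlp (hπ : IsTrivialFibration π) :
    (ITy ⊔ IRepTy ⊔ ITm ⊔ ETm : MorphismProperty SPCwF.{u, v}).rlp π := by
  rintro F G i (((⟨Γ, A, hF, hG⟩ | ⟨Γ, A, hF, hG⟩) | ⟨Γ, A, a, hF, hG, ha⟩) |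
    ⟨Γ, x, y, ⟨h, hF⟩, hG, hxy⟩) <;> refine ⟨fun {f g} sq => ?_⟩
  · obtain ⟨A', hA'⟩ := hπ.exists_ty (f.fn.obj Γ) ⟨g.fn.obj (i.fn.obj Γ), g.ty A⟩
      (congrArg (fun k : F ⟶ B => k.fn.obj Γ) sq.w)
    obtain ⟨l, hl, -⟩ := hG E _ A'
    refine hasLift_of sq l ((hF E _).unique (congrArg Sigma.fst hl) rfl)
      ((hG B _ _).unique (Eq.trans ?_ hA') rfl)
    exact congrArg (fun s : Σ Δ, E.Ty Δ => (⟨π.fn.obj s.1, π.ty s.2⟩ : Σ Δ, B.Ty Δ)) hl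
  · obtain ⟨A', hA'⟩ := hπ.exists_rep (f.fn.obj Γ) ⟨g.fn.obj (i.fn.obj Γ), g.rep.map A⟩
      (congrArg (fun k : F ⟶ B => k.fn.obj Γ) sq.w)
    obtain ⟨l, hl, -⟩ := hG E _ A'
    refine hasLift_of sq l ((hF E _).unique (congrArg Sigma.fst hl) rfl)
      ((hG B _ _).unique (Eq.trans ?_ hA') rfl)
    exact congrArg
      (fun s : Σ Δ, E.rep.Ty' Δ => (⟨π.fn.obj s.1, π.rep.map s.2⟩ : Σ Δ, B.rep.Ty' Δ)) hl
  · obtain ⟨a', ha', hga⟩ := hπ.exists_tm (f.ty A) ⟨g.fn.obj (i.fn.obj Γ), g.tm a⟩ <| by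
      refine (congrArg (fun k : F ⟶ B => (⟨k.fn.obj Γ, k.ty A⟩ : Σ Δ, B.Ty Δ)) sq.w).trans ?_
      exact congrArg (Sigma.mk _) ((congrArg g.ty ha).symm.trans (g.tp_tm a).symm)
    obtain ⟨l, hl, -⟩ := hG E _ a'
    refine hasLift_of sq l ((hF E _ (f.ty A)).unique ?_ rfl)
      ((hG B _ _).unique (Eq.trans ?_ hga) rfl)
    · have h := congrArg (fun s : Σ Δ, E.Tm Δ => (⟨s.1, E.tp s.2⟩ : Σ Δ, E.Ty Δ)) hl
      refine Eq.trans ?_ (h.trans (congrArg (Sigma.mk _) ha'))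
      exact congrArg (Sigma.mk _) ((congrArg l.ty ha).symm.trans (l.tp_tm a).symm)
    · exact congrArg (fun s : Σ Δ, E.Tm Δ => (⟨π.fn.obj s.1, π.tm s.2⟩ : Σ Δ, B.Tm Δ)) hl
  -- For an equation, injectivity on terms shows that it already holds in the domain.
  · have hf : f.tm x = f.tm y := by
      refine (hπ.tm_bij _ (E.tp (f.tm x))).injOn rfl
        ((f.tp_tm y).trans ((congrArg f.ty h.symm).trans (f.tp_tm x).symm)) ?_
      exact (congrArg (fun k : F ⟶ B => k.tm x = k.tm y) sq.w).mpr (congrArg g.tm hxy)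
    obtain ⟨l, hl, -⟩ := hG E _ (f.tm x)
    refine hasLift_of sq l ((hF E _ (f.tm x) (f.tm y) (congrArg E.tp hf)).unique ?_ rfl)
      ((hG B _ _).unique (Eq.trans ?_
        (congrArg (fun k : F ⟶ B => (⟨k.fn.obj Γ, k.tm x⟩ : Σ Δ, B.Tm Δ)) sq.w)) rfl)
    · rw [← hf]
      refine Eq.trans ?_
        (congrArg (fun s : Σ Δ, E.Tm Δ => (⟨s.1, s.2, s.2⟩ : Σ Δ, E.Tm Δ × E.Tm Δ)) hl)
      exact congrArg (fun t => (⟨_, l.tm (i.tm x), l.tm t⟩ : Σ Δ, E.Tm Δ × E.Tm Δ)) hxy.symm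
    · exact congrArg (fun s : Σ Δ, E.Tm Δ => (⟨π.fn.obj s.1, π.tm s.2⟩ : Σ Δ, B.Tm Δ)) hl

/-- Trivial fibrations over a SOGAT split. -/
theorem exists_section {E B : SPCwF.{w, w}} {π : E ⟶ B} (hπ : IsTrivialFibration π)
    (hB : B.IsSOGAT) : ∃ s : B ⟶ E, s ≫ π = 𝟙 B := by
  obtain ⟨O, hO, h⟩ := hB
  have := MorphismProperty.transfiniteCompositionsOfShape_pushouts_coproducts_le_llp_rlp
    _ ℕ _ h π hπ.rlp
  have sq : CommSq (hO.to E) (hO.to B) π (𝟙 B) := ⟨hO.hom_ext _ _⟩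
  exact ⟨sq.lift, sq.fac_right⟩

end IsTrivialFibration

end SPCwF

/-! ### Strictification of the Yoneda embedding -/

namespace Labelled

section

variable {T : CwF.{w, w}}

theorem fst_bijectiveOnTerms : (fst T).BijectiveOnTerms := fun _ t =>
  ⟨fun a ha => a.tp_a.trans (congrArg Ty.A ha),
    fun _ ha _ ha' e => Tm.ext' (ha.trans ha'.symm) e,
    fun b hb => ⟨⟨t, b, hb⟩, rfl, rfl⟩⟩

/-- The sections of a labelled dependent presheaf correspond to the terms of its label. -/
theorem snd_bijectiveOnTerms : (snd T).BijectiveOnTerms := fun X t => by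
  refine ⟨fun _ ha => congrArg (fun t : Ty T.full X.X => t.D.Y) ha, ?_, ?_⟩
  · rintro ⟨_, a, ha⟩ rfl ⟨t', a', ha'⟩ e h
    obtain rfl : t' = _ := e
    refine Tm.ext' rfl ?_
    have h' := eq_of_heq (Sigma.mk.inj h).2
    exact (t'.D.term_sec a ha).symm.trans ((congrArg t'.D.term h').trans (t'.D.term_sec a' ha'))
  · rintro ⟨_, s⟩ rfl
    refine ⟨⟨t, t.D.term s, t.D.tp_term s⟩, rfl, ?_⟩
    exact congrArg (Sigma.mk _) (t.D.term_inj (t.D.term_sec _ _))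

variable {Γ Γ' : T.Obj}

/-- A labelled dependent presheaf over a labelled presheaf `X` is isomorphic to the dependent
presheaf of terms of its label. -/
noncomputable def Dep.isoTy {X : Ctx T Γ} {A : T.Ty Γ} (D : Dep X A) :
    Yoneda.ty T A ≅ Psh.Dep.sub X.α.inv D.Y :=
  Iso.symm <| NatIso.ofComponents (fun e => Equiv.toIso <| Equiv.ofBijective
    (fun y : D.Y.obj ((NatTrans.mapElements X.α.inv).obj e) =>
      (⟨D.ψ y, (D.tp_ψ y).trans (congrArg (fun σ => T.tySub σ A) (X.lab_pt _))⟩ :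
        (Yoneda.ty T A).obj e))
    ⟨fun y y' h => D.ψ_inj y y' (congrArg Subtype.val h), fun a => by
      obtain ⟨y, hy⟩ := D.ψ_surj (e := (NatTrans.mapElements X.α.inv).obj e) a.1
        (a.2.trans (congrArg (fun σ => T.tySub σ A) (X.lab_pt _).symm))
      exact ⟨y, Subtype.ext hy⟩⟩) (fun f => ConcreteCategory.hom_ext _ _ fun y =>
        Subtype.ext (D.ψ_map ((NatTrans.mapElements X.α.inv).map f) y))

theorem Dep.ψ_isoTy {X : Ctx T Γ} {A : T.Ty Γ} (D : Dep X A) (e : (yoneda.obj Γ).Elements)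
    (a : (Yoneda.ty T A).obj e) : D.ψ (D.isoTy.hom.app e a) = a.1 :=
  congrArg (fun k => (k a).1) (D.isoTy.hom_inv_id_app e)

/-- A section of `t.D.Y` over `𝕪(Γ')` whose values are the instances of a term `b` is the
restriction of the section given by `b`. -/
theorem tm_sub_eq {X' : Ctx T Γ'} {X : Ctx T Γ} {σ : Γ' ⟶ Γ} {m : X'.X ⟶ X.X}
    (hm : X'.Over X m σ) (t : Ty T.full X) (b : Tm X') (hb : b.ty = t.sub σ m hm)
    {n : yoneda.obj Γ' ⟶ X.X} (hn : X'.α.inv ≫ m = n) (s : (Psh.Dep.sub n t.D.Y).sections)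
    (hs : ∀ e, t.D.ψ (s.1 e) = T.tmSub (e.2 : e.1.unop ⟶ Γ') b.a) :
    Psh.Tm.sub X'.α.inv ⟨b.ty.D.Y, b.ty.D.sec b.a b.tp_a⟩ = ⟨Psh.Dep.sub n t.D.Y, s⟩ := by
  subst hn
  obtain ⟨_, b, hb'⟩ := b
  obtain rfl : _ = t.sub σ m hm := hb
  refine congrArg (Sigma.mk _) (Subtype.ext (funext fun e => t.D.ψ_inj _ _ ?_))
  refine Eq.trans ?_ (hs e).symm
  refine ((t.sub σ m hm).D.ψ_sec b hb' ((NatTrans.mapElements X'.α.inv).obj e)).trans ?_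
  exact congrArg (fun σ => T.tmSub σ b) (X'.lab_pt _)

/-- The data of a `YonedaTwoCell`, relative to a morphism `h : C ⟶ T`: a `2`-cell `h ≫ 𝕪 ≅ F`. -/
structure RelTwoCell {C : CwF.{u, v}} (h : CwF.Hom C T) (F : CwF.Hom C (Psh.cwf T.Obj)) where
  α : h.fn ⋙ yoneda ≅ F.fn
  ψ : ∀ {Γ : C.Obj} (A : C.Ty Γ), Yoneda.ty T (h.ty A) ≅ Psh.Dep.sub (α.hom.app Γ) (F.ty A)
  tm : ∀ {Δ Γ : C.Obj} (σ : Δ ⟶ Γ) (A : C.Ty Γ) (a : C.Tm Δ)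
    (_ : C.tp a = C.tySub σ A) (ha' : T.tp (h.tm a) = T.tySub (h.fn.map σ) (h.ty A)),
    Psh.Tm.sub (α.hom.app Δ) (F.tm a) =
      ⟨Psh.Dep.sub (yoneda.map (h.fn.map σ) ≫ α.hom.app Γ) (F.ty A),
        (Functor.sectionsFunctor _).map
          (Functor.whiskerLeft (NatTrans.mapElements (yoneda.map (h.fn.map σ))) (ψ A).hom)
          (Yoneda.tm T (h.fn.map σ) (h.ty A) (h.tm a) ha')⟩

/-- The labellings form a `2`-cell from the labels, embedded by Yoneda, to the underlying
presheaves. -/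
noncomputable def relTwoCell {C : CwF.{u, v}} (F : CwF.Hom C (cwf T)) :
    RelTwoCell (F.comp (fst T)) (F.comp (snd T)) where
  α := NatIso.ofComponents (fun Γ => (F.fn.obj Γ).X.α.symm) (fun {Δ Γ} σ =>
    (Iso.inv_hom_id_assoc (F.fn.obj Δ).X.α
      (yoneda.map (show (F.fn.obj Δ).Γ ⟶ (F.fn.obj Γ).Γ from F.fn.map σ) ≫
        (F.fn.obj Γ).X.α.inv)).symm)
  ψ A := (F.ty A).D.isoTy
  tm {Δ Γ} σ A a ha _ := tm_sub_eq (Ctx.map_over _ _ _) (F.ty A) (F.tm a)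
    ((F.tp_tm a).trans ((congrArg F.ty ha).trans (F.ty_sub σ A)))
    (Iso.inv_hom_id_assoc (F.fn.obj Δ).X.α
      (yoneda.map (show (F.fn.obj Δ).Γ ⟶ (F.fn.obj Γ).Γ from F.fn.map σ) ≫ (F.fn.obj Γ).X.α.inv)) _
    (fun _ => (F.ty A).D.ψ_isoTy _ _)

end

variable (T : SPCwF.{w, w})

/-- The projection from coded labelled presheaves to their labels. -/
noncomputable def smallFst : small T ⟶ T := (smallSPHom T).comp (spFst T)

theorem smallFst_isTrivialFibration : SPCwF.IsTrivialFibration (smallFst T) where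
  ty_surj A := ⟨STy.mk (.gen false _ A), congrArg Ty.A (STy.val_mk _)⟩
  rep_surj A := ⟨STy.mk (.gen true _ A), congrArg Ty.A (STy.val_mk _)⟩
  tm_bij := (smallHom_isEmbedding T).bijectiveOnTerms.comp fst_bijectiveOnTerms

variable {T}

theorem bijectiveOnTerms_of_section (s : SPCwF.Hom T (spCwF T))
    (hs : s.comp (spFst T) = SPCwF.Hom.id T) :
    (s.comp (spSnd T)).BijectiveOnTerms := by
  have h : (s.toHom.comp (fst T.toCwF)).BijectiveOnTerms := by
    have e : s.toHom.comp (fst T.toCwF) = CwF.Hom.id T.toCwF :=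
      congrArg (fun k : SPCwF.Hom T T => k.toHom) hs
    rw [e]
    exact fun _ _ => Set.bijOn_id _
  exact (h.of_comp fst_bijectiveOnTerms).comp snd_bijectiveOnTerms

theorem nonempty_yonedaTwoCell_of_section (s : SPCwF.Hom T (spCwF T))
    (hs : s.comp (spFst T) = SPCwF.Hom.id T) :
    Nonempty (YonedaTwoCell (s.comp (spSnd T))) := by
  have e : s.toHom.comp (fst T.toCwF) = CwF.Hom.id T.toCwF :=
    congrArg (fun k : SPCwF.Hom T T => k.toHom) hs
  have key : ∀ h : CwF.Hom T.toCwF T.toCwF, h = CwF.Hom.id T.toCwF →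
      RelTwoCell h (s.comp (spSnd T)).toHom → Nonempty (YonedaTwoCell (s.comp (spSnd T))) := by
    rintro _ rfl c
    exact ⟨{ α := c.α, ψ := c.ψ, tm := fun σ A a h => c.tm σ A a h h }⟩
  exact key _ e (relTwoCell s.toHom)

end Labelled

/-- For every SOGAT `T`, the presheaf model of extensional type theory over `T` has an internal
model of `T` which is bijective on terms and isomorphic to the Yoneda embedding. -/
theorem mainTheorem10 (T : SPCwF.{w, w}) (hT : T.IsSOGAT) :
    ∃ y : SPCwF.Hom T ((Psh.ettModel T.Obj).toSPCwF (Psh.locRep T.Obj)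
        (Psh.locRepUnitStr T.Obj) (Psh.locRepSigmaStr T.Obj)),
      y.BijectiveOnTerms ∧ Nonempty (YonedaTwoCell y) := by
  obtain ⟨s, hs⟩ := (Labelled.smallFst_isTrivialFibration T).exists_section hT
  let t : SPCwF.Hom T (Labelled.spCwF T) := SPCwF.Hom.comp s (Labelled.smallSPHom T)
  exact ⟨t.comp (Labelled.spSnd T), Labelled.bijectiveOnTerms_of_section t hs,
    Labelled.nonempty_yonedaTwoCell_of_section t hs⟩
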